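/- Units $G=c=1$. Let $\rho:[0,\infty)\to[0,\infty)$, $p\mapsto\rho(p)$, be an equation of state that is continuous for $p\ge 0$, $C^\infty$ for $p>0$, with $d\rho/dp>0$ for $p>0$. Put $\rho_b=\rho(0)$ and let $\Lambda\in\mathbb R$ satisfy $\Lambda<4\pi\rho_b$. Let $P_c>0$. For $R\in(0,\infty]$, a *fluid solution on $0\le r<R$ with central pressure $P_c$* is a static, spherically symmetric metric $$ds^2=-e^{\nu(r)}dt^2+e^{a(r)}dr^2+r^2(d\theta^2+\sin^2\theta\,d\phi^2)$$ together with a pressure $P(r)>0$ such that $\nu$ is $C^2$ and $a,P$ are $C^1$ on $0<r<R$, all three are continuous on $0\le r<R$ with $a(0)=0$, $\nu(0)=0$ (which fixes the scale of $t$) and $P(0)=P_c$, and Einstein's equations $G_{\mu\nu}+\Lambda g_{\mu\nu}=8\pi T_{\mu\nu}$ hold for $0<r<R$, where $T_{\mu\nu}=(\rho+P)U_\mu U_\nu+Pg_{\mu\nu}$, $U=-e^{\nu/2}dt$, $\rho=\rho(P(r))$. It is *inextendible* if it is not the restriction of a fluid solution on a larger ball. Then there is a unique inextendible fluid solution $(R,\nu,a,P)$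 with central pressure $P_c$. Its metric and pressure are $C^\infty$ on the ball of radius $R$, including the centre (in Cartesian coordinates), and $P$ is strictly decreasing on $0\le r<R$. Moreover: * If $\Lambda\le 0$, then either (i) the matter occupies the whole space, that is $R=\infty$, and as $r\to\infty$ the pressure tends to a limit $P_\infty\ge0$ and the density tends to $\rho_\infty=\rho(P_\infty)$; or (ii) the matter has finite extent, that is $R=r_b<\infty$ and $P(r)\to0$ as $r\to r_b$, and a unique Schwarzschild–anti-de Sitter solution (Schwarzschild if $\Lambda=0$) is joined on as an exterior field for all $r>r_b$. * If $0<\Lambda<4\pi\rho_b$, then the matter always has finite extent, $R=r_b<\infty$ and $P(r)\to0$ as $r\to r_b$, and a unique Schwarzschild–de Sitter solution is joined on as an exterior field for $r_b<r<r_h$, with $r_h<\infty$. Here the Schwarzschild–(anti-)de Sitter solution of mass $M$ is the vacuum metric $-f\,dt^2+f^{-1}dr^2+r^2d\Omega^2$, $f(r)=1-\frac{2M}{r}-\frac{\Lambda}{3}r^2$, taken on the largest interval starting at $r_b$ on which $f>0$ (so $f(r_h)=0$ in the last case). That it is joined on means that, after adding a constant $c$ to $\nu$ inside (a rescaling of $t$),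 the joined metric solves the field equations with the fluid source for $0<r<r_b$ and without matter outside, and is of class $C^1$ when the radial coordinate is the Gauss coordinate $\chi(r)=\int_0^r e^{a(s)/2}ds$. Both $M$ and $c$ are uniquely determined, and $M=4\pi\int_0^{r_b}s^2\rho(P(s))\,ds$. -/

import Mathlib

open scoped ContDiff

noncomputable section

namespace StaticFluid

/-! ### Curvature in a coordinate chart of `ℝ⁴` -/

/-- Coordinates on (a chart of) spacetime. In the spherical chart used below they are
`(x 0, x 1, x 2, x 3) = (t, r, θ, φ)`. -/
abbrev Coord := Fin 4 → ℝ

/-- A field of `4 × 4` matrices, the components of a covariant 2-tensor in the chart. -/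
abbrev TensorField := Coord → Matrix (Fin 4) (Fin 4) ℝ

/-- The partial derivative `∂f/∂x^μ`. -/
def pd (μ : Fin 4) (f : Coord → ℝ) (x : Coord) : ℝ :=
  deriv (fun s : ℝ => f (Function.update x μ s)) (x μ)

/-- Christoffel symbols
`Γ^ρ_{μν} = ½ g^{ρσ} (∂_μ g_{σν} + ∂_ν g_{σμ} - ∂_σ g_{μν})`. -/
def christoffel (g : TensorField) (ρ μ ν : Fin 4) (x : Coord) : ℝ :=
  (1 / 2) * ∑ σ : Fin 4, (g x)⁻¹ ρ σ *
    (pd μ (fun y => g y σ ν) x + pd ν (fun y => g y σ μ) x - pd σ (fun y => g y μ ν) x)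

/-- Ricci tensor
`R_{μν} = ∂_ρ Γ^ρ_{μν} - ∂_ν Γ^ρ_{μρ} + Γ^σ_{μν} Γ^ρ_{σρ} - Γ^σ_{μρ} Γ^ρ_{σν}`. -/
def ricci (g : TensorField) (μ ν : Fin 4) (x : Coord) : ℝ :=
  ∑ ρ : Fin 4, (pd ρ (christoffel g ρ μ ν) x - pd ν (christoffel g ρ μ ρ) x
    + ∑ σ : Fin 4, (christoffel g σ μ ν x * christoffel g ρ σ ρ x
      - christoffel g σ μ ρ x * christoffel g ρ σ ν x))

/-- Scalar curvature `R = g^{μν} R_{μν}`. -/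
def scalarCurvature (g : TensorField) (x : Coord) : ℝ :=
  ∑ μ : Fin 4, ∑ ν : Fin 4, (g x)⁻¹ μ ν * ricci g μ ν x

/-- Einstein tensor `G_{μν} = R_{μν} - ½ R g_{μν}`. -/
def einstein (g : TensorField) (μ ν : Fin 4) (x : Coord) : ℝ :=
  ricci g μ ν x - (1 / 2) * scalarCurvature g x * g x μ ν

/-! ### Static, spherically symmetric metrics with a perfect fluid -/

/-- The metric `ds² = -e^{ν(r)} dt² + e^{a(r)} dr² + r² (dθ² + sin²θ dφ²)`. -/
def metric (ν a : ℝ → ℝ) : TensorField := fun x =>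
  Matrix.diagonal ![-Real.exp (ν (x 1)), Real.exp (a (x 1)), x 1 ^ 2,
    x 1 ^ 2 * Real.sin (x 2) ^ 2]

/-- The covector `U = -e^{ν/2} dt` of a fluid at rest. -/
def restVelocity (ν : ℝ → ℝ) (x : Coord) : Fin 4 → ℝ :=
  ![-Real.exp (ν (x 1) / 2), 0, 0, 0]

/-- The energy-momentum tensor `T_{μν} = (ρ + P) U_μ U_ν + P g_{μν}` of a perfect fluid at
rest with density `ρ(r)` and pressure `P(r)`. -/
def fluidStress (ν a ρ P : ℝ → ℝ) (α β : Fin 4) (x : Coord) : ℝ :=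
  (ρ (x 1) + P (x 1)) * restVelocity ν x α * restVelocity ν x β
    + P (x 1) * metric ν a x α β

/-- Einstein's field equations `G_{μν} + Λ g_{μν} = 8π T_{μν}` (units `G = c = 1`) at all
points of the spherical chart whose area radius lies in `S`. -/
def FieldEquations (Λ : ℝ) (ν a ρ P : ℝ → ℝ) (S : Set ℝ) : Prop :=
  ∀ x : Coord, x 1 ∈ S → x 2 ∈ Set.Ioo 0 Real.pi → ∀ α β : Fin 4,
    einstein (metric ν a) α β x + Λ * metric ν a x α β
      = 8 * Real.pi * fluidStress ν a ρ P α β x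

/-- The radii `0 ≤ r < R`, where `R ∈ (0, ∞]`. -/
def radii (R : EReal) : Set ℝ := {r | 0 ≤ r ∧ (r : EReal) < R}

/-- The radii `0 < r < R`, where `R ∈ (0, ∞]`. -/
def posRadii (R : EReal) : Set ℝ := {r | 0 < r ∧ (r : EReal) < R}

/-- The equation of state `p ↦ ρ(p)`: defined, non-negative and continuous for `p ≥ 0`, smooth
with `dρ/dp > 0` for `p > 0`. (Values at negative `p` are irrelevant.) -/
structure IsEquationOfState (eos : ℝ → ℝ) : Prop where
  nonneg : ∀ p, 0 ≤ p → 0 ≤ eos p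
  continuousOn : ContinuousOn eos (Set.Ici 0)
  smooth : ContDiffOn ℝ ∞ eos (Set.Ioi 0)
  deriv_pos : ∀ p, 0 < p → 0 < deriv eos p

/-- `(ν, a, P)` is, on the ball `0 ≤ r < R`, a static, spherically symmetric perfect-fluid
solution with equation of state `eos`, positive pressure and central pressure `Pc`.
Off the centre the fields have the differentiability needed to write the field equations; at the
centre they are only asked to be continuous, with `a(0) = 0` (no conical singularity there).
The scale of the time coordinate is fixed by `ν(0) = 0`. -/
structure IsFluidSolution (eos : ℝ → ℝ) (Λ Pc : ℝ) (R : EReal) (ν a P : ℝ → ℝ) : Prop where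
  radius_pos : 0 < R
  nu_contDiffOn : ContDiffOn ℝ 2 ν (posRadii R)
  a_contDiffOn : ContDiffOn ℝ 1 a (posRadii R)
  P_contDiffOn : ContDiffOn ℝ 1 P (posRadii R)
  nu_continuousOn : ContinuousOn ν (radii R)
  a_continuousOn : ContinuousOn a (radii R)
  P_continuousOn : ContinuousOn P (radii R)
  nu_zero : ν 0 = 0
  a_zero : a 0 = 0
  P_zero : P 0 = Pc
  P_pos : ∀ r ∈ radii R, 0 < P r
  field : FieldEquations Λ ν a (fun r => eos (P r)) P (posRadii R)

/-- A fluid solution that is not the restriction of one on a larger ball. -/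
structure IsInextendible (eos : ℝ → ℝ) (Λ Pc : ℝ) (R : EReal) (ν a P : ℝ → ℝ) : Prop where
  solution : IsFluidSolution eos Λ Pc R ν a P
  maximal : ∀ (R' : EReal) (ν' a' P' : ℝ → ℝ), IsFluidSolution eos Λ Pc R' ν' a' P' → R ≤ R' →
    Set.EqOn ν' ν (radii R) → Set.EqOn a' a (radii R) → Set.EqOn P' P (radii R) → R' = R

/-- The components, in Cartesian coordinates `x = r n` with `n` a unit vector, of the spatial
metric `e^{a(r)} dr² + r² dΩ²`, that is `δ_ij + (e^{a(r)} - 1) n_i n_j`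
(and `δ_ij` at `x = 0`). -/
def cartesianMetric (a : ℝ → ℝ) (i j : Fin 3) (x : EuclideanSpace ℝ (Fin 3)) : ℝ :=
  (if i = j then 1 else 0) + (Real.exp (a ‖x‖) - 1) * (x i * x j) / ‖x‖ ^ 2

/-- The metric and the pressure are `C^∞` on the whole ball `‖x‖ < R` of `ℝ³`, centre included. -/
structure IsSmoothOnBall (R : EReal) (ν a P : ℝ → ℝ) : Prop where
  nu_smooth : ContDiffOn ℝ ∞ (fun x : EuclideanSpace ℝ (Fin 3) => ν ‖x‖)
    {x | ((‖x‖ : ℝ) : EReal) < R}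
  cartesian_smooth : ∀ i j : Fin 3, ContDiffOn ℝ ∞ (cartesianMetric a i j)
    {x : EuclideanSpace ℝ (Fin 3) | ((‖x‖ : ℝ) : EReal) < R}
  P_smooth : ContDiffOn ℝ ∞ (fun x : EuclideanSpace ℝ (Fin 3) => P ‖x‖)
    {x | ((‖x‖ : ℝ) : EReal) < R}

/-! ### The vacuum exterior -/

/-- `1 - 2M/r - Λr²/3`, so that the Schwarzschild-(anti-)de Sitter metric is
`-f dt² + dr²/f + r² dΩ²` with `f = sdsFactor Λ M r`, where `f > 0`. -/
def sdsFactor (Λ M r : ℝ) : ℝ := 1 - 2 * M / r - Λ / 3 * r ^ 2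

/-- The function equal to `u` for `r < rb` and to `v` for `r ≥ rb`. -/
def glue (rb : ℝ) (u v : ℝ → ℝ) (r : ℝ) : ℝ := if r < rb then u r else v r

/-- `ν` of the joined metric: inside it is the given one up to the rescaling
`e^ν ↦ e^c e^ν` of time, outside `e^ν = f`. -/
def joinedNu (Λ M c rb : ℝ) (ν : ℝ → ℝ) : ℝ → ℝ :=
  glue rb (fun r => ν r + c) (fun r => Real.log (sdsFactor Λ M r))

/-- `a` of the joined metric: outside `e^a = 1/f`. -/
def joinedA (Λ M rb : ℝ) (a : ℝ → ℝ) : ℝ → ℝ :=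
  glue rb a (fun r => -Real.log (sdsFactor Λ M r))

/-- The Gauss coordinate `χ(r) = ∫₀^r e^{a(s)/2} ds` (proper radial distance). -/
def gaussCoord (a : ℝ → ℝ) (r : ℝ) : ℝ := ∫ s in (0 : ℝ)..r, Real.exp (a s / 2)

/-- In the Gauss coordinate `χ` the metric `-e^ν dt² + dχ² + r(χ)² dΩ²` is of class `C¹` on
`0 < r < R`: the inverse `r(χ)` of `χ(r)` and `e^{ν(r(χ))}` are `C¹` functions of `χ`. -/
def IsC1InGaussCoord (R : EReal) (ν a : ℝ → ℝ) : Prop :=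
  ∃ rad : ℝ → ℝ, (∀ r ∈ posRadii R, rad (gaussCoord a r) = r) ∧
    ContDiffOn ℝ 1 rad (gaussCoord a '' posRadii R) ∧
    ContDiffOn ℝ 1 (fun s => Real.exp (ν (rad s))) (gaussCoord a '' posRadii R)

/-- The Schwarzschild-(anti-)de Sitter metric with mass `M` is joined at `rb` to the fluid
solution `(ν, a, P)` (time being rescaled inside by `c`), as an exterior field on
`rb < r < Re`, the largest interval starting at `rb` on which this metric is static (`f > 0`). -/
structure IsExteriorJoin (eos : ℝ → ℝ) (Λ rb : ℝ) (ν a P : ℝ → ℝ) (M c : ℝ) (Re : EReal) :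
    Prop where
  lt : (rb : EReal) < Re
  static : ∀ r : ℝ, rb ≤ r → (r : EReal) < Re → 0 < sdsFactor Λ M r
  maximal : Re = ⊤ ∨ ∃ rh : ℝ, Re = (rh : EReal) ∧ sdsFactor Λ M rh = 0
  fluid_inside : FieldEquations Λ (joinedNu Λ M c rb ν) (joinedA Λ M rb a)
    (fun r => eos (P r)) P (Set.Ioo 0 rb)
  vacuum_outside : FieldEquations Λ (joinedNu Λ M c rb ν) (joinedA Λ M rb a)
    (fun _ => 0) (fun _ => 0) {r | rb < r ∧ (r : EReal) < Re}
  c1 : IsC1InGaussCoord Re (joinedNu Λ M c rb ν) (joinedA Λ M rb a)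

/-- The mass `m(r) = 4π ∫₀^r s² ρ(s) ds` inside radius `r`. -/
def mass (eos P : ℝ → ℝ) (r : ℝ) : ℝ :=
  4 * Real.pi * ∫ s in (0 : ℝ)..r, s ^ 2 * eos (P s)

/-- The matter has finite extent, with boundary radius `rb` at which the pressure vanishes, and a
unique Schwarzschild-(anti-)de Sitter metric is joined on there; its mass is `m(rb)` and its static
region ends at `Re`. -/
def HasFiniteExtent (eos : ℝ → ℝ) (Λ : ℝ) (R : EReal) (ν a P : ℝ → ℝ) (rb : ℝ) (Re : EReal) :
    Prop :=
  R = (rb : EReal) ∧ Filter.Tendsto P (nhdsWithin rb (Set.Iio rb)) (nhds 0) ∧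
    ∃ c : ℝ, IsExteriorJoin eos Λ rb ν a P (mass eos P rb) c Re ∧
      ∀ (M' c' : ℝ) (Re' : EReal), IsExteriorJoin eos Λ rb ν a P M' c' Re' →
        M' = mass eos P rb ∧ c' = c ∧ Re' = Re

/-- The matter occupies the whole space; pressure and density have limits `P∞ ≥ 0` and
`ρ∞ = ρ(P∞)` as `r → ∞`. -/
def FillsSpace (eos : ℝ → ℝ) (R : EReal) (P : ℝ → ℝ) : Prop :=
  R = ⊤ ∧ ∃ Pinf : ℝ, 0 ≤ Pinf ∧ Filter.Tendsto P Filter.atTop (nhds Pinf) ∧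
    Filter.Tendsto (fun r => eos (P r)) Filter.atTop (nhds (eos Pinf))

end StaticFluid

end

noncomputable section

namespace StaticFluid
open Filter Topology Set

/-! ### Curvature of the static, spherically symmetric metric. -/

section

/-! Einstein's equations for this metric are three ordinary differential equations
(`fieldEquations_iff`). The first integrates to e^{-a} = 1 - 2m/r - Λr²/3, the second gives ν', and
together with the third they imply P' = -(ρ + P)ν'/2. So everything reduces to the
Tolman-Oppenheimer-Volkoff equation for the pressure.

That equation is singular at r = 0. In the variable x = r² the singularity disappears: the mean
density m/r³ becomes the average w(x) = 4π∫₀¹ u² ρ(p(u²x)) du, and the equation becomes p' = -(ρ +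
p)F/(2Y) with Y = 1 - (2w + Λ/3)x (`lapse`) and F = 4πp + w - Λ/3 (`force`). This is a Volterra
equation whose right-hand side at x depends only on p between 0 and x. After truncation it is
Lipschitz and is solved by contraction in an exponentially weighted norm, which gives local
existence, extension and uniqueness (`IsVolterra.exists_solution`, `IsCore.exists_extension`,
`IsCore.eqOn`). The average makes sense for negative x as well, so a solution is smooth on a
neighbourhood of x = 0, and hence metric and pressure are smooth functions of Cartesian coordinates
at the centre.

The condition Λ < 4πρ_b gives F ≥ (4πρ_b - Λ)/3 > 0, so the pressure decreases, and with it the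
density and the mean density. Then e^ν F²/Y is nonincreasing, because its derivative is a positive
multiple of w'. Since ν ≥ 0, this bounds Y below by a positive constant depending only on the
equation of state, Λ and the central pressure (`IsSol.lapse_ge`). Hence the solution cannot break
down through Y → 0; if it stops at a finite radius, the pressure tends to zero there
(`exists_isMaximal`).

If R = ∞, monotonicity gives the limits of pressure and density. For Λ > 0 this case is excluded,
since Y ≤ 0 at r² = 3/Λ. If R = r_b is finite, f with mass m(r_b) agrees with Y at r_b, and as P = 0
there the first derivatives of ν agree too, so the joined metric is C¹. Conversely, C¹ in the Gauss
coordinate forces e^a and e^ν to be continuous across r_b, which fixes M and c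
(`IsC1InGaussCoord.matching`). -/

lemma pd_congr {f g : Coord → ℝ} {x : Coord} (μ : Fin 4) (h : f =ᶠ[𝓝 x] g) :
    pd μ f x = pd μ g x := by
  have hc : Tendsto (fun s : ℝ => Function.update x μ s) (𝓝 (x μ)) (𝓝 x) := by
    have : Continuous (fun s : ℝ => Function.update x μ s) := by fun_prop
    simpa using this.tendsto (x μ)
  exact EventuallyEq.deriv_eq (hc.eventually h)

/-- The points of the spherical chart with area radius in `S`. -/
def chart (S : Set ℝ) : Set Coord := {x | x 1 ∈ S ∧ x 2 ∈ Set.Ioo 0 Real.pi}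

lemma isOpen_chart {S : Set ℝ} (hS : IsOpen S) : IsOpen (chart S) :=
  (hS.preimage (continuous_apply 1)).inter (isOpen_Ioo.preimage (continuous_apply 2))

/-- Data for the derivatives of the metric coefficients. -/
structure MetricDerivs (ν a ν1 ν2 a1 : ℝ → ℝ) (S : Set ℝ) : Prop where
  isOpen : IsOpen S
  pos : ∀ r ∈ S, 0 < r
  nu : ∀ r ∈ S, HasDerivAt ν (ν1 r) r
  nu' : ∀ r ∈ S, HasDerivAt ν1 (ν2 r) r
  a : ∀ r ∈ S, HasDerivAt a (a1 r) r

/-- The partial derivatives `∂_μ g_{ii}` of the metric. -/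
def metricDeriv (ν a ν1 a1 : ℝ → ℝ) (x : Coord) (μ i : Fin 4) : ℝ :=
  ![![0, 0, 0, 0],
    ![-(Real.exp (ν (x 1)) * ν1 (x 1)), Real.exp (a (x 1)) * a1 (x 1), 2 * x 1,
      2 * x 1 * Real.sin (x 2) ^ 2],
    ![0, 0, 0, x 1 ^ 2 * (2 * Real.sin (x 2) * Real.cos (x 2))],
    ![0, 0, 0, 0]] μ i

/-- The nonzero Christoffel symbols of the metric. -/
def christoffelTable (ν a ν1 a1 : ℝ → ℝ) (ρ μ κ : Fin 4) (x : Coord) : ℝ :=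
  ![![![0, ν1 (x 1) / 2, 0, 0], ![ν1 (x 1) / 2, 0, 0, 0], ![0, 0, 0, 0], ![0, 0, 0, 0]],
    ![![ν1 (x 1) * Real.exp (ν (x 1)) * Real.exp (-a (x 1)) / 2, 0, 0, 0], ![0, a1 (x 1) / 2, 0, 0],
      ![0, 0, -x 1 * Real.exp (-a (x 1)), 0],
      ![0, 0, 0, -x 1 * Real.exp (-a (x 1)) * Real.sin (x 2) ^ 2]],
    ![![0, 0, 0, 0], ![0, 0, 1 / x 1, 0], ![0, 1 / x 1, 0, 0],
      ![0, 0, 0, -Real.sin (x 2) * Real.cos (x 2)]],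
    ![![0, 0, 0, 0], ![0, 0, 0, 1 / x 1], ![0, 0, 0, Real.cos (x 2) / Real.sin (x 2)],
      ![0, 1 / x 1, Real.cos (x 2) / Real.sin (x 2), 0]]] ρ μ κ

variable {ν a ν1 ν2 a1 : ℝ → ℝ} {S : Set ℝ}

lemma pd_metric (h : MetricDerivs ν a ν1 ν2 a1 S) {x : Coord} (hx : x ∈ chart S) (μ i j : Fin 4) :
    pd μ (fun y => metric ν a y i j) x = if i = j then metricDeriv ν a ν1 a1 x μ i else 0 := by
  split_ifs with hij
  · subst hij
    have h1 := (h.nu _ hx.1).exp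
    have h2 := (h.a _ hx.1).exp
    have h3 : HasDerivAt (fun s : ℝ => s ^ 2) (2 * x 1) (x 1) := by
      simpa using hasDerivAt_pow 2 (x 1)
    have h4 : HasDerivAt (fun s : ℝ => Real.sin s ^ 2) (2 * Real.sin (x 2) * Real.cos (x 2))
      (x 2) := by simpa using (Real.hasDerivAt_sin (x 2)).fun_pow 2
    have h5 := h3.mul_const (Real.sin (x 2) ^ 2)
    have h6 := h4.const_mul (x 1 ^ 2)
    unfold pd
    fin_cases i <;> fin_cases μ <;>
      simp [metric, metricDeriv, Function.update, h1.deriv, h2.deriv,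
        h3.deriv, h5.deriv, h6.deriv]
  · simp [pd, metric, Matrix.diagonal_apply_ne _ hij]

lemma inv_metric {x : Coord} (hx : x 1 ≠ 0) (hs : Real.sin (x 2) ≠ 0) :
    (metric ν a x)⁻¹ = Matrix.diagonal ![-Real.exp (-ν (x 1)), Real.exp (-a (x 1)), (x 1 ^ 2)⁻¹,
      (x 1 ^ 2 * Real.sin (x 2) ^ 2)⁻¹] := by
  apply Matrix.inv_eq_left_inv
  rw [metric, Matrix.diagonal_mul_diagonal, ← Matrix.diagonal_one]
  congr 1
  ext i
  fin_cases i <;> simp [← Real.exp_add, hx]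
  field_simp

lemma christoffel_eq (h : MetricDerivs ν a ν1 ν2 a1 S) {x : Coord} (hx : x ∈ chart S)
    (ρ μ κ : Fin 4) :
    christoffel (metric ν a) ρ μ κ x = christoffelTable ν a ν1 a1 ρ μ κ x := by
  have hr := (h.pos _ hx.1).ne'
  have hs := (Real.sin_pos_of_mem_Ioo hx.2).ne'
  unfold christoffel
  simp only [pd_metric h hx, inv_metric hr hs, Matrix.diagonal_apply, ite_mul, zero_mul,
    Finset.sum_ite_eq, Finset.mem_univ, if_true]
  have e1 : Real.exp (-ν (x 1)) * Real.exp (ν (x 1)) = 1 := by simp [← Real.exp_add]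
  have e2 : Real.exp (-a (x 1)) * Real.exp (a (x 1)) = 1 := by simp [← Real.exp_add]
  fin_cases ρ <;> fin_cases μ <;> fin_cases κ <;>
    simp [metricDeriv, christoffelTable] <;> (try field_simp) <;>
    first
    | done
    | ring1
    | linear_combination (ν1 (x 1)) * e1
    | linear_combination (a1 (x 1)) * e2

/-- The partial derivatives of the Christoffel symbols. -/
def christoffelDeriv (ν a ν1 ν2 a1 : ℝ → ℝ) (τ ρ μ κ : Fin 4) (x : Coord) : ℝ :=
  ![![![![0, 0, 0, 0], ![0, 0, 0, 0], ![0, 0, 0, 0], ![0, 0, 0, 0]],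
      ![![0, 0, 0, 0], ![0, 0, 0, 0], ![0, 0, 0, 0], ![0, 0, 0, 0]],
      ![![0, 0, 0, 0], ![0, 0, 0, 0], ![0, 0, 0, 0], ![0, 0, 0, 0]],
      ![![0, 0, 0, 0], ![0, 0, 0, 0], ![0, 0, 0, 0], ![0, 0, 0, 0]]],
    ![![![0, ν2 (x 1) / 2, 0, 0], ![ν2 (x 1) / 2, 0, 0, 0], ![0, 0, 0, 0], ![0, 0, 0, 0]],
      ![![(ν2 (x 1) + ν1 (x 1) * (ν1 (x 1) - a1 (x 1))) *
          Real.exp (ν (x 1)) * Real.exp (-a (x 1)) / 2, 0, 0, 0],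
        ![0, deriv a1 (x 1) / 2, 0, 0],
        ![0, 0, (x 1 * a1 (x 1) - 1) * Real.exp (-a (x 1)), 0],
        ![0, 0, 0, (x 1 * a1 (x 1) - 1) * Real.exp (-a (x 1)) * Real.sin (x 2) ^ 2]],
      ![![0, 0, 0, 0], ![0, 0, -(1 / x 1 ^ 2), 0], ![0, -(1 / x 1 ^ 2), 0, 0], ![0, 0, 0, 0]],
      ![![0, 0, 0, 0], ![0, 0, 0, -(1 / x 1 ^ 2)], ![0, 0, 0, 0], ![0, -(1 / x 1 ^ 2), 0, 0]]],
    ![![![0, 0, 0, 0], ![0, 0, 0, 0], ![0, 0, 0, 0], ![0, 0, 0, 0]],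
      ![![0, 0, 0, 0], ![0, 0, 0, 0], ![0, 0, 0, 0],
        ![0, 0, 0, -x 1 * Real.exp (-a (x 1)) * (2 * Real.sin (x 2) * Real.cos (x 2))]],
      ![![0, 0, 0, 0], ![0, 0, 0, 0], ![0, 0, 0, 0],
        ![0, 0, 0, Real.sin (x 2) ^ 2 - Real.cos (x 2) ^ 2]],
      ![![0, 0, 0, 0], ![0, 0, 0, 0], ![0, 0, 0, -(1 / Real.sin (x 2) ^ 2)],
        ![0, 0, -(1 / Real.sin (x 2) ^ 2), 0]]],
    ![![![0, 0, 0, 0], ![0, 0, 0, 0], ![0, 0, 0, 0], ![0, 0, 0, 0]],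
      ![![0, 0, 0, 0], ![0, 0, 0, 0], ![0, 0, 0, 0], ![0, 0, 0, 0]],
      ![![0, 0, 0, 0], ![0, 0, 0, 0], ![0, 0, 0, 0], ![0, 0, 0, 0]],
      ![![0, 0, 0, 0], ![0, 0, 0, 0], ![0, 0, 0, 0], ![0, 0, 0, 0]]]] τ ρ μ κ

set_option maxHeartbeats 800000 in
lemma pd_christoffelTable (h : MetricDerivs ν a ν1 ν2 a1 S) {x : Coord} (hx : x ∈ chart S)
    (τ ρ μ κ : Fin 4) :
    pd τ (christoffelTable ν a ν1 a1 ρ μ κ) x = christoffelDeriv ν a ν1 ν2 a1 τ ρ μ κ x := by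
  have hr := (h.pos _ hx.1).ne'
  have hs := (Real.sin_pos_of_mem_Ioo hx.2).ne'
  have ha := (h.a _ hx.1).fun_neg.exp
  have e1 : deriv (fun s => ν1 s / 2) (x 1) = ν2 (x 1) / 2 := ((h.nu' _ hx.1).div_const 2).deriv
  have e2 : deriv (fun s => ν1 s * Real.exp (ν s) * Real.exp (-a s)) (x 1) =
      (ν2 (x 1) + ν1 (x 1) * (ν1 (x 1) - a1 (x 1))) * Real.exp (ν (x 1)) * Real.exp (-a (x 1)) := by
    rw [(((h.nu' _ hx.1).fun_mul (h.nu _ hx.1).exp).fun_mul ha).deriv]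
    ring
  have e3 : deriv (fun s => s * Real.exp (-a s)) (x 1) =
      -((x 1 * a1 (x 1) - 1) * Real.exp (-a (x 1))) := by
    rw [((hasDerivAt_id' (x 1)).fun_mul ha).deriv]
    ring
  have e6 : deriv (fun s => Real.sin s ^ 2) (x 2) = 2 * Real.sin (x 2) * Real.cos (x 2) := by
    rw [((Real.hasDerivAt_sin (x 2)).fun_pow 2).deriv]
    simp
  have e7 : deriv (fun s => Real.sin s * Real.cos s) (x 2) =
      -(Real.sin (x 2) ^ 2 - Real.cos (x 2) ^ 2) := by
    rw [((Real.hasDerivAt_sin (x 2)).fun_mul (Real.hasDerivAt_cos (x 2))).deriv]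
    ring
  have e8 : deriv (fun s => Real.cos s / Real.sin s) (x 2) = -(Real.sin (x 2) ^ 2)⁻¹ := by
    rw [((Real.hasDerivAt_cos (x 2)).fun_div (Real.hasDerivAt_sin (x 2)) hs).deriv]
    field_simp
    linear_combination -(Real.sin_sq_add_cos_sq (x 2))
  unfold pd
  fin_cases τ
  · fin_cases ρ <;> fin_cases μ <;> fin_cases κ <;>
      simp [christoffelTable, christoffelDeriv, Function.update]
  · fin_cases ρ <;> fin_cases μ <;> fin_cases κ <;>
      simp [christoffelTable, christoffelDeriv, Function.update, e1, e2, e3]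
  · fin_cases ρ <;> fin_cases μ <;> fin_cases κ <;>
      simp [christoffelTable, christoffelDeriv, Function.update, e6, e7, e8]
  · fin_cases ρ <;> fin_cases μ <;> fin_cases κ <;>
      simp [christoffelTable, christoffelDeriv, Function.update]

/-- The closed form of the Christoffel symbols holds on the whole open chart, so it may be
differentiated. -/
lemma pd_christoffel (h : MetricDerivs ν a ν1 ν2 a1 S) {x : Coord} (hx : x ∈ chart S)
    (τ ρ μ κ : Fin 4) :
    pd τ (christoffel (metric ν a) ρ μ κ) x = christoffelDeriv ν a ν1 ν2 a1 τ ρ μ κ x := by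
  rw [← pd_christoffelTable h hx]
  apply pd_congr
  filter_upwards [(isOpen_chart h.isOpen).mem_nhds hx] with y hy using christoffel_eq h hy ρ μ κ

/-- The Ricci tensor of the metric. -/
def ricciTable (ν a ν1 ν2 a1 : ℝ → ℝ) (x : Coord) : Fin 4 → ℝ :=
  ![Real.exp (ν (x 1)) * Real.exp (-a (x 1)) * (ν2 (x 1) / 2 + ν1 (x 1) ^ 2 / 4
      - ν1 (x 1) * a1 (x 1) / 4 + ν1 (x 1) / x 1),
    -(ν2 (x 1) / 2) - ν1 (x 1) ^ 2 / 4 + ν1 (x 1) * a1 (x 1) / 4 + a1 (x 1) / x 1,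
    1 - Real.exp (-a (x 1)) * (1 + x 1 * (ν1 (x 1) - a1 (x 1)) / 2),
    (1 - Real.exp (-a (x 1)) * (1 + x 1 * (ν1 (x 1) - a1 (x 1)) / 2)) * Real.sin (x 2) ^ 2]

/-- The only second derivative of `a`, in ∂_r Γ^r_{rr}, enters R_{rr} twice with opposite signs and
cancels. This is why no differentiability of `a1` is needed. -/
lemma ricci_eq (h : MetricDerivs ν a ν1 ν2 a1 S) {x : Coord} (hx : x ∈ chart S)
    (μ κ : Fin 4) :
    ricci (metric ν a) μ κ x = if μ = κ then ricciTable ν a ν1 ν2 a1 x μ else 0 := by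
  have hr := (h.pos _ hx.1).ne'
  have hs := (Real.sin_pos_of_mem_Ioo hx.2).ne'
  have hsc := Real.sin_sq_add_cos_sq (x 2)
  unfold ricci
  simp only [pd_christoffel h hx, christoffel_eq h hx, Fin.sum_univ_four]
  fin_cases μ <;> fin_cases κ <;>
    simp [christoffelTable, christoffelDeriv, ricciTable]
  all_goals (try field_simp)
  · ring
  · ring
  · ring
  · linear_combination -2 * hsc
  · ring

end

/-! ### The field equations as ordinary differential equations. -/

section

variable {ν a ν1 ν2 a1 : ℝ → ℝ} {S : Set ℝ}

/-- The Einstein tensor of the metric. -/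
def einsteinTable (ν a ν1 ν2 a1 : ℝ → ℝ) (x : Coord) : Fin 4 → ℝ :=
  ![Real.exp (ν (x 1)) * (1 - Real.exp (-a (x 1)) + x 1 * a1 (x 1) * Real.exp (-a (x 1)))
      / x 1 ^ 2,
    ν1 (x 1) / x 1 - (Real.exp (a (x 1)) - 1) / x 1 ^ 2,
    x 1 ^ 2 * Real.exp (-a (x 1)) * (ν2 (x 1) / 2 + ν1 (x 1) ^ 2 / 4
      - ν1 (x 1) * a1 (x 1) / 4 + (ν1 (x 1) - a1 (x 1)) / (2 * x 1)),
    x 1 ^ 2 * Real.exp (-a (x 1)) * (ν2 (x 1) / 2 + ν1 (x 1) ^ 2 / 4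
      - ν1 (x 1) * a1 (x 1) / 4 + (ν1 (x 1) - a1 (x 1)) / (2 * x 1)) * Real.sin (x 2) ^ 2]

lemma einstein_eq (h : MetricDerivs ν a ν1 ν2 a1 S) {x : Coord} (hx : x ∈ chart S)
    (μ κ : Fin 4) :
    einstein (metric ν a) μ κ x = if μ = κ then einsteinTable ν a ν1 ν2 a1 x μ else 0 := by
  have hr := (h.pos _ hx.1).ne'
  have hs := (Real.sin_pos_of_mem_Ioo hx.2).ne'
  unfold einstein scalarCurvature
  simp only [ricci_eq h hx, inv_metric hr hs, Matrix.diagonal_apply, ite_mul, zero_mul,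
    Finset.sum_ite_eq, Finset.mem_univ, if_true, mul_ite, mul_zero]
  simp only [metric, Matrix.diagonal_apply, mul_ite, mul_zero]
  split_ifs with hμ
  · subst hμ
    have e1 : Real.exp (ν (x 1)) ≠ 0 := (Real.exp_pos _).ne'
    have e2 : Real.exp (a (x 1)) ≠ 0 := (Real.exp_pos _).ne'
    simp only [Fin.sum_univ_four, ricciTable, einsteinTable, Real.exp_neg]
    fin_cases μ <;> simp <;> field_simp <;> ring
  · simp

/-- For a static, spherically symmetric metric Einstein's equations with a perfect fluid at rest
are three ordinary differential equations. -/
theorem fieldEquations_iff (h : MetricDerivs ν a ν1 ν2 a1 S) (Λ : ℝ) (ρ P : ℝ → ℝ) :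
    FieldEquations Λ ν a ρ P S ↔ ∀ r ∈ S,
      1 - Real.exp (-a r) + r * a1 r * Real.exp (-a r) = r ^ 2 * (8 * Real.pi * ρ r + Λ) ∧
      Real.exp (-a r) * (1 + r * ν1 r) = 1 + r ^ 2 * (8 * Real.pi * P r - Λ) ∧
      Real.exp (-a r) * (ν2 r / 2 + ν1 r ^ 2 / 4 - ν1 r * a1 r / 4 + (ν1 r - a1 r) / (2 * r)) =
        8 * Real.pi * P r - Λ := by
  have key : ∀ x ∈ chart S, ∀ α β : Fin 4,
      (einstein (metric ν a) α β x + Λ * metric ν a x α β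
        = 8 * Real.pi * fluidStress ν a ρ P α β x) ↔
      (if α = β then einsteinTable ν a ν1 ν2 a1 x α else 0) + Λ * metric ν a x α β
        = 8 * Real.pi * fluidStress ν a ρ P α β x := by
    intro x hx α β
    rw [einstein_eq h hx]
  have hsq : ∀ y : ℝ, Real.exp (y / 2) * Real.exp (y / 2) = Real.exp y := fun y => by
    rw [← Real.exp_add]; ring_nf
  constructor
  · intro H r hr
    have hr0 := (h.pos r hr).ne'
    -- On the equator sin θ = 1, and the tt, rr and θθ components there already give the three
    -- equations.
    set x : Coord := ![0, r, Real.pi / 2, 0] with hxdef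
    have hx : x ∈ chart S := ⟨hr, by simp [hxdef, Real.pi_pos]⟩
    have e1 : Real.exp (ν r) ≠ 0 := (Real.exp_pos _).ne'
    have e2 : Real.exp (a r) ≠ 0 := (Real.exp_pos _).ne'
    have H0 := (key x hx 0 0).1 (H x hx.1 hx.2 0 0)
    have H1 := (key x hx 1 1).1 (H x hx.1 hx.2 1 1)
    have H2 := (key x hx 2 2).1 (H x hx.1 hx.2 2 2)
    simp only [fluidStress, restVelocity, metric, einsteinTable, hxdef, Real.exp_neg, if_true,
      Matrix.diagonal_apply] at H0 H1 H2
    simp at H0 H1 H2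
    have hs := hsq (ν r)
    simp only [Real.exp_neg]
    refine ⟨?_, ?_, ?_⟩
    · rw [mul_assoc _ (Real.exp _) (Real.exp _), hs] at H0
      field_simp at H0 ⊢
      linear_combination H0
    · field_simp at H1 ⊢
      linear_combination H1
    · field_simp at H2 ⊢
      linear_combination H2
  · intro H x hx1 hx2 α β
    rw [key x ⟨hx1, hx2⟩]
    obtain ⟨H0, H1, H2⟩ := H _ hx1
    have hr0 := (h.pos _ hx1).ne'
    have e1 : Real.exp (ν (x 1)) ≠ 0 := (Real.exp_pos _).ne'
    have e2 : Real.exp (a (x 1)) ≠ 0 := (Real.exp_pos _).ne'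
    have hs := hsq (ν (x 1))
    simp only [Real.exp_neg] at H0 H1 H2
    simp only [fluidStress, restVelocity, metric, einsteinTable, Real.exp_neg,
      Matrix.diagonal_apply]
    fin_cases α <;> fin_cases β <;> simp
    · rw [H0, mul_assoc _ (Real.exp (ν (x 1) / 2)), hs]
      field_simp
      ring
    · field_simp at H1 ⊢
      linear_combination H1
    · rw [mul_assoc (x 1 ^ 2), H2]
      ring
    · rw [mul_assoc (x 1 ^ 2), H2]
      ring

end

/-! ### Averages over balls as functions of x = r². -/

section

/-- The averages `∫₀¹ u^k f(u² x) du`. -/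
def moment (k : ℕ) (f : ℝ → ℝ) (x : ℝ) : ℝ := ∫ u in (0 : ℝ)..1, u ^ k * f (u ^ 2 * x)

lemma sq_mul_mem_Icc {a b x u : ℝ} (ha : a ≤ 0) (hb : 0 ≤ b) (hx : x ∈ Icc a b)
    (hu : u ∈ Icc (0 : ℝ) 1) : u ^ 2 * x ∈ Icc a b := by
  have h1 : u ^ 2 ≤ 1 := pow_le_one₀ hu.1 hu.2
  have h0 : 0 ≤ u ^ 2 := sq_nonneg u
  obtain ⟨h2, h3⟩ := hx
  constructor <;> nlinarith

lemma moment_congr {k : ℕ} {f g : ℝ → ℝ} {a b x : ℝ} (ha : a ≤ 0) (hb : 0 ≤ b)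
    (hfg : EqOn f g (Icc a b)) (hx : x ∈ Icc a b) : moment k f x = moment k g x := by
  refine intervalIntegral.integral_congr fun u hu => ?_
  rw [uIcc_of_le zero_le_one] at hu
  simp only [hfg (sq_mul_mem_Icc ha hb hx hu)]

lemma moment_continuous (k : ℕ) {f : ℝ → ℝ} (hf : Continuous f) : Continuous (moment k f) := by
  apply intervalIntegral.continuous_parametric_intervalIntegral_of_continuous'
  fun_prop

/-- A function continuous on a compact interval agrees there with a continuous function. -/
lemma exists_continuous_eqOn {f : ℝ → ℝ} {a b : ℝ} (hab : a ≤ b) (hf : ContinuousOn f (Icc a b)) :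
    ∃ g : ℝ → ℝ, Continuous g ∧ EqOn f g (Icc a b) :=
  ⟨IccExtend hab ((Icc a b).domRestrict f), hf.domRestrict.Icc_extend',
    fun x hx => by rw [IccExtend_of_mem hab _ hx]; rfl⟩

lemma moment_continuousOn (k : ℕ) {f : ℝ → ℝ} {a b : ℝ} (ha : a ≤ 0) (hb : 0 ≤ b)
    (hf : ContinuousOn f (Icc a b)) : ContinuousOn (moment k f) (Icc a b) := by
  obtain ⟨g, hg, hfg⟩ := exists_continuous_eqOn (ha.trans hb) hf
  exact (moment_continuous k hg).continuousOn.congr fun x hx => moment_congr ha hb hfg hx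

lemma moment_integrand_continuousOn (k : ℕ) {f : ℝ → ℝ} {a b x : ℝ} (ha : a ≤ 0) (hb : 0 ≤ b)
    (hf : ContinuousOn f (Icc a b)) (hx : x ∈ Icc a b) :
    ContinuousOn (fun u : ℝ => u ^ k * f (u ^ 2 * x)) (Icc 0 1) :=
  (continuous_pow k).continuousOn.mul
    (hf.comp (by fun_prop) fun _ hu => sq_mul_mem_Icc ha hb hx hu)

lemma moment_const (k : ℕ) (c x : ℝ) : moment k (fun _ => c) x = c / (k + 1) := by
  simp [moment, integral_pow]
  ring

lemma moment_mono (k : ℕ) {f g : ℝ → ℝ} {a b x : ℝ} (ha : a ≤ 0) (hb : 0 ≤ b)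
    (hf : ContinuousOn f (Icc a b)) (hg : ContinuousOn g (Icc a b)) (hx : x ∈ Icc a b)
    (hfg : ∀ s ∈ Icc a b, f s ≤ g s) : moment k f x ≤ moment k g x := by
  refine intervalIntegral.integral_mono_on zero_le_one ?_ ?_ fun u hu => ?_
  · exact (moment_integrand_continuousOn k ha hb hf hx).intervalIntegrable_of_Icc zero_le_one
  · exact (moment_integrand_continuousOn k ha hb hg hx).intervalIntegrable_of_Icc zero_le_one
  · exact mul_le_mul_of_nonneg_left (hfg _ (sq_mul_mem_Icc ha hb hx hu)) (pow_nonneg hu.1 k)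

/-- Monotonicity is applied to f ≤ g + D and g ≤ f + D; the constant D contributes D/(k + 1). -/
lemma abs_moment_sub_le (k : ℕ) {f g : ℝ → ℝ} {a b x D : ℝ} (ha : a ≤ 0) (hb : 0 ≤ b)
    (hf : ContinuousOn f (Icc a b)) (hg : ContinuousOn g (Icc a b)) (hx : x ∈ Icc a b)
    (hfg : ∀ s ∈ Icc a b, |f s - g s| ≤ D) : |moment k f x - moment k g x| ≤ D / (k + 1) := by
  have e : ∀ h₁ h₂ : ℝ → ℝ, ContinuousOn h₁ (Icc a b) → ContinuousOn h₂ (Icc a b) →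
      moment k (fun s => h₁ s + h₂ s) x = moment k h₁ x + moment k h₂ x := by
    intro h₁ h₂ hc₁ hc₂
    rw [moment, moment, moment, ← intervalIntegral.integral_add]
    · simp only [mul_add]
    · exact (moment_integrand_continuousOn k ha hb hc₁ hx).intervalIntegrable_of_Icc zero_le_one
    · exact (moment_integrand_continuousOn k ha hb hc₂ hx).intervalIntegrable_of_Icc zero_le_one
  have h1 := moment_mono k ha hb hf (hg.add continuousOn_const) hx
    (g := fun s => g s + D) fun s hs => by linarith [(abs_le.1 (hfg s hs)).2]
  have h2 := moment_mono k ha hb hg (hf.add continuousOn_const) hx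
    (g := fun s => f s + D) fun s hs => by linarith [(abs_le.1 (hfg s hs)).1]
  rw [e _ _ hg continuousOn_const, moment_const] at h1
  rw [e _ _ hf continuousOn_const, moment_const] at h2
  exact abs_le.2 ⟨by linarith, by linarith⟩

lemma exists_Icc_subset_Ioo {A B x : ℝ} (hA : A < 0) (hB : 0 < B) (hx : x ∈ Ioo A B) :
    ∃ a b, a < 0 ∧ 0 < b ∧ x ∈ Ioo a b ∧ Icc a b ⊆ Ioo A B := by
  obtain ⟨a, h1, h2⟩ := exists_between (lt_min hA hx.1)
  obtain ⟨b, h3, h4⟩ := exists_between (max_lt hB hx.2)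
  exact ⟨a, b, (lt_min_iff.1 h2).1, (max_lt_iff.1 h3).1, ⟨(lt_min_iff.1 h2).2, (max_lt_iff.1 h3).2⟩,
    fun y hy => ⟨h1.trans_le hy.1, hy.2.trans_lt h4⟩⟩

/-- Differentiation under the integral: the inner derivative of u²x supplies the factor u² that
raises k by 2. The dominating constant is a bound for f' on a compact interval containing 0 and a
neighbourhood of x, which also contains every u²y used. -/
lemma moment_hasDerivAt (k : ℕ) {f f' : ℝ → ℝ} {A B x : ℝ} (hA : A < 0) (hB : 0 < B)
    (hf : ∀ s ∈ Ioo A B, HasDerivAt f (f' s) s) (hf' : ContinuousOn f' (Ioo A B))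
    (hx : x ∈ Ioo A B) : HasDerivAt (moment k f) (moment (k + 2) f' x) x := by
  obtain ⟨a, b, ha, hb, hxab, hsub⟩ := exists_Icc_subset_Ioo hA hB hx
  have hfc : ContinuousOn f (Icc a b) := fun s hs => (hf s (hsub hs)).continuousAt.continuousWithinAt
  obtain ⟨C, hC⟩ := isCompact_Icc.exists_bound_of_continuousOn (hf'.mono hsub)
  have hm : ∀ (j : ℕ) (g : ℝ → ℝ) (y : ℝ), ContinuousOn g (Icc a b) → y ∈ Icc a b →
      MeasureTheory.AEStronglyMeasurable (fun u : ℝ => u ^ j * g (u ^ 2 * y))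
        (MeasureTheory.volume.restrict (uIoc 0 1)) := by
    intro j g y hg hy
    rw [uIoc_of_le zero_le_one]
    exact ((moment_integrand_continuousOn j ha.le hb.le hg hy).mono
      Ioc_subset_Icc_self).aestronglyMeasurable measurableSet_Ioc
  refine (intervalIntegral.hasDerivAt_integral_of_dominated_loc_of_deriv_le
    (F := fun y u => u ^ k * f (u ^ 2 * y)) (F' := fun y u => u ^ (k + 2) * f' (u ^ 2 * y))
    (bound := fun _ => C) (isOpen_Ioo.mem_nhds hxab) ?_ ?_ ?_ ?_ ?_ ?_).2
  · filter_upwards [isOpen_Ioo.mem_nhds hxab] with y hy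
    exact hm k f y hfc (Ioo_subset_Icc_self hy)
  · exact (moment_integrand_continuousOn k ha.le hb.le hfc
      (Ioo_subset_Icc_self hxab)).intervalIntegrable_of_Icc zero_le_one
  · exact hm (k + 2) f' x (hf'.mono hsub) (Ioo_subset_Icc_self hxab)
  · refine Eventually.of_forall fun u hu y hy => ?_
    rw [uIoc_of_le zero_le_one] at hu
    have hu' : u ∈ Icc (0 : ℝ) 1 := Ioc_subset_Icc_self hu
    rw [norm_mul, Real.norm_of_nonneg (pow_nonneg hu'.1 _)]
    have h1 := hC _ (sq_mul_mem_Icc ha.le hb.le (Ioo_subset_Icc_self hy) hu')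
    have h2 : u ^ (k + 2) ≤ 1 := pow_le_one₀ hu'.1 hu'.2
    calc u ^ (k + 2) * ‖f' (u ^ 2 * y)‖ ≤ 1 * ‖f' (u ^ 2 * y)‖ := by gcongr
      _ ≤ C := by rwa [one_mul]
  · exact intervalIntegrable_const
  · refine Eventually.of_forall fun u hu y hy => ?_
    rw [uIoc_of_le zero_le_one] at hu
    have hu' : u ∈ Icc (0 : ℝ) 1 := Ioc_subset_Icc_self hu
    have h1 := hf _ (hsub (sq_mul_mem_Icc ha.le hb.le (Ioo_subset_Icc_self hy) hu'))
    have h2 : HasDerivAt (fun y : ℝ => u ^ 2 * y) (u ^ 2) y := by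
      simpa using (hasDerivAt_id' y).const_mul (u ^ 2)
    have h3 := (h1.comp y h2).const_mul (u ^ k)
    exact h3.congr_deriv (by ring)

/-- The induction on n runs over all k at once, since each derivative shifts k. This is what makes
m/r³ smooth across the centre. -/
lemma moment_contDiffOn_nat (n k : ℕ) {f : ℝ → ℝ} {A B : ℝ} (hA : A < 0) (hB : 0 < B)
    (hf : ContDiffOn ℝ n f (Ioo A B)) : ContDiffOn ℝ n (moment k f) (Ioo A B) := by
  induction n generalizing k f with
  | zero =>
    simp only [Nat.cast_zero, contDiffOn_zero] at hf ⊢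
    intro x hx
    obtain ⟨a, b, ha, hb, hxab, hsub⟩ := exists_Icc_subset_Ioo hA hB hx
    exact ((moment_continuousOn k ha.le hb.le (hf.mono hsub)).continuousAt
      (Icc_mem_nhds hxab.1 hxab.2)).continuousWithinAt
  | succ n ih =>
    rw [Nat.cast_add, Nat.cast_one, contDiffOn_succ_iff_deriv_of_isOpen isOpen_Ioo] at hf ⊢
    obtain ⟨h1, -, h2⟩ := hf
    have hd : ∀ x ∈ Ioo A B, HasDerivAt (moment k f) (moment (k + 2) (deriv f) x) x :=
      fun x hx => moment_hasDerivAt k hA hB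
        (fun s hs => (h1.differentiableAt (isOpen_Ioo.mem_nhds hs)).hasDerivAt) h2.continuousOn hx
    exact ⟨fun x hx => (hd x hx).differentiableAt.differentiableWithinAt, by simp,
      (ih (k + 2) h2).congr fun x hx => (hd x hx).deriv⟩

/-- Integrate d/du (u³ f(u²x)) over [0, 1]. For the density this is dm/dr = 4πr²ρ in the form 2xw' +
3w = 4πρ. -/
lemma two_mul_moment_add {f f' : ℝ → ℝ} {A B x : ℝ} (hA : A < 0) (hB : 0 < B)
    (hf : ∀ s ∈ Ioo A B, HasDerivAt f (f' s) s) (hf' : ContinuousOn f' (Ioo A B))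
    (hx : x ∈ Ioo A B) : 2 * x * moment 4 f' x + 3 * moment 2 f x = f x := by
  obtain ⟨a, b, ha, hb, hxab, hsub⟩ := exists_Icc_subset_Ioo hA hB hx
  have hfc : ContinuousOn f (Icc a b) := fun s hs => (hf s (hsub hs)).continuousAt.continuousWithinAt
  have hx' := Ioo_subset_Icc_self hxab
  have c1 := (moment_integrand_continuousOn 4 ha.le hb.le (hf'.mono hsub)
    hx').intervalIntegrable_of_Icc (μ := MeasureTheory.volume) zero_le_one
  have c2 := (moment_integrand_continuousOn 2 ha.le hb.le hfc
    hx').intervalIntegrable_of_Icc (μ := MeasureTheory.volume) zero_le_one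
  have key := intervalIntegral.integral_eq_sub_of_hasDerivAt (a := 0) (b := 1)
    (f := fun u : ℝ => u ^ 3 * f (u ^ 2 * x))
    (f' := fun u => 2 * x * (u ^ 4 * f' (u ^ 2 * x)) + 3 * (u ^ 2 * f (u ^ 2 * x))) (fun u hu => ?_)
    ((c1.const_mul _).add (c2.const_mul _))
  · rw [intervalIntegral.integral_add (c1.const_mul _) (c2.const_mul _),
      intervalIntegral.integral_const_mul, intervalIntegral.integral_const_mul] at key
    simpa [moment] using key
  · rw [uIcc_of_le zero_le_one] at hu
    have h1 := hf _ (hsub (sq_mul_mem_Icc ha.le hb.le hx' hu))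
    have h2 : HasDerivAt (fun u : ℝ => u ^ 2 * x) (2 * u * x) u := by
      simpa using (hasDerivAt_pow 2 u).mul_const x
    have h4 : HasDerivAt (fun u : ℝ => u ^ 3) (3 * u ^ 2) u := by simpa using hasDerivAt_pow 3 u
    exact (h4.fun_mul (h1.comp u h2)).congr_deriv (by simp only [Function.comp]; ring)

/-- Substitution s = ru; it links the average with the mass integral. -/
lemma cube_mul_moment (f : ℝ → ℝ) (r : ℝ) :
    r ^ 3 * moment 2 f (r ^ 2) = ∫ s in (0 : ℝ)..r, s ^ 2 * f (s ^ 2) := by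
  have h := intervalIntegral.smul_integral_comp_mul_left (fun s => s ^ 2 * f (s ^ 2)) r
    (a := 0) (b := 1)
  simp only [mul_zero, mul_one, smul_eq_mul] at h
  rw [← h, moment, ← intervalIntegral.integral_const_mul, ← intervalIntegral.integral_const_mul]
  refine intervalIntegral.integral_congr fun u _ => ?_
  rw [show (r * u) ^ 2 = u ^ 2 * r ^ 2 by ring]
  ring

end

/-! ### Volterra equations. -/

section

/-- Integrating an exponential weight of rate l gains a factor 1/l, which beats any Lipschitz
constant once l is large. Negative x is reduced to positive x by reflection. -/
lemma abs_integral_le_exp {h : ℝ → ℝ} {M l : ℝ} (hl : 0 < l) {x : ℝ}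
    (hM : ∀ s ∈ uIcc 0 x, |h s| ≤ M * Real.exp (l * |s|)) :
    |∫ s in (0 : ℝ)..x, h s| ≤ M / l * (Real.exp (l * |x|) - 1) := by
  have pos : ∀ (g : ℝ → ℝ) (y : ℝ), 0 ≤ y → (∀ s ∈ Icc 0 y, |g s| ≤ M * Real.exp (l * s)) →
      |∫ s in (0 : ℝ)..y, g s| ≤ M / l * (Real.exp (l * y) - 1) := by
    intro g y hy hg
    have h1 := intervalIntegral.norm_integral_le_of_norm_le (a := 0) (b := y) (f := g)
      (g := fun s => M * Real.exp (l * s)) (μ := MeasureTheory.volume) hy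
      (Eventually.of_forall fun s hs => hg s (Ioc_subset_Icc_self hs))
      (Continuous.intervalIntegrable (by fun_prop) _ _)
    rw [intervalIntegral.integral_const_mul, intervalIntegral.integral_comp_mul_left _ hl.ne',
      integral_exp] at h1
    simp only [Real.norm_eq_abs, mul_zero, Real.exp_zero, smul_eq_mul] at h1
    calc _ ≤ _ := h1
      _ = _ := by ring
  rcases le_total 0 x with hx | hx
  · rw [abs_of_nonneg hx]
    refine pos h x hx fun s hs => ?_
    have := hM s (by rwa [uIcc_of_le hx])
    rwa [abs_of_nonneg hs.1] at this
  · rw [abs_of_nonpos hx]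
    have h2 := pos (fun s => h (-s)) (-x) (by linarith) fun s hs => by
      have := hM (-s) (by rw [uIcc_of_ge hx]; exact ⟨by linarith [hs.2], by linarith [hs.1]⟩)
      rwa [abs_neg, abs_of_nonneg hs.1] at this
    rwa [intervalIntegral.integral_comp_neg, neg_neg, neg_zero, intervalIntegral.integral_symm,
      abs_neg] at h2

/-- A causal, bounded, Lipschitz operator, the right-hand side of a Volterra equation
`p' = K p`. -/
structure IsVolterra (K : (ℝ → ℝ) → ℝ → ℝ) (B L : ℝ) : Prop where
  B_nonneg : 0 ≤ B
  L_nonneg : 0 ≤ L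
  cont : ∀ p, Continuous p → Continuous (K p)
  bound : ∀ p, Continuous p → ∀ x, |K p x| ≤ B
  lip : ∀ p q, Continuous p → Continuous q → ∀ x D, (∀ s ∈ uIcc 0 x, |p s - q s| ≤ D) →
    |K p x - K q x| ≤ L * D

variable {K : (ℝ → ℝ) → ℝ → ℝ} {B L : ℝ}

lemma abs_le_of_mem_uIcc {s x : ℝ} (h : s ∈ uIcc 0 x) : |s| ≤ |x| := by
  simpa using abs_sub_left_of_mem_uIcc h

/-- Banach's fixed point theorem for u = e^{-l|x|} p in the bounded continuous functions on all of
ℝ. Boundedness of K keeps |p| ≤ |c| + B|x|, so u is bounded; the weight makes the map a contraction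
globally, with no restriction to short intervals. -/
theorem IsVolterra.exists_solution (hK : IsVolterra K B L) (c : ℝ) :
    ∃ p : ℝ → ℝ, Continuous p ∧ ∀ x, p x = c + ∫ s in (0 : ℝ)..x, K p s := by
  -- This choice gives L/l ≤ 1/2 for the contraction, and l ≥ 1, which yields |x| e^{-l|x|} ≤ 1
  -- below.
  set l : ℝ := 2 * L + 1 with hl
  have hL := hK.L_nonneg
  have hl0 : 0 < l := by positivity
  let up : BoundedContinuousFunction ℝ ℝ → ℝ → ℝ := fun u x => Real.exp (l * |x|) * u x
  have hup : ∀ u, Continuous (up u) := fun u => by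
    have := u.continuous
    fun_prop
  have hI : ∀ u, Continuous fun x => ∫ s in (0 : ℝ)..x, K (up u) s := fun u =>
    intervalIntegral.continuous_primitive
      (fun a b => (hK.cont _ (hup u)).intervalIntegrable a b) 0
  let Φ : BoundedContinuousFunction ℝ ℝ → BoundedContinuousFunction ℝ ℝ := fun u =>
    BoundedContinuousFunction.ofNormedAddCommGroup
      (fun x => Real.exp (-(l * |x|)) * (c + ∫ s in (0 : ℝ)..x, K (up u) s))
      (by have := hI u; fun_prop) (|c| + B) (by
        intro x
        have h1 : |∫ s in (0 : ℝ)..x, K (up u) s| ≤ B * |x| := by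
          have := intervalIntegral.norm_integral_le_of_norm_le_const (a := 0) (b := x)
            (f := K (up u)) (C := B) (fun s _ => hK.bound _ (hup u) s)
          simpa using this
        have h2 : Real.exp (-(l * |x|)) * |x| ≤ 1 := by
          rw [Real.exp_neg, inv_mul_le_iff₀ (Real.exp_pos _), mul_one]
          have := Real.add_one_le_exp (l * |x|)
          nlinarith [abs_nonneg x]
        have h3 : Real.exp (-(l * |x|)) ≤ 1 := Real.exp_le_one_iff.2 (by
          have := abs_nonneg x
          have : 0 ≤ l * |x| := by positivity
          linarith)
        rw [Real.norm_eq_abs, abs_mul, abs_of_pos (Real.exp_pos _)]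
        calc _ ≤ Real.exp (-(l * |x|)) * (|c| + B * |x|) := by
              gcongr
              exact (abs_add_le _ _).trans (by linarith)
          _ = Real.exp (-(l * |x|)) * |c| + B * (Real.exp (-(l * |x|)) * |x|) := by ring
          _ ≤ 1 * |c| + B * 1 := by
              have := hK.B_nonneg
              gcongr
          _ = _ := by ring)
  have hΦ : ContractingWith (1 / 2) Φ := by
    refine ⟨by norm_num [← NNReal.coe_lt_coe], LipschitzWith.of_dist_le_mul fun u v => ?_⟩
    rw [BoundedContinuousFunction.dist_le (by positivity)]
    intro x
    have hsub : Φ u x - Φ v x =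
        Real.exp (-(l * |x|)) * ∫ s in (0 : ℝ)..x, (K (up u) s - K (up v) s) := by
      rw [intervalIntegral.integral_sub ((hK.cont _ (hup u)).intervalIntegrable _ _)
        ((hK.cont _ (hup v)).intervalIntegrable _ _)]
      simp only [Φ, BoundedContinuousFunction.coe_ofNormedAddCommGroup]
      ring
    have hd : ∀ s, |K (up u) s - K (up v) s| ≤ L * dist u v * Real.exp (l * |s|) := by
      intro s
      have := hK.lip (up u) (up v) (hup u) (hup v) s (dist u v * Real.exp (l * |s|)) fun t ht => by
        simp only [up]
        rw [← mul_sub, abs_mul, abs_of_pos (Real.exp_pos _), mul_comm]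
        have h1 : |u t - v t| ≤ dist u v := u.dist_coe_le_dist t
        have h2 := abs_le_of_mem_uIcc ht
        gcongr
      linarith
    rw [Real.dist_eq, hsub, abs_mul, abs_of_pos (Real.exp_pos _)]
    have h1 := abs_integral_le_exp (h := fun s => K (up u) s - K (up v) s)
      (M := L * dist u v) hl0 (x := x) fun s _ => hd s
    have h2 : Real.exp (-(l * |x|)) * Real.exp (l * |x|) = 1 := by simp [← Real.exp_add]
    have h3 : L / l ≤ 1 / 2 := by rw [div_le_div_iff₀ hl0 two_pos]; linarith
    have h4 : 0 ≤ dist u v := dist_nonneg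
    have h5 := Real.exp_pos (-(l * |x|))
    calc _ ≤ Real.exp (-(l * |x|)) * (L * dist u v / l * (Real.exp (l * |x|) - 1)) := by gcongr
      _ = L / l * dist u v * (Real.exp (-(l * |x|)) * Real.exp (l * |x|))
          - L / l * dist u v * Real.exp (-(l * |x|)) := by ring
      _ ≤ L / l * dist u v := by
          rw [h2, mul_one]
          have : 0 ≤ L / l * dist u v * Real.exp (-(l * |x|)) := by positivity
          linarith
      _ ≤ _ := by push_cast; gcongr
  have hfix : Φ (hΦ.fixedPoint Φ) = hΦ.fixedPoint Φ := hΦ.fixedPoint_isFixedPt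
  set u := hΦ.fixedPoint Φ
  refine ⟨up u, hup u, fun x => ?_⟩
  have h1 : u x = Real.exp (-(l * |x|)) * (c + ∫ s in (0 : ℝ)..x, K (up u) s) := by
    conv_lhs => rw [← hfix]
    rfl
  simp only [up]
  rw [h1, ← mul_assoc, ← Real.exp_add]
  simp [up]

/-- The maximum k over [0, X] of e^{-ls}|p - q| satisfies k ≤ k/2. Causality of K is what lets the
equations be assumed on [0, X] only. -/
theorem IsVolterra.eqOn (hK : IsVolterra K B L) {c X : ℝ} {p q : ℝ → ℝ} (hp : Continuous p)
    (hq : Continuous q) (hpK : ∀ x ∈ Icc 0 X, p x = c + ∫ s in (0 : ℝ)..x, K p s)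
    (hqK : ∀ x ∈ Icc 0 X, q x = c + ∫ s in (0 : ℝ)..x, K q s) : EqOn p q (Icc 0 X) := by
  intro y hy
  set l : ℝ := 2 * L + 1 with hl
  have hL := hK.L_nonneg
  have hl0 : 0 < l := by positivity
  obtain ⟨x, hx, hmax⟩ := isCompact_Icc.exists_isMaxOn (⟨y, hy⟩ : (Icc (0 : ℝ) X).Nonempty)
    (f := fun s => Real.exp (-(l * s)) * |p s - q s|) (by fun_prop)
  set k := Real.exp (-(l * x)) * |p x - q x| with hk
  have hexp : ∀ s, Real.exp (l * s) * Real.exp (-(l * s)) = 1 := fun s => by simp [← Real.exp_add]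
  have hle : ∀ s ∈ Icc 0 X, |p s - q s| ≤ k * Real.exp (l * s) := by
    intro s hs
    have h1 : Real.exp (-(l * s)) * |p s - q s| ≤ k := hmax hs
    calc |p s - q s| = (Real.exp (-(l * s)) * |p s - q s|) * Real.exp (l * s) := by
          rw [mul_right_comm, mul_comm (Real.exp (-(l * s))), hexp, one_mul]
      _ ≤ _ := by gcongr
  have hk0 : 0 ≤ k := by positivity
  have hd : |∫ s in (0 : ℝ)..x, (K p s - K q s)| ≤ L * k / l * (Real.exp (l * |x|) - 1) := by
    refine abs_integral_le_exp hl0 fun s hs => ?_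
    rw [uIcc_of_le hx.1] at hs
    rw [abs_of_nonneg hs.1, mul_assoc]
    refine hK.lip p q hp hq s _ fun t ht => ?_
    rw [uIcc_of_le hs.1] at ht
    refine (hle t ⟨ht.1, ht.2.trans (hs.2.trans hx.2)⟩).trans ?_
    have := ht.2
    gcongr
  rw [intervalIntegral.integral_sub ((hK.cont _ hp).intervalIntegrable _ _)
    ((hK.cont _ hq).intervalIntegrable _ _), abs_of_nonneg hx.1] at hd
  have hdx : |p x - q x| ≤ L * k / l * (Real.exp (l * x) - 1) := by
    rw [hpK x hx, hqK x hx]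
    convert hd using 2
    ring
  have h3 : L / l ≤ 1 / 2 := by rw [div_le_div_iff₀ hl0 two_pos]; linarith
  have hk2 : k ≤ 1 / 2 * k := by
    calc k ≤ Real.exp (-(l * x)) * (L * k / l * (Real.exp (l * x) - 1)) := by
          rw [hk]; gcongr
      _ = L / l * k * (Real.exp (l * x) * Real.exp (-(l * x)))
          - L / l * k * Real.exp (-(l * x)) := by ring
      _ ≤ L / l * k := by
          rw [hexp, mul_one]
          have : 0 ≤ L / l * k * Real.exp (-(l * x)) := by positivity
          linarith
      _ ≤ _ := by gcongr
  have hk1 : k = 0 := by linarith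
  have := hle y hy
  rw [hk1, zero_mul] at this
  linarith [abs_nonpos_iff.1 this]

end

/-! ### The Tolman-Oppenheimer-Volkoff equation in x = r²: truncation and extension. -/

section

/-- `m / r³` as a function of `x = r²`, where the pressure is `p (r²)`. -/
def meanDensity (eos p : ℝ → ℝ) (x : ℝ) : ℝ := 4 * Real.pi * moment 2 (fun s => eos (p s)) x

/-- `e^{-a}` as a function of `x = r²`. -/
def lapse (eos : ℝ → ℝ) (Λ : ℝ) (p : ℝ → ℝ) (x : ℝ) : ℝ :=
  1 - (2 * meanDensity eos p x + Λ / 3) * x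

/-- The gravitational force `4πP + m/r³ - Λ/3` as a function of `x = r²`. -/
def force (eos : ℝ → ℝ) (Λ : ℝ) (p : ℝ → ℝ) (x : ℝ) : ℝ :=
  4 * Real.pi * p x + meanDensity eos p x - Λ / 3

/-- The right-hand side of the Tolman-Oppenheimer-Volkoff equation in the variable `x = r²`. -/
def tovRate (eos : ℝ → ℝ) (Λ : ℝ) (p : ℝ → ℝ) (x : ℝ) : ℝ :=
  -((eos (p x) + p x) * force eos Λ p x) / (2 * lapse eos Λ p x)

/-- Truncation to `[lo, hi]`. -/
def clamp (lo hi t : ℝ) : ℝ := max lo (min t hi)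

lemma clamp_mem {lo hi : ℝ} (h : lo ≤ hi) (t : ℝ) : clamp lo hi t ∈ Icc lo hi :=
  ⟨le_max_left _ _, max_le h (min_le_right _ _)⟩

lemma clamp_of_mem {lo hi t : ℝ} (h : t ∈ Icc lo hi) : clamp lo hi t = t := by
  rw [clamp, min_eq_left h.2, max_eq_right h.1]

lemma clamp_continuous (lo hi : ℝ) : Continuous (clamp lo hi) := by unfold clamp; fun_prop

lemma abs_clamp_sub_le (lo hi s t : ℝ) : |clamp lo hi s - clamp lo hi t| ≤ |s - t| := by
  have h1 := abs_max_sub_max_le_abs (min s hi) (min t hi) lo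
  have h2 := abs_min_sub_min_le_max s hi t hi
  rw [max_comm (min s hi), max_comm (min t hi)] at h1
  simp only [sub_self, abs_zero, abs_nonneg, max_eq_left] at h2
  exact h1.trans h2

/-- The truncated Tolman-Oppenheimer-Volkoff operator. -/
def clampedRate (eos : ℝ → ℝ) (Λ δ M η y X : ℝ) (p : ℝ → ℝ) (x : ℝ) : ℝ :=
  -((eos (clamp δ M (p x)) + clamp δ M (p x)) * (4 * Real.pi * clamp δ M (p x)
      + meanDensity eos (fun s => clamp δ M (p s)) x - Λ / 3)) /
    (2 * clamp η y (1 - (2 * meanDensity eos (fun s => clamp δ M (p s)) x + Λ / 3)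
      * clamp (-X) X x))

variable {eos : ℝ → ℝ} {Λ Pc : ℝ}

lemma exists_lipschitz_of_contDiffOn {E : Type*} [NormedAddCommGroup E] [NormedSpace ℝ E]
    {F : E → ℝ} {s : Set E} (hs : IsCompact s) (hc : Convex ℝ s) (hF : ContDiffOn ℝ 1 F s) :
    ∃ L : ℝ, 0 ≤ L ∧ ∀ x ∈ s, ∀ y ∈ s, |F x - F y| ≤ L * dist x y := by
  obtain ⟨L, hL⟩ := (hF.locallyLipschitzOn hc).exists_lipschitzOnWith_of_compact hs
  exact ⟨L, L.2, fun x hx y hy => hL.dist_le_mul x hx y hy⟩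

lemma IsEquationOfState.contDiffOn_one (heos : IsEquationOfState eos) {δ M : ℝ} (hδ : 0 < δ) :
    ContDiffOn ℝ 1 eos (Icc δ M) :=
  (heos.smooth.mono fun _ hx => hδ.trans_le hx.1).of_le (by simp)

/-- The rate is a function F of pressure, mean density and lapse. Truncation confines these three to
a compact convex box on which F is C¹, hence bounded and Lipschitz. The bounds δ, η > 0 keep away
from zero pressure, where the equation of state is only continuous, and from zero lapse. -/
lemma clampedRate_isVolterra (heos : IsEquationOfState eos) {δ M η y X : ℝ} (hδ : 0 < δ)
    (hδM : δ ≤ M) (hη : 0 < η) (hηy : η ≤ y) (hX : 0 ≤ X) :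
    ∃ B L, IsVolterra (clampedRate eos Λ δ M η y X) B L := by
  have hpi := Real.pi_pos
  have heosC := heos.contDiffOn_one (M := M) hδ
  obtain ⟨Lr, hLr0, hLr⟩ := exists_lipschitz_of_contDiffOn isCompact_Icc (convex_Icc δ M) heosC
  obtain ⟨E, hE⟩ := isCompact_Icc.exists_bound_of_continuousOn heosC.continuousOn
  set F : ℝ × ℝ × ℝ → ℝ := fun z =>
    -((eos z.1 + z.1) * (4 * Real.pi * z.1 + z.2.1 - Λ / 3)) / (2 * z.2.2) with hF
  set S : Set (ℝ × ℝ × ℝ) := Icc δ M ×ˢ (Icc (-(4 * Real.pi * E)) (4 * Real.pi * E) ×ˢ Icc η y)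
  have hScomp : IsCompact S := isCompact_Icc.prod (isCompact_Icc.prod isCompact_Icc)
  have hSconv : Convex ℝ S := (convex_Icc _ _).prod ((convex_Icc _ _).prod (convex_Icc _ _))
  have hFS : ContDiffOn ℝ 1 F S := by
    have h1 : ContDiffOn ℝ 1 (fun z : ℝ × ℝ × ℝ => eos z.1) S :=
      heosC.comp contDiff_fst.contDiffOn fun z hz => hz.1
    refine ContDiffOn.div (ContDiffOn.neg ((h1.add ?_).mul ?_)) ?_ fun z hz => ?_
    · fun_prop
    · fun_prop
    · fun_prop
    · have := hη.trans_le hz.2.2.1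
      positivity
  obtain ⟨L, hL0, hL⟩ := exists_lipschitz_of_contDiffOn hScomp hSconv hFS
  obtain ⟨B, hB⟩ := hScomp.exists_bound_of_continuousOn hFS.continuousOn
  set ρ : (ℝ → ℝ) → ℝ → ℝ := fun p s => eos (clamp δ M (p s)) with hρ
  set Z : (ℝ → ℝ) → ℝ → ℝ × ℝ × ℝ := fun p x => (clamp δ M (p x),
    meanDensity eos (fun s => clamp δ M (p s)) x,
    clamp η y (1 - (2 * meanDensity eos (fun s => clamp δ M (p s)) x + Λ / 3) * clamp (-X) X x))
    with hZ
  have hρc : ∀ p, Continuous p → Continuous (ρ p) := fun p hp =>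
    heosC.continuousOn.comp_continuous ((clamp_continuous δ M).comp hp) fun x => clamp_mem hδM _
  have hwc : ∀ p, Continuous p → Continuous (meanDensity eos (fun s => clamp δ M (p s))) :=
    fun p hp => continuous_const.mul (moment_continuous 2 (hρc p hp))
  have hρE : ∀ p s, |ρ p s| ≤ E := fun p s => hE _ (clamp_mem hδM _)
  have hE0 : 0 ≤ E := (abs_nonneg _).trans (hρE id 0)
  have hwE : ∀ p, Continuous p → ∀ x, |meanDensity eos (fun s => clamp δ M (p s)) x| ≤
      4 * Real.pi * E := by
    intro p hp x
    have h1 := abs_moment_sub_le 2 (f := ρ p) (g := fun _ => 0) (a := min 0 x) (b := max 0 x)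
      (x := x) (D := E) (min_le_left _ _) (le_max_left _ _) (hρc p hp).continuousOn
      continuousOn_const ⟨min_le_right _ _, le_max_right _ _⟩ fun s _ => by
        rw [sub_zero]; exact hρE p s
    rw [moment_const, zero_div, sub_zero] at h1
    rw [meanDensity, abs_mul, abs_of_pos (by positivity)]
    gcongr
    refine h1.trans (div_le_self hE0 ?_)
    norm_num
  have hZS : ∀ p, Continuous p → ∀ x, Z p x ∈ S := fun p hp x =>
    ⟨clamp_mem hδM _, abs_le.1 (hwE p hp x), clamp_mem hηy _⟩
  have hZc : ∀ p, Continuous p → Continuous (Z p) := by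
    intro p hp
    have h1 := (clamp_continuous δ M).comp hp
    have h2 := hwc p hp
    have h3 := clamp_continuous (-X) X
    refine h1.prodMk (h2.prodMk ((clamp_continuous η y).comp ?_))
    fun_prop
  have hK : clampedRate eos Λ δ M η y X = fun p x => F (Z p x) := rfl
  -- The three summands bound the variation of pressure, mean density and lapse. The last contains X
  -- because the lapse multiplies the mean density by x, truncated to [-X, X] to keep the constant
  -- uniform.
  refine ⟨|B|, L * (1 + 4 * Real.pi * Lr + 2 * (4 * Real.pi * Lr) * X), ?_⟩
  rw [hK]
  refine ⟨abs_nonneg _, by positivity, fun p hp => ?_, fun p hp x => ?_, ?_⟩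
  · exact hFS.continuousOn.comp_continuous (hZc p hp) (hZS p hp)
  · exact (hB _ (hZS p hp x)).trans (le_abs_self B)
  · intro p q hp hq x D hD
    refine (hL _ (hZS p hp x) _ (hZS q hq x)).trans ?_
    rw [mul_assoc]
    refine mul_le_mul_of_nonneg_left ?_ hL0
    have hD0 : 0 ≤ D := (abs_nonneg _).trans (hD 0 left_mem_uIcc)
    have d1 : |clamp δ M (p x) - clamp δ M (q x)| ≤ D :=
      (abs_clamp_sub_le _ _ _ _).trans (hD x right_mem_uIcc)
    have d2 : |meanDensity eos (fun s => clamp δ M (p s)) x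
        - meanDensity eos (fun s => clamp δ M (q s)) x| ≤ 4 * Real.pi * Lr * D := by
      have h1 := abs_moment_sub_le 2 (f := ρ p) (g := ρ q) (a := min 0 x) (b := max 0 x)
        (x := x) (D := Lr * D) (min_le_left _ _) (le_max_left _ _) (hρc p hp).continuousOn
        (hρc q hq).continuousOn ⟨min_le_right _ _, le_max_right _ _⟩ fun s hs => by
          refine (hLr _ (clamp_mem hδM _) _ (clamp_mem hδM _)).trans ?_
          gcongr
          exact (abs_clamp_sub_le _ _ _ _).trans (hD s hs)
      rw [meanDensity, meanDensity, ← mul_sub, abs_mul, abs_of_pos (by positivity), mul_assoc _ Lr]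
      gcongr
      refine h1.trans (div_le_self (by positivity) ?_)
      norm_num
    have d3 : |clamp (-X) X x| ≤ X := abs_le.2 (clamp_mem (by linarith) x)
    have d4 := abs_clamp_sub_le η y
      (1 - (2 * meanDensity eos (fun s => clamp δ M (p s)) x + Λ / 3) * clamp (-X) X x)
      (1 - (2 * meanDensity eos (fun s => clamp δ M (q s)) x + Λ / 3) * clamp (-X) X x)
    have d5 : |1 - (2 * meanDensity eos (fun s => clamp δ M (p s)) x + Λ / 3) * clamp (-X) X x -
        (1 - (2 * meanDensity eos (fun s => clamp δ M (q s)) x + Λ / 3) * clamp (-X) X x)| ≤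
        2 * (4 * Real.pi * Lr * D) * X := by
      rw [show ∀ u v z : ℝ, 1 - (2 * u + Λ / 3) * z - (1 - (2 * v + Λ / 3) * z)
        = (2 * (v - u)) * z by intros; ring, abs_mul, abs_mul, abs_two, abs_sub_comm]
      gcongr
    have e1 : 0 ≤ 4 * Real.pi * Lr * D := by positivity
    have e2 : 0 ≤ 2 * (4 * Real.pi * Lr * D) * X := by positivity
    rw [Prod.dist_eq, Prod.dist_eq]
    refine max_le ?_ (max_le ?_ ?_)
    · exact d1.trans (by linarith)
    · exact d2.trans (by linarith)
    · exact (d4.trans d5).trans (by linarith)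

/-- `p` solves the Tolman-Oppenheimer-Volkoff equation on `0 ≤ r² ≤ x`. -/
structure IsCore (eos : ℝ → ℝ) (Λ Pc x : ℝ) (p : ℝ → ℝ) : Prop where
  cont : ContinuousOn p (Icc 0 x)
  pos : ∀ s ∈ Icc 0 x, 0 < p s
  lapse_pos : ∀ s ∈ Icc 0 x, 0 < lapse eos Λ p s
  eq : ∀ s ∈ Icc 0 x, p s = Pc + ∫ t in (0 : ℝ)..s, tovRate eos Λ p t

/-- `p` solves the Tolman-Oppenheimer-Volkoff equation on the open interval `(A, B)`. -/
structure IsSol (eos : ℝ → ℝ) (Λ Pc A B : ℝ) (p : ℝ → ℝ) : Prop where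
  neg : A < 0
  pos_right : 0 < B
  zero : p 0 = Pc
  pos : ∀ s ∈ Ioo A B, 0 < p s
  lapse_pos : ∀ s ∈ Ioo A B, 0 < lapse eos Λ p s
  hasDerivAt : ∀ s ∈ Ioo A B, HasDerivAt p (tovRate eos Λ p s) s

lemma meanDensity_congr {p q : ℝ → ℝ} {a b x : ℝ} (ha : a ≤ 0) (hb : 0 ≤ b)
    (h : EqOn p q (Icc a b)) (hx : x ∈ Icc a b) : meanDensity eos p x = meanDensity eos q x := by
  rw [meanDensity, meanDensity, moment_congr (g := fun s => eos (q s)) ha hb (fun s hs => by simp only [h hs]) hx]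

lemma lapse_congr {p q : ℝ → ℝ} {a b x : ℝ} (ha : a ≤ 0) (hb : 0 ≤ b)
    (h : EqOn p q (Icc a b)) (hx : x ∈ Icc a b) : lapse eos Λ p x = lapse eos Λ q x := by
  rw [lapse, lapse, meanDensity_congr ha hb h hx]

lemma force_congr {p q : ℝ → ℝ} {a b x : ℝ} (ha : a ≤ 0) (hb : 0 ≤ b)
    (h : EqOn p q (Icc a b)) (hx : x ∈ Icc a b) : force eos Λ p x = force eos Λ q x := by
  rw [force, force, meanDensity_congr ha hb h hx, h hx]

lemma tovRate_congr {p q : ℝ → ℝ} {a b x : ℝ} (ha : a ≤ 0) (hb : 0 ≤ b)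
    (h : EqOn p q (Icc a b)) (hx : x ∈ Icc a b) : tovRate eos Λ p x = tovRate eos Λ q x := by
  rw [tovRate, tovRate, force_congr ha hb h hx, lapse_congr ha hb h hx, h hx]

lemma density_continuousOn (heos : IsEquationOfState eos) {p : ℝ → ℝ} {s : Set ℝ}
    (hp : ContinuousOn p s) (hpos : ∀ t ∈ s, 0 ≤ p t) : ContinuousOn (fun t => eos (p t)) s :=
  heos.continuousOn.comp hp hpos

lemma meanDensity_continuousOn (heos : IsEquationOfState eos) {p : ℝ → ℝ} {a b : ℝ} (ha : a ≤ 0)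
    (hb : 0 ≤ b) (hp : ContinuousOn p (Icc a b)) (hpos : ∀ t ∈ Icc a b, 0 ≤ p t) :
    ContinuousOn (meanDensity eos p) (Icc a b) :=
  continuousOn_const.mul (moment_continuousOn 2 ha hb (density_continuousOn heos hp hpos))

lemma lapse_continuousOn (heos : IsEquationOfState eos) {p : ℝ → ℝ} {a b : ℝ} (ha : a ≤ 0)
    (hb : 0 ≤ b) (hp : ContinuousOn p (Icc a b)) (hpos : ∀ t ∈ Icc a b, 0 ≤ p t) :
    ContinuousOn (lapse eos Λ p) (Icc a b) := by
  have := meanDensity_continuousOn heos ha hb hp hpos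
  unfold lapse
  fun_prop

lemma force_continuousOn (heos : IsEquationOfState eos) {p : ℝ → ℝ} {a b : ℝ} (ha : a ≤ 0)
    (hb : 0 ≤ b) (hp : ContinuousOn p (Icc a b)) (hpos : ∀ t ∈ Icc a b, 0 ≤ p t) :
    ContinuousOn (force eos Λ p) (Icc a b) := by
  have := meanDensity_continuousOn heos ha hb hp hpos
  unfold force
  fun_prop

lemma tovRate_continuousOn (heos : IsEquationOfState eos) {p : ℝ → ℝ} {a b : ℝ} (ha : a ≤ 0)
    (hb : 0 ≤ b) (hp : ContinuousOn p (Icc a b)) (hpos : ∀ t ∈ Icc a b, 0 ≤ p t)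
    (hl : ∀ t ∈ Icc a b, 0 < lapse eos Λ p t) : ContinuousOn (tovRate eos Λ p) (Icc a b) :=
  (((density_continuousOn heos hp hpos).add hp).mul
    (force_continuousOn heos ha hb hp hpos)).neg.div
    (continuousOn_const.mul (lapse_continuousOn heos ha hb hp hpos))
    fun t ht => (mul_pos two_pos (hl t ht)).ne'

/-- As long as pressure, lapse and x stay in their windows the truncation is invisible. -/
lemma clampedRate_eq_tovRate {δ M η y X : ℝ} {p q : ℝ → ℝ} {a b x : ℝ} (ha : a ≤ 0) (hb : 0 ≤ b)
    (hpq : EqOn p q (Icc a b)) (hq : ∀ s ∈ Icc a b, q s ∈ Icc δ M) (hx : x ∈ Icc a b)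
    (hX : x ∈ Icc (-X) X) (hl : lapse eos Λ q x ∈ Icc η y) :
    clampedRate eos Λ δ M η y X p x = tovRate eos Λ q x := by
  have h1 : EqOn (fun s => clamp δ M (p s)) q (Icc a b) := fun s hs => by
    simp only [hpq hs, clamp_of_mem (hq s hs)]
  rw [clampedRate, meanDensity_congr ha hb h1 hx, clamp_of_mem hX, hpq hx,
    clamp_of_mem (hq x hx)]
  rw [lapse] at hl
  rw [clamp_of_mem hl, tovRate, force, lapse]

lemma exists_Icc_subset_of_isOpen {a b : ℝ} (hab : a ≤ b) {U : Set ℝ} (hU : IsOpen U)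
    (h : Icc a b ⊆ U) : ∃ ε > 0, Icc (a - ε) (b + ε) ⊆ U := by
  obtain ⟨ε, hε, hsub⟩ := isCompact_Icc.exists_cthickening_subset_open hU h
  refine ⟨ε, hε, fun s hs => hsub ?_⟩
  refine Metric.mem_cthickening_of_dist_le s (clamp a b s) ε _ (clamp_mem hab s) ?_
  rw [Real.dist_eq, clamp, abs_le]
  rcases max_cases a (min s b) with h1 | h1 <;> rcases min_cases s b with h2 | h2 <;>
    constructor <;> linarith [hs.1, hs.2, h1.1, h1.2, h2.1, h2.2]

/-- A solution on `[0, x]` extends to a solution on an open interval. -/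
theorem IsCore.exists_extension (heos : IsEquationOfState eos) {x : ℝ} (hx : 0 ≤ x) {p : ℝ → ℝ}
    (hp : IsCore eos Λ Pc x p) :
    ∃ ε > 0, ∃ q, IsSol eos Λ Pc (-ε) (x + ε) q ∧ IsCore eos Λ Pc (x + ε / 2) q ∧
      EqOn p q (Icc 0 x) := by
  have hne : (Icc 0 x).Nonempty := ⟨0, le_rfl, hx⟩
  have hlc := lapse_continuousOn (Λ := Λ) heos le_rfl hx hp.cont fun t ht => (hp.pos t ht).le
  obtain ⟨s1, hs1, hmin⟩ := isCompact_Icc.exists_isMinOn hne hp.cont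
  obtain ⟨s2, hs2, hmax⟩ := isCompact_Icc.exists_isMaxOn hne hp.cont
  obtain ⟨s3, hs3, hlmin⟩ := isCompact_Icc.exists_isMinOn hne hlc
  obtain ⟨s4, hs4, hlmax⟩ := isCompact_Icc.exists_isMaxOn hne hlc
  -- The windows are strictly larger than the ranges of pressure and lapse on [0, x], so a
  -- continuous continuation stays inside them a little further on.
  set δ := p s1 / 2 with hδ
  set M := p s2 + 1 with hM
  set η := lapse eos Λ p s3 / 2 with hη
  set y := lapse eos Λ p s4 + 1 with hy
  have hδ0 := hp.pos s1 hs1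
  have hη0 := hp.lapse_pos s3 hs3
  have hpI : ∀ s ∈ Icc 0 x, p s ∈ Ioo δ M := fun s hs => by
    have h1 : p s1 ≤ p s := hmin hs
    have h2 : p s ≤ p s2 := hmax hs
    exact ⟨by linarith, by linarith⟩
  have hlI : ∀ s ∈ Icc 0 x, lapse eos Λ p s ∈ Ioo η y := fun s hs => by
    have h1 : lapse eos Λ p s3 ≤ lapse eos Λ p s := hlmin hs
    have h2 : lapse eos Λ p s ≤ lapse eos Λ p s4 := hlmax hs
    exact ⟨by linarith, by linarith⟩
  have h0 := hne.some_mem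
  have hδM : δ ≤ M := ((hpI _ h0).1.trans (hpI _ h0).2).le
  have hηy : η ≤ y := ((hlI _ h0).1.trans (hlI _ h0).2).le
  obtain ⟨B, L, hV⟩ := clampedRate_isVolterra (Λ := Λ) heos (X := x + 1) (by linarith : 0 < δ) hδM
    (by linarith : 0 < η) hηy (by linarith)
  obtain ⟨q, hqc, hq⟩ := hV.exists_solution Pc
  obtain ⟨g, hgc, hg⟩ := exists_continuous_eqOn hx hp.cont
  have hgK : ∀ s ∈ Icc 0 x, g s = Pc + ∫ t in (0 : ℝ)..s,
      clampedRate eos Λ δ M η y (x + 1) g t := by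
    intro s hs
    rw [← hg hs, hp.eq s hs]
    congr 1
    refine intervalIntegral.integral_congr fun t ht => ?_
    rw [uIcc_of_le hs.1] at ht
    have ht' : t ∈ Icc 0 x := ⟨ht.1, ht.2.trans hs.2⟩
    exact (clampedRate_eq_tovRate le_rfl hx hg.symm (fun s hs => Ioo_subset_Icc_self (hpI s hs))
      ht' ⟨by linarith [ht'.1], by linarith [ht'.2]⟩ (Ioo_subset_Icc_self (hlI t ht'))).symm
  have hgq : EqOn g q (Icc 0 x) := hV.eqOn hgc hqc hgK fun s _ => hq s
  have hpq : EqOn p q (Icc 0 x) := hg.trans hgq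
  -- Far from [0, x] the global solution q may leave the domain of the equation of state. The
  -- truncated c has a continuous lapse everywhere and agrees with q wherever q stays in its window.
  set c : ℝ → ℝ := fun s => clamp δ M (q s) with hc
  have hcc : Continuous c := (clamp_continuous δ M).comp hqc
  have hcI : ∀ s, c s ∈ Icc δ M := fun s => clamp_mem hδM _
  have hlcc : Continuous (lapse eos Λ c) := by
    have h1 : Continuous fun s => eos (c s) :=
      (heos.contDiffOn_one (M := M) (by linarith : 0 < δ)).continuousOn.comp_continuous hcc hcI
    have h2 := moment_continuous 2 h1
    unfold lapse meanDensity
    fun_prop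
  have hcq0 : EqOn c p (Icc 0 x) := fun s hs => by
    simp only [hc, ← hpq hs, clamp_of_mem (Ioo_subset_Icc_self (hpI s hs))]
  have hU : IsOpen ((q ⁻¹' Ioo δ M) ∩ (lapse eos Λ c ⁻¹' Ioo η y) ∩ Ioo (-(x + 1)) (x + 1)) :=
    ((isOpen_Ioo.preimage hqc).inter (isOpen_Ioo.preimage hlcc)).inter isOpen_Ioo
  -- The open set of good points contains a margin on both sides; the one to the left of 0 is needed
  -- for smoothness at the centre.
  obtain ⟨ε, hε, hsub⟩ := exists_Icc_subset_of_isOpen hx hU fun s hs =>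
    ⟨⟨by rw [mem_preimage, ← hpq hs]; exact hpI s hs,
      by rw [mem_preimage, lapse_congr le_rfl hx hcq0 hs]; exact hlI s hs⟩,
      by linarith [hs.1], by linarith [hs.2]⟩
  rw [zero_sub] at hsub
  have hε1 : -ε ≤ 0 := by linarith
  have hε2 : 0 ≤ x + ε := by linarith
  have hcq : EqOn c q (Icc (-ε) (x + ε)) := fun s hs =>
    clamp_of_mem (Ioo_subset_Icc_self (hsub hs).1.1)
  have hqpos : ∀ s ∈ Icc (-ε) (x + ε), 0 < q s := fun s hs => by
    linarith [(hsub hs).1.1.1]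
  have hql : ∀ s ∈ Icc (-ε) (x + ε), lapse eos Λ q s ∈ Ioo η y := fun s hs => by
    rw [← lapse_congr hε1 hε2 hcq hs]
    exact (hsub hs).1.2
  have hqlpos : ∀ s ∈ Icc (-ε) (x + ε), 0 < lapse eos Λ q s := fun s hs => by
    linarith [(hql s hs).1]
  have hrate : EqOn (clampedRate eos Λ δ M η y (x + 1) q) (tovRate eos Λ q)
      (Icc (-ε) (x + ε)) := fun s hs =>
    clampedRate_eq_tovRate hε1 hε2 (fun _ _ => rfl) (fun t ht =>
      Ioo_subset_Icc_self (hsub ht).1.1) hs (Ioo_subset_Icc_self (hsub hs).2)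
      (Ioo_subset_Icc_self (hql s hs))
  have hVc := hV.cont q hqc
  refine ⟨ε, hε, q, ⟨by linarith, by linarith, by simpa using hq 0,
    fun s hs => hqpos s (Ioo_subset_Icc_self hs), fun s hs => hqlpos s (Ioo_subset_Icc_self hs),
    fun s hs => ?_⟩, ⟨hqc.continuousOn, fun s hs => hqpos s ?_, fun s hs => hqlpos s ?_,
    fun s hs => ?_⟩, hpq⟩
  · rw [← hrate (Ioo_subset_Icc_self hs)]
    exact ((hVc.integral_hasStrictDerivAt 0 s).hasDerivAt.const_add Pc).congr_of_eventuallyEq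
      (Eventually.of_forall hq)
  · exact ⟨by linarith [hs.1], by linarith [hs.2]⟩
  · exact ⟨by linarith [hs.1], by linarith [hs.2]⟩
  · rw [hq s]
    congr 1
    refine intervalIntegral.integral_congr fun t ht => hrate ?_
    rw [uIcc_of_le hs.1] at ht
    exact ⟨by linarith [ht.1], by linarith [ht.2, hs.2]⟩

end

/-! ### Uniqueness, smoothness and monotonicity of solutions. -/

section

variable {eos : ℝ → ℝ} {Λ Pc : ℝ}

/-- By compactness both solutions fit into common truncation windows, so both solve the same
Volterra equation. -/
theorem IsCore.eqOn (heos : IsEquationOfState eos) {x : ℝ} (hx : 0 ≤ x) {p q : ℝ → ℝ}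
    (hp : IsCore eos Λ Pc x p) (hq : IsCore eos Λ Pc x q) : EqOn p q (Icc 0 x) := by
  have hne : (Icc 0 x).Nonempty := ⟨0, le_rfl, hx⟩
  have h0 := hne.some_mem
  have bounds : ∀ f : ℝ → ℝ, ContinuousOn f (Icc 0 x) → (∀ s ∈ Icc 0 x, 0 < f s) →
      ∃ l u, 0 < l ∧ ∀ s ∈ Icc 0 x, f s ∈ Icc l u := by
    intro f hf hpos
    obtain ⟨s1, hs1, hmin⟩ := isCompact_Icc.exists_isMinOn hne hf
    obtain ⟨s2, hs2, hmax⟩ := isCompact_Icc.exists_isMaxOn hne hf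
    exact ⟨f s1, f s2, hpos s1 hs1, fun s hs => ⟨hmin hs, hmax hs⟩⟩
  obtain ⟨δ1, M1, hδ1, h1⟩ := bounds p hp.cont hp.pos
  obtain ⟨δ2, M2, hδ2, h2⟩ := bounds q hq.cont hq.pos
  obtain ⟨η1, y1, hη1, h3⟩ := bounds (lapse eos Λ p)
    (lapse_continuousOn heos le_rfl hx hp.cont fun t ht => (hp.pos t ht).le) hp.lapse_pos
  obtain ⟨η2, y2, hη2, h4⟩ := bounds (lapse eos Λ q)
    (lapse_continuousOn heos le_rfl hx hq.cont fun t ht => (hq.pos t ht).le) hq.lapse_pos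
  have i1 : ∀ s ∈ Icc 0 x, p s ∈ Icc (min δ1 δ2) (max M1 M2) := fun s hs =>
    Icc_subset_Icc (min_le_left _ _) (le_max_left _ _) (h1 s hs)
  have i2 : ∀ s ∈ Icc 0 x, q s ∈ Icc (min δ1 δ2) (max M1 M2) := fun s hs =>
    Icc_subset_Icc (min_le_right _ _) (le_max_right _ _) (h2 s hs)
  have i3 : ∀ s ∈ Icc 0 x, lapse eos Λ p s ∈ Icc (min η1 η2) (max y1 y2) := fun s hs =>
    Icc_subset_Icc (min_le_left _ _) (le_max_left _ _) (h3 s hs)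
  have i4 : ∀ s ∈ Icc 0 x, lapse eos Λ q s ∈ Icc (min η1 η2) (max y1 y2) := fun s hs =>
    Icc_subset_Icc (min_le_right _ _) (le_max_right _ _) (h4 s hs)
  obtain ⟨B, L, hV⟩ := clampedRate_isVolterra (Λ := Λ) heos (X := x) (lt_min hδ1 hδ2)
    ((i1 _ h0).1.trans (i1 _ h0).2) (lt_min hη1 hη2) ((i3 _ h0).1.trans (i3 _ h0).2) hx
  have ext : ∀ f : ℝ → ℝ, IsCore eos Λ Pc x f →
      (∀ s ∈ Icc 0 x, f s ∈ Icc (min δ1 δ2) (max M1 M2)) →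
      (∀ s ∈ Icc 0 x, lapse eos Λ f s ∈ Icc (min η1 η2) (max y1 y2)) →
      ∃ g, Continuous g ∧ EqOn f g (Icc 0 x) ∧ ∀ s ∈ Icc 0 x, g s = Pc + ∫ t in (0 : ℝ)..s,
        clampedRate eos Λ (min δ1 δ2) (max M1 M2) (min η1 η2) (max y1 y2) x g t := by
    intro f hf hfI hlI
    obtain ⟨g, hgc, hg⟩ := exists_continuous_eqOn hx hf.cont
    refine ⟨g, hgc, hg, fun s hs => ?_⟩
    rw [← hg hs, hf.eq s hs]
    congr 1
    refine intervalIntegral.integral_congr fun t ht => ?_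
    rw [uIcc_of_le hs.1] at ht
    have ht' : t ∈ Icc 0 x := ⟨ht.1, ht.2.trans hs.2⟩
    exact (clampedRate_eq_tovRate le_rfl hx hg.symm hfI ht'
      ⟨by linarith [ht'.1], ht'.2⟩ (hlI t ht')).symm
  obtain ⟨g1, hg1, e1, k1⟩ := ext p hp i1 i3
  obtain ⟨g2, hg2, e2, k2⟩ := ext q hq i2 i4
  exact (e1.trans (hV.eqOn hg1 hg2 k1 k2)).trans e2.symm

lemma IsCore.mono {x y : ℝ} (hxy : x ≤ y) {p : ℝ → ℝ} (hp : IsCore eos Λ Pc y p) :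
    IsCore eos Λ Pc x p :=
  have h : Icc 0 x ⊆ Icc 0 y := Icc_subset_Icc_right hxy
  ⟨hp.cont.mono h, fun s hs => hp.pos s (h hs), fun s hs => hp.lapse_pos s (h hs),
    fun s hs => hp.eq s (h hs)⟩

lemma IsCore.congr {x : ℝ} (hx : 0 ≤ x) {p q : ℝ → ℝ} (hp : IsCore eos Λ Pc x p)
    (h : EqOn p q (Icc 0 x)) : IsCore eos Λ Pc x q := by
  refine ⟨hp.cont.congr h.symm, fun s hs => h hs ▸ hp.pos s hs,
    fun s hs => lapse_congr (Λ := Λ) (eos := eos) le_rfl hx h hs ▸ hp.lapse_pos s hs,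
    fun s hs => ?_⟩
  rw [← h hs, hp.eq s hs]
  congr 1
  refine intervalIntegral.integral_congr fun t ht => ?_
  rw [uIcc_of_le hs.1] at ht
  exact tovRate_congr le_rfl hx h ⟨ht.1, ht.2.trans hs.2⟩

lemma isCore_zero (hPc : 0 < Pc) : IsCore eos Λ Pc 0 (fun _ => Pc) := by
  refine ⟨continuousOn_const, fun _ _ => hPc, fun s hs => ?_, fun s hs => ?_⟩ <;>
  · rw [Icc_self, mem_singleton_iff] at hs
    simp [hs, lapse]

namespace IsSol
variable {A B : ℝ} {p : ℝ → ℝ}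

lemma continuousOn (hp : IsSol eos Λ Pc A B p) : ContinuousOn p (Ioo A B) :=
  fun s hs => (hp.hasDerivAt s hs).continuousAt.continuousWithinAt

/-- The density of a solution is as smooth as its pressure. -/
lemma density_contDiffOn (heos : IsEquationOfState eos) (hp : IsSol eos Λ Pc A B p) {n : ℕ}
    (h : ContDiffOn ℝ n p (Ioo A B)) : ContDiffOn ℝ n (fun s => eos (p s)) (Ioo A B) :=
  (heos.smooth.of_le (by exact_mod_cast le_top)).comp h hp.pos

lemma meanDensity_contDiffOn (heos : IsEquationOfState eos) (hp : IsSol eos Λ Pc A B p) {n : ℕ}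
    (h : ContDiffOn ℝ n p (Ioo A B)) : ContDiffOn ℝ n (meanDensity eos p) (Ioo A B) :=
  contDiffOn_const.mul (moment_contDiffOn_nat n 2 hp.neg hp.pos_right
    (hp.density_contDiffOn heos h))

lemma lapse_contDiffOn (heos : IsEquationOfState eos) (hp : IsSol eos Λ Pc A B p) {n : ℕ}
    (h : ContDiffOn ℝ n p (Ioo A B)) : ContDiffOn ℝ n (lapse eos Λ p) (Ioo A B) := by
  have := hp.meanDensity_contDiffOn heos h
  unfold lapse
  fun_prop

lemma force_contDiffOn (heos : IsEquationOfState eos) (hp : IsSol eos Λ Pc A B p) {n : ℕ}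
    (h : ContDiffOn ℝ n p (Ioo A B)) : ContDiffOn ℝ n (force eos Λ p) (Ioo A B) := by
  have := hp.meanDensity_contDiffOn heos h
  unfold force
  fun_prop

lemma tovRate_contDiffOn (heos : IsEquationOfState eos) (hp : IsSol eos Λ Pc A B p) {n : ℕ}
    (h : ContDiffOn ℝ n p (Ioo A B)) : ContDiffOn ℝ n (tovRate eos Λ p) (Ioo A B) :=
  ((((hp.density_contDiffOn heos h).add h).mul (hp.force_contDiffOn heos h)).neg).div
    (contDiffOn_const.mul (hp.lapse_contDiffOn heos h))
    fun s hs => (mul_pos two_pos (hp.lapse_pos s hs)).ne'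

/-- Bootstrap: the right-hand side is as smooth as p, so p has one derivative more. -/
lemma contDiffOn_nat (heos : IsEquationOfState eos) (hp : IsSol eos Λ Pc A B p) (n : ℕ) :
    ContDiffOn ℝ n p (Ioo A B) := by
  induction n with
  | zero => simpa using hp.continuousOn
  | succ n ih =>
    rw [Nat.cast_add, Nat.cast_one, contDiffOn_succ_iff_deriv_of_isOpen isOpen_Ioo]
    exact ⟨fun s hs => (hp.hasDerivAt s hs).differentiableAt.differentiableWithinAt, by simp,
      (hp.tovRate_contDiffOn heos ih).congr fun s hs => (hp.hasDerivAt s hs).deriv⟩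

lemma contDiffOn (heos : IsEquationOfState eos) (hp : IsSol eos Λ Pc A B p) :
    ContDiffOn ℝ ∞ p (Ioo A B) := contDiffOn_infty.2 (hp.contDiffOn_nat heos)

lemma meanDensity_smooth (heos : IsEquationOfState eos) (hp : IsSol eos Λ Pc A B p) :
    ContDiffOn ℝ ∞ (meanDensity eos p) (Ioo A B) :=
  contDiffOn_infty.2 fun n => hp.meanDensity_contDiffOn heos (hp.contDiffOn_nat heos n)

lemma lapse_smooth (heos : IsEquationOfState eos) (hp : IsSol eos Λ Pc A B p) :
    ContDiffOn ℝ ∞ (lapse eos Λ p) (Ioo A B) :=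
  contDiffOn_infty.2 fun n => hp.lapse_contDiffOn heos (hp.contDiffOn_nat heos n)

lemma force_smooth (heos : IsEquationOfState eos) (hp : IsSol eos Λ Pc A B p) :
    ContDiffOn ℝ ∞ (force eos Λ p) (Ioo A B) :=
  contDiffOn_infty.2 fun n => hp.force_contDiffOn heos (hp.contDiffOn_nat heos n)

lemma continuousOn_Icc (hp : IsSol eos Λ Pc A B p) {x : ℝ} (hxB : x < B) :
    ContinuousOn p (Icc 0 x) :=
  hp.continuousOn.mono fun _ hs => ⟨hp.neg.trans_le hs.1, hs.2.trans_lt hxB⟩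

/-- The mean density exceeds the boundary density `ρ(0)`, so gravity is attractive. -/
lemma le_meanDensity (heos : IsEquationOfState eos) {x y : ℝ} (hy : y ∈ Icc 0 x)
    (hc : ContinuousOn p (Icc 0 x)) (hpos : ∀ s ∈ Icc 0 x, 0 ≤ p s) {c : ℝ}
    (h : ∀ s ∈ Icc 0 x, c ≤ eos (p s)) : 4 * Real.pi * c / 3 ≤ meanDensity eos p y := by
  have h1 := moment_mono 2 le_rfl (hy.1.trans hy.2) continuousOn_const
    (density_continuousOn heos hc hpos) hy h
  rw [moment_const] at h1
  rw [meanDensity, mul_div_assoc]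
  have := Real.pi_pos
  gcongr
  norm_num at h1 ⊢
  exact h1

end IsSol

lemma IsEquationOfState.strictMonoOn (heos : IsEquationOfState eos) :
    StrictMonoOn eos (Ici 0) :=
  strictMonoOn_of_deriv_pos (convex_Ici 0) heos.continuousOn fun p hp => by
    rw [interior_Ici] at hp
    exact heos.deriv_pos p hp

namespace IsSol
variable {A B : ℝ} {p : ℝ → ℝ}

/-- The density is at least ρ(0), so its mean contributes at least 4πρ(0)/3, and the pressure term
is nonnegative. This is where Λ < 4πρ(0) will give an attractive force. -/
lemma force_ge (heos : IsEquationOfState eos) {x y : ℝ} (hy : y ∈ Icc 0 x)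
    (hc : ContinuousOn p (Icc 0 x)) (hpos : ∀ s ∈ Icc 0 x, 0 ≤ p s) :
    (4 * Real.pi * eos 0 - Λ) / 3 ≤ force eos Λ p y := by
  have h1 := le_meanDensity heos hy hc hpos (c := eos 0) fun s hs =>
    heos.strictMonoOn.monotoneOn self_mem_Ici (hpos s hs) (hpos s hs)
  have h2 := hpos y hy
  have := Real.pi_pos
  have : 0 ≤ 4 * Real.pi * p y := by positivity
  rw [force]
  linarith

/-- The derivative of the mean density with respect to `x = r²`. -/
lemma exists_hasDerivAt_meanDensity (heos : IsEquationOfState eos)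
    (hΛ : Λ < 4 * Real.pi * eos 0) (hp : IsSol eos Λ Pc A B p) :
    ∃ w' : ℝ → ℝ, ∀ x ∈ Ioo A B, HasDerivAt (meanDensity eos p) (w' x) x ∧
      2 * x * w' x + 3 * meanDensity eos p x = 4 * Real.pi * eos (p x) ∧ (0 ≤ x → w' x ≤ 0) := by
  set ρ' : ℝ → ℝ := fun s => deriv eos (p s) * tovRate eos Λ p s with hρ'
  have hd : ∀ s ∈ Ioo A B, HasDerivAt (fun s => eos (p s)) (ρ' s) s := fun s hs =>
    ((heos.smooth.differentiableOn (by simp)).differentiableAt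
      (Ioi_mem_nhds (hp.pos s hs))).hasDerivAt.comp s (hp.hasDerivAt s hs)
  have hc : ContinuousOn ρ' (Ioo A B) :=
    ((heos.smooth.continuousOn_deriv_of_isOpen isOpen_Ioi (by simp)).comp hp.continuousOn
      hp.pos).mul (hp.tovRate_contDiffOn heos (hp.contDiffOn_nat heos 0)).continuousOn
  refine ⟨fun x => 4 * Real.pi * moment 4 ρ' x, fun x hx => ⟨?_, ?_, fun hx0 => ?_⟩⟩
  · exact (moment_hasDerivAt 2 hp.neg hp.pos_right hd hc hx).const_mul _
  · have := two_mul_moment_add hp.neg hp.pos_right hd hc hx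
    rw [meanDensity]
    linear_combination (4 * Real.pi) * this
  -- Since dρ/dp > 0 and the force is nonnegative, the density does not increase outwards, and w'
  -- averages its derivative.
  · have hsub : Icc 0 x ⊆ Ioo A B := fun s hs => ⟨hp.neg.trans_le hs.1, hs.2.trans_lt hx.2⟩
    have h1 := moment_mono 4 le_rfl hx0 (hc.mono hsub) continuousOn_const (right_mem_Icc.2 hx0)
      (g := fun _ => 0) fun s hs => by
        have hf := force_ge (Λ := Λ) heos hs (hp.continuousOn_Icc hx.2)
          fun s hs => (hp.pos s (hsub hs)).le
        have hf0 : 0 ≤ force eos Λ p s := by linarith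
        have hl := hp.lapse_pos s (hsub hs)
        have hps := hp.pos s (hsub hs)
        have hr := heos.nonneg _ hps.le
        have hdp := heos.deriv_pos _ hps
        simp only [hρ', tovRate, neg_div, mul_neg, Left.neg_nonpos_iff]
        positivity
    rw [moment_const, zero_div] at h1
    have := Real.pi_pos
    exact mul_nonpos_of_nonneg_of_nonpos (by positivity) h1

lemma tovRate_neg (heos : IsEquationOfState eos) (hΛ : Λ < 4 * Real.pi * eos 0)
    (hp : IsSol eos Λ Pc A B p) {x : ℝ} (hx0 : 0 ≤ x) (hx : x < B) : tovRate eos Λ p x < 0 := by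
  have hsub : Icc 0 x ⊆ Ioo A B := fun s hs => ⟨hp.neg.trans_le hs.1, hs.2.trans_lt hx⟩
  have hf := force_ge (Λ := Λ) heos (right_mem_Icc.2 hx0) (hp.continuousOn_Icc hx)
    fun s hs => (hp.pos s (hsub hs)).le
  have hf0 : 0 < force eos Λ p x := by linarith
  have hl := hp.lapse_pos x (hsub (right_mem_Icc.2 hx0))
  have hps := hp.pos x (hsub (right_mem_Icc.2 hx0))
  have hr := heos.nonneg _ hps.le
  rw [tovRate, neg_div, Left.neg_neg_iff]
  positivity

end IsSol

end

/-! ### The lower bound for e^{-a}. -/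

section

variable {eos : ℝ → ℝ} {Λ Pc : ℝ}

/-- `ν` as a function of `x = r²`. -/
def potential (eos : ℝ → ℝ) (Λ : ℝ) (p : ℝ → ℝ) (x : ℝ) : ℝ :=
  ∫ s in (0 : ℝ)..x, force eos Λ p s / lapse eos Λ p s

lemma potential_congr {p q : ℝ → ℝ} {b x : ℝ} (hb : 0 ≤ b)
    (h : EqOn p q (Icc 0 b)) (hx : x ∈ Icc 0 b) :
    potential eos Λ p x = potential eos Λ q x := by
  refine intervalIntegral.integral_congr fun s hs => ?_
  rw [uIcc_of_le hx.1] at hs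
  have hs' : s ∈ Icc 0 b := ⟨hs.1, hs.2.trans hx.2⟩
  simp only [force_congr (Λ := Λ) (eos := eos) le_rfl hb h hs',
    lapse_congr (Λ := Λ) (eos := eos) le_rfl hb h hs']

lemma hasDerivAt_integral_of_continuousOn {f : ℝ → ℝ} {A B x : ℝ} (hA : A < 0) (hB : 0 < B)
    (hf : ContinuousOn f (Ioo A B)) (hx : x ∈ Ioo A B) :
    HasDerivAt (fun y => ∫ s in (0 : ℝ)..y, f s) (f x) x := by
  have hsub : uIcc 0 x ⊆ Ioo A B := (ordConnected_Ioo).uIcc_subset ⟨hA, hB⟩ hx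
  exact intervalIntegral.integral_hasDerivAt_right ((hf.mono hsub).intervalIntegrable)
    (hf.stronglyMeasurableAtFilter isOpen_Ioo x hx)
    (hf.continuousAt (isOpen_Ioo.mem_nhds hx))

namespace IsSol
variable {A B : ℝ} {p : ℝ → ℝ}

lemma mono (hp : IsSol eos Λ Pc A B p) {A' B' : ℝ} (hA : A ≤ A') (hA' : A' < 0) (hB : B' ≤ B)
    (hB' : 0 < B') : IsSol eos Λ Pc A' B' p :=
  have h : Ioo A' B' ⊆ Ioo A B := Ioo_subset_Ioo hA hB
  ⟨hA', hB', hp.zero, fun s hs => hp.pos s (h hs), fun s hs => hp.lapse_pos s (h hs),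
    fun s hs => hp.hasDerivAt s (h hs)⟩

lemma potential_hasDerivAt (heos : IsEquationOfState eos) (hp : IsSol eos Λ Pc A B p) {x : ℝ}
    (hx : x ∈ Ioo A B) :
    HasDerivAt (potential eos Λ p) (force eos Λ p x / lapse eos Λ p x) x :=
  hasDerivAt_integral_of_continuousOn hp.neg hp.pos_right
    ((hp.force_smooth heos).continuousOn.div (hp.lapse_smooth heos).continuousOn
      fun s hs => (hp.lapse_pos s hs).ne') hx

lemma potential_smooth (heos : IsEquationOfState eos) (hp : IsSol eos Λ Pc A B p) :
    ContDiffOn ℝ ∞ (potential eos Λ p) (Ioo A B) := by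
  rw [contDiffOn_infty_iff_deriv_of_isOpen isOpen_Ioo]
  exact ⟨fun s hs => (hp.potential_hasDerivAt heos hs).differentiableAt.differentiableWithinAt,
    ((hp.force_smooth heos).div (hp.lapse_smooth heos) fun s hs => (hp.lapse_pos s hs).ne').congr
      fun s hs => (hp.potential_hasDerivAt heos hs).deriv⟩

lemma force_pos (heos : IsEquationOfState eos) (hΛ : Λ < 4 * Real.pi * eos 0)
    (hp : IsSol eos Λ Pc A B p) {x : ℝ} (hx0 : 0 ≤ x) (hx : x < B) :
    (4 * Real.pi * eos 0 - Λ) / 3 ≤ force eos Λ p x ∧ 0 < force eos Λ p x := by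
  have hsub : Icc 0 x ⊆ Ioo A B := fun s hs => ⟨hp.neg.trans_le hs.1, hs.2.trans_lt hx⟩
  have hf := force_ge (Λ := Λ) heos (right_mem_Icc.2 hx0) (hp.continuousOn_Icc hx)
    fun s hs => (hp.pos s (hsub hs)).le
  exact ⟨hf, by linarith⟩

/-- Derivatives of the mean density, the lapse and the force with respect to `x = r²`. -/
lemma exists_hasDerivAt (heos : IsEquationOfState eos)
    (hΛ : Λ < 4 * Real.pi * eos 0) (hp : IsSol eos Λ Pc A B p) {x : ℝ} (hx : x ∈ Ioo A B) :
    ∃ w', 2 * x * w' + 3 * meanDensity eos p x = 4 * Real.pi * eos (p x) ∧ (0 ≤ x → w' ≤ 0) ∧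
      HasDerivAt (lapse eos Λ p) (meanDensity eos p x - 4 * Real.pi * eos (p x) - Λ / 3) x ∧
      HasDerivAt (force eos Λ p) (4 * Real.pi * tovRate eos Λ p x + w') x := by
  obtain ⟨w', hw'⟩ := hp.exists_hasDerivAt_meanDensity heos hΛ
  obtain ⟨h1, h2, h3⟩ := hw' x hx
  refine ⟨w' x, h2, h3, ?_, ?_⟩
  · refine ((((h1.const_mul 2).add_const (Λ / 3)).fun_mul (hasDerivAt_id' x)).const_sub
      1).congr_deriv ?_
    linear_combination -h2
  · exact (((hp.hasDerivAt x hx).const_mul (4 * Real.pi)).fun_add h1).sub_const _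

/-- A lower bound for `e^{-a}` that depends only on the central pressure. -/
lemma lapse_ge (heos : IsEquationOfState eos) (hΛ : Λ < 4 * Real.pi * eos 0)
    (hp : IsSol eos Λ Pc A B p) {x : ℝ} (hx0 : 0 ≤ x) (hx : x < B) :
    ((4 * Real.pi * eos 0 - Λ) / 3 /
      (4 * Real.pi * Pc + 4 * Real.pi * eos Pc / 3 - Λ / 3)) ^ 2 ≤ lapse eos Λ p x := by
  have hsub : Icc 0 x ⊆ Ioo A B := fun s hs => ⟨hp.neg.trans_le hs.1, hs.2.trans_lt hx⟩
  -- With N = ν, N' = F/Y. In the logarithmic derivative N' + 2F'/F - Y'/Y everything cancels except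
  -- 2w'/F, so G' = 2e^N (F/Y) w' ≤ 0. Then e^N F² ≤ F(0)² Y, and N ≥ 0 with the lower bound for F
  -- gives the claim.
  set G : ℝ → ℝ := fun s => Real.exp (potential eos Λ p s) * force eos Λ p s ^ 2
    / lapse eos Λ p s with hG
  have hGd : ∀ s ∈ Icc 0 x, ∃ G', G' ≤ 0 ∧ HasDerivAt G G' s := by
    intro s hs
    obtain ⟨w', h1, h2, h3, h4⟩ := hp.exists_hasDerivAt heos hΛ (hsub hs)
    have hl := hp.lapse_pos s (hsub hs)
    have hf := (hp.force_pos heos hΛ hs.1 (hsub hs).2).2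
    have h5 := hp.potential_hasDerivAt heos (hsub hs)
    refine ⟨Real.exp (potential eos Λ p s) * (2 * force eos Λ p s / lapse eos Λ p s) * w', ?_,
      ((h5.exp.fun_mul (h4.fun_pow 2)).fun_div h3 hl.ne').congr_deriv ?_⟩
    · exact mul_nonpos_of_nonneg_of_nonpos (by positivity) (h2 hs.1)
    · have e : force eos Λ p s = 4 * Real.pi * p s + meanDensity eos p s - Λ / 3 := rfl
      rw [tovRate]
      field_simp
      rw [e]
      ring
  have hanti : AntitoneOn G (Icc 0 x) := by
    refine antitoneOn_of_deriv_nonpos (convex_Icc 0 x) (fun s hs => ?_) (fun s hs => ?_)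
      fun s hs => ?_
    · obtain ⟨G', -, h⟩ := hGd s hs
      exact h.continuousAt.continuousWithinAt
    · obtain ⟨G', -, h⟩ := hGd s (interior_subset hs)
      exact h.differentiableAt.differentiableWithinAt
    · obtain ⟨G', h0, h⟩ := hGd s (interior_subset hs)
      rwa [h.deriv]
  have hGx := hanti (left_mem_Icc.2 hx0) (right_mem_Icc.2 hx0) hx0
  have hl := hp.lapse_pos x (hsub (right_mem_Icc.2 hx0))
  have hf := hp.force_pos heos hΛ hx0 hx
  have hN : 0 ≤ potential eos Λ p x := intervalIntegral.integral_nonneg hx0 fun s hs =>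
    div_nonneg (hp.force_pos heos hΛ hs.1 (hsub hs).2).2.le (hp.lapse_pos s (hsub hs)).le
  have hf0 := (hp.force_pos heos hΛ le_rfl hp.pos_right).2
  have e0 : force eos Λ p 0 = 4 * Real.pi * Pc + 4 * Real.pi * eos Pc / 3 - Λ / 3 := by
    have : moment 2 (fun s => eos (p s)) 0 = eos Pc / 3 := by
      rw [moment_congr (g := fun _ => eos Pc) (a := 0) (b := 0) le_rfl le_rfl (fun s hs => ?_)
        (left_mem_Icc.2 le_rfl), moment_const]
      · norm_num
      · rw [Icc_self, mem_singleton_iff] at hs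
        simp only [hs, hp.zero]
    rw [force, meanDensity, this, hp.zero]
    ring
  simp only [hG] at hGx
  rw [show lapse eos Λ p 0 = 1 by simp [lapse], show potential eos Λ p 0 = 0 by simp [potential],
    Real.exp_zero, one_mul, div_one, div_le_iff₀ hl] at hGx
  rw [← e0, div_pow, div_le_iff₀ (by positivity)]
  have h1 : 0 ≤ (4 * Real.pi * eos 0 - Λ) / 3 := by linarith
  calc ((4 * Real.pi * eos 0 - Λ) / 3) ^ 2 ≤ 1 * force eos Λ p x ^ 2 := by
        rw [one_mul]; exact pow_le_pow_left₀ h1 hf.1 2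
    _ ≤ Real.exp (potential eos Λ p x) * force eos Λ p x ^ 2 := by
        gcongr
        exact Real.one_le_exp hN
    _ ≤ _ := hGx
    _ = _ := mul_comm _ _

end IsSol

end

/-! ### The maximal solution and its boundary. -/

section

variable {eos : ℝ → ℝ} {Λ Pc : ℝ}

/-- `p` is the maximal solution, defined for `r² < R²`; it is continued by zero. -/
structure IsMaximal (eos : ℝ → ℝ) (Λ Pc : ℝ) (R : EReal) (p : ℝ → ℝ) : Prop where
  pos : 0 < R
  core : ∀ r : ℝ, 0 ≤ r → (r : EReal) < R → IsCore eos Λ Pc (r ^ 2) p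
  local_sol : ∀ r : ℝ, 0 ≤ r → (r : EReal) < R → ∃ ε > 0, ∃ q,
    IsSol eos Λ Pc (-ε) (r ^ 2 + ε) q ∧ EqOn p q (Ico 0 (r ^ 2 + ε))
  maximal : ∀ r : ℝ, 0 ≤ r → ∀ q, IsCore eos Λ Pc (r ^ 2) q → (r : EReal) < R
  boundary : ∀ rb : ℝ, R = rb → ContinuousOn p (Icc 0 (rb ^ 2)) ∧ p (rb ^ 2) = 0 ∧
    0 < lapse eos Λ p (rb ^ 2)

lemma IsCore.exists_local_sol (heos : IsEquationOfState eos) {x : ℝ} (hx : 0 ≤ x) {p : ℝ → ℝ}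
    (hp : IsCore eos Λ Pc x p) : ∃ ε > 0, ∃ q, IsSol eos Λ Pc (-ε) (x + ε) q ∧
      IsCore eos Λ Pc (x + ε) q := by
  obtain ⟨ε, hε, q, h1, h2, -⟩ := hp.exists_extension heos hx
  exact ⟨ε / 2, by linarith, q, h1.mono (by linarith) (by linarith) (by linarith) (by linarith), h2⟩

/-- Uniqueness glues all solutions on intervals [0, x] into one. At a finite end the pressure has a
limit by monotonicity and the lapse stays positive by `IsSol.lapse_ge`; a positive limit would allow
one more extension. -/
theorem exists_isMaximal (heos : IsEquationOfState eos) (hΛ : Λ < 4 * Real.pi * eos 0)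
    (hPc : 0 < Pc) : ∃ R p, IsMaximal eos Λ Pc R p := by
  classical
  set Dom : Set ℝ := {x | 0 ≤ x ∧ ∃ p, IsCore eos Λ Pc x p} with hDom
  -- The default value 0 matters: it turns out to be the limit of the pressure at a finite boundary.
  set p : ℝ → ℝ := fun x => if h : x ∈ Dom then h.2.choose x else 0 with hp
  have hmono : ∀ {x y}, 0 ≤ x → x ≤ y → y ∈ Dom → x ∈ Dom := fun hx hxy hy =>
    ⟨hx, hy.2.choose, hy.2.choose_spec.mono hxy⟩
  have hpq : ∀ {x q}, 0 ≤ x → IsCore eos Λ Pc x q → EqOn q p (Icc 0 x) := by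
    intro x q hx hq s hs
    have hsD : s ∈ Dom := ⟨hs.1, q, hq.mono hs.2⟩
    simp only [hp, dif_pos hsD]
    exact (hq.mono hs.2).eqOn heos hs.1 hsD.2.choose_spec (right_mem_Icc.2 hs.1)
  have hcore : ∀ x ∈ Dom, IsCore eos Λ Pc x p := fun x hx =>
    hx.2.choose_spec.congr hx.1 (hpq hx.1 hx.2.choose_spec)
  have hloc : ∀ x ∈ Dom, ∃ ε > 0, ∃ q, IsSol eos Λ Pc (-ε) (x + ε) q ∧
      EqOn p q (Icc 0 (x + ε)) ∧ x + ε ∈ Dom := by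
    intro x hx
    obtain ⟨ε, hε, q, h1, h2⟩ := (hcore x hx).exists_local_sol heos hx.1
    have h0 : 0 ≤ x + ε := by linarith [hx.1]
    exact ⟨ε, hε, q, h1, (hpq h0 h2).symm, h0, q, h2⟩
  have h0D : (0 : ℝ) ∈ Dom := ⟨le_rfl, _, isCore_zero hPc⟩
  set R : EReal := sSup ((fun r : ℝ => (r : EReal)) '' {r | 0 ≤ r ∧ r ^ 2 ∈ Dom}) with hR
  -- The inequality is strict because every solution extends a little further, so the supremum is
  -- not attained.
  have hlt : ∀ r : ℝ, 0 ≤ r → ((r : EReal) < R ↔ r ^ 2 ∈ Dom) := by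
    intro r hr
    rw [hR, lt_sSup_iff]
    constructor
    · rintro ⟨_, ⟨r', ⟨hr', hD⟩, rfl⟩, hlt⟩
      have : r < r' := EReal.coe_lt_coe_iff.1 hlt
      exact hmono (sq_nonneg r) (by gcongr) hD
    · intro hD
      obtain ⟨ε, hε, -, -, -, hD'⟩ := hloc _ hD
      refine ⟨_, ⟨√(r ^ 2 + ε), ⟨Real.sqrt_nonneg _, ?_⟩, rfl⟩, ?_⟩
      · rwa [Real.sq_sqrt hD'.1]
      · exact EReal.coe_lt_coe_iff.2 (Real.lt_sqrt_of_sq_lt (by linarith))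
  refine ⟨R, p, ?_, fun r hr hrR => hcore _ ((hlt r hr).1 hrR), fun r hr hrR => ?_,
    fun r hr q hq => (hlt r hr).2 ⟨sq_nonneg r, q, hq⟩, ?_⟩
  · exact_mod_cast (hlt 0 le_rfl).2 (by simpa using h0D)
  · obtain ⟨ε, hε, q, h1, h2, -⟩ := hloc _ ((hlt r hr).1 hrR)
    exact ⟨ε, hε, q, h1, h2.mono Ico_subset_Icc_self⟩
  intro rb hrb
  have hrb0 : 0 < rb := by
    have : ((0 : ℝ) : EReal) < R := (hlt 0 le_rfl).2 (by simpa using h0D)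
    rw [hrb] at this
    exact EReal.coe_lt_coe_iff.1 this
  set X := rb ^ 2 with hX
  have hX0 : 0 < X := by positivity
  have hXD : X ∉ Dom := fun h => lt_irrefl R (by conv_lhs => rw [hrb]
                                                 exact (hlt rb hrb0.le).2 h)
  have hD : ∀ s, 0 ≤ s → s < X → s ∈ Dom := by
    intro s hs hsX
    have := (hlt (√s) (Real.sqrt_nonneg s)).1 (by
      rw [hrb]
      exact EReal.coe_lt_coe_iff.2 ((Real.sqrt_lt' hrb0).2 hsX))
    rwa [Real.sq_sqrt hs] at this
  have hder : ∀ s, 0 < s → s < X → ∃ d < 0, HasDerivAt p d s := by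
    intro s hs hsX
    obtain ⟨ε, hε, q, h1, h2, -⟩ := hloc s (hD s hs.le hsX)
    refine ⟨_, h1.tovRate_neg heos hΛ hs.le (by linarith), (h1.hasDerivAt s ⟨by linarith,
      by linarith⟩).congr_of_eventuallyEq ?_⟩
    filter_upwards [Icc_mem_nhds hs (by linarith : s < s + ε)] with t ht using h2 ht
  have hpos : ∀ s, 0 ≤ s → s < X → 0 < p s := fun s hs hsX =>
    (hcore s (hD s hs hsX)).pos s (right_mem_Icc.2 hs)
  have hcont : ContinuousOn p (Ico 0 X) := by
    intro s hs
    obtain ⟨t, h1, h2⟩ := exists_between hs.2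
    refine ((hcore t (hD t (hs.1.trans h1.le) h2)).cont s ⟨hs.1, h1.le⟩).mono_of_mem_nhdsWithin ?_
    rw [mem_nhdsWithin]
    exact ⟨Iio t, isOpen_Iio, h1, fun y hy => ⟨hy.2.1, (mem_Iio.1 hy.1).le⟩⟩
  have hanti : AntitoneOn p (Ioo 0 X) := by
    refine antitoneOn_of_deriv_nonpos (convex_Ioo 0 X) (hcont.mono Ioo_subset_Ico_self)
      (fun s hs => ?_) fun s hs => ?_
    · rw [interior_Ioo] at hs
      obtain ⟨d, -, h⟩ := hder s hs.1 hs.2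
      exact h.differentiableAt.differentiableWithinAt
    · rw [interior_Ioo] at hs
      obtain ⟨d, h0, h⟩ := hder s hs.1 hs.2
      rw [h.deriv]
      exact h0.le
  have hbdd : BddBelow (p '' Ioo 0 X) := ⟨0, by
    rintro _ ⟨s, hs, rfl⟩
    exact (hpos s hs.1.le hs.2).le⟩
  have hlim := AntitoneOn.tendsto_nhdsWithin_Ioo_left (nonempty_Ioo.2 hX0) hanti hbdd
  set Pb := sInf (p '' Ioo 0 X) with hPb
  have hPb0 : 0 ≤ Pb := le_csInf ((nonempty_Ioo.2 hX0).image p) (by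
    rintro _ ⟨s, hs, rfl⟩
    exact (hpos s hs.1.le hs.2).le)
  -- q closes up p at X by its limit. It is used to show that this limit is 0, after which q is p
  -- itself.
  set q := Function.update p X Pb with hq
  have hqX : q X = Pb := Function.update_self ..
  have hqp : ∀ s, s < X → q s = p s := fun s hs => Function.update_of_ne hs.ne _ _
  have hIco : Icc 0 X \ {X} = Ico 0 X := by
    ext s
    simp [lt_iff_le_and_ne]
  have hqc : ContinuousOn q (Icc 0 X) := by
    rw [hq, continuousOn_update_iff, hIco]
    exact ⟨hcont, fun _ => hlim.mono_left (nhdsWithin_mono _ fun s hs => hs.2)⟩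
  have hqpos : ∀ s ∈ Icc 0 X, 0 ≤ q s := by
    intro s hs
    rcases hs.2.lt_or_eq with h | h
    · rw [hqp s h]; exact (hpos s hs.1 h).le
    · rw [h, hqX]; exact hPb0
  have hlc := lapse_continuousOn (Λ := Λ) heos le_rfl hX0.le hqc hqpos
  have hqp' : ∀ t, t < X → EqOn p q (Icc 0 t) := fun t ht s hs =>
    (hqp s (hs.2.trans_lt ht)).symm
  -- The bound does not depend on s, so it survives in the limit s → X.
  have hlapse : ∀ s, 0 ≤ s → s < X → ((4 * Real.pi * eos 0 - Λ) / 3 /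
      (4 * Real.pi * Pc + 4 * Real.pi * eos Pc / 3 - Λ / 3)) ^ 2 ≤ lapse eos Λ q s := by
    intro s hs hsX
    obtain ⟨ε, hε, g, h1, h2, -⟩ := hloc s (hD s hs hsX)
    rw [← lapse_congr le_rfl hs (hqp' s hsX) (right_mem_Icc.2 hs),
      lapse_congr le_rfl (by linarith) h2 ⟨hs, by linarith⟩]
    exact h1.lapse_ge heos hΛ hs (by linarith)
  have hl0 : 0 < ((4 * Real.pi * eos 0 - Λ) / 3 /
      (4 * Real.pi * Pc + 4 * Real.pi * eos Pc / 3 - Λ / 3)) ^ 2 := by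
    have h1 : eos 0 ≤ eos Pc := heos.strictMonoOn.monotoneOn self_mem_Ici hPc.le hPc.le
    have h2 := Real.pi_pos
    have h3 : 4 * Real.pi * eos 0 ≤ 4 * Real.pi * eos Pc := by gcongr
    have h4 : 0 < 4 * Real.pi * Pc := by positivity
    exact pow_pos (div_pos (by linarith) (by linarith)) 2
  have hlX : 0 < lapse eos Λ q X := by
    refine hl0.trans_le (ge_of_tendsto (f := lapse eos Λ q) (x := 𝓝[<] X) ?_ ?_)
    · rw [← nhdsWithin_Ioo_eq_nhdsLT hX0]
      exact (hlc X (right_mem_Icc.2 hX0.le)).mono_left (nhdsWithin_mono X Ioo_subset_Icc_self)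
    · filter_upwards [Ioo_mem_nhdsLT hX0] with s hs using hlapse s hs.1.le hs.2
  have hlpos : ∀ s ∈ Icc 0 X, 0 < lapse eos Λ q s := by
    intro s hs
    rcases hs.2.lt_or_eq with h | h
    · exact hl0.trans_le (hlapse s hs.1 h)
    · rwa [h]
  -- Otherwise q would be a solution on the closed interval [0, X], the integral equation passing to
  -- the end point by continuity, and X would belong to the domain.
  have hPb : Pb = 0 := by
    by_contra hne
    refine hXD ⟨hX0.le, q, hqc, fun s hs => ?_, hlpos, ?_⟩
    · rcases hs.2.lt_or_eq with h | h
      · rw [hqp s h]; exact hpos s hs.1 h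
      · rw [h, hqX]; exact lt_of_le_of_ne hPb0 (Ne.symm hne)
    · have hrc := tovRate_continuousOn heos le_rfl hX0.le hqc hqpos hlpos
      refine Set.EqOn.of_subset_closure (s := Ico 0 X) (fun s hs => ?_) hqc ?_
        Ico_subset_Icc_self (closure_Ico hX0.ne).ge
      · exact ((hcore s (hD s hs.1 hs.2)).congr hs.1 (hqp' s hs.2)).eq s (right_mem_Icc.2 hs.1)
      · have := intervalIntegral.continuousOn_primitive_interval (a := 0) (b := X)
          (f := tovRate eos Λ q) (μ := MeasureTheory.volume)
          (by rw [uIcc_of_le hX0.le]; exact hrc.integrableOn_Icc)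
        rw [uIcc_of_le hX0.le] at this
        exact continuousOn_const.add this
  have hqeq : q = p := by
    rw [hq, hPb, Function.update_eq_self_iff]
    simp only [hp, dif_neg hXD]
  rw [hqeq] at hqc hlX hqX
  exact ⟨hqc, hqX.trans hPb, hlX⟩

end

/-! ### Every fluid solution satisfies the Tolman-Oppenheimer-Volkoff equation. -/

section

variable {eos : ℝ → ℝ} {Λ Pc : ℝ} {R : EReal}

lemma isOpen_posRadii (R : EReal) : IsOpen (posRadii R) :=
  isOpen_Ioi.inter (isOpen_Iio.preimage continuous_coe_real_ereal)

lemma posRadii_subset : posRadii R ⊆ radii R := fun _ hr => ⟨hr.1.le, hr.2⟩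

lemma Icc_subset_radii {r : ℝ} (hr : (r : EReal) < R) : Icc 0 r ⊆ radii R := fun _ hs =>
  ⟨hs.1, (EReal.coe_le_coe_iff.2 hs.2).trans_lt hr⟩

lemma Ioo_subset_posRadii {r : ℝ} (hr : (r : EReal) < R) : Ioo 0 r ⊆ posRadii R := fun _ hs =>
  ⟨hs.1, (EReal.coe_le_coe_iff.2 hs.2.le).trans_lt hr⟩

namespace IsFluidSolution
variable {ν a P : ℝ → ℝ}

lemma metricDerivs (h : IsFluidSolution eos Λ Pc R ν a P) :
    MetricDerivs ν a (deriv ν) (deriv (deriv ν)) (deriv a) (posRadii R) := by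
  have ho := isOpen_posRadii R
  have h2 := h.nu_contDiffOn
  rw [show (2 : WithTop ℕ∞) = 1 + 1 by norm_num, contDiffOn_succ_iff_deriv_of_isOpen ho] at h2
  exact ⟨ho, fun r hr => hr.1,
    fun r hr => (h2.1.differentiableAt (ho.mem_nhds hr)).hasDerivAt,
    fun r hr => ((h2.2.2.differentiableOn (by simp)).differentiableAt (ho.mem_nhds hr)).hasDerivAt,
    fun r hr => ((h.a_contDiffOn.differentiableOn (by simp)).differentiableAt
      (ho.mem_nhds hr)).hasDerivAt⟩

lemma ode (h : IsFluidSolution eos Λ Pc R ν a P) : ∀ r ∈ posRadii R,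
    1 - Real.exp (-a r) + r * deriv a r * Real.exp (-a r)
      = r ^ 2 * (8 * Real.pi * eos (P r) + Λ) ∧
    Real.exp (-a r) * (1 + r * deriv ν r) = 1 + r ^ 2 * (8 * Real.pi * P r - Λ) ∧
    Real.exp (-a r) * (deriv (deriv ν) r / 2 + deriv ν r ^ 2 / 4 - deriv ν r * deriv a r / 4
      + (deriv ν r - deriv a r) / (2 * r)) = 8 * Real.pi * P r - Λ :=
  (fieldEquations_iff h.metricDerivs Λ _ _).1 h.field

/-- Conservation of energy-momentum. -/
lemma hasDerivAt_pressure (h : IsFluidSolution eos Λ Pc R ν a P) {r : ℝ} (hr : r ∈ posRadii R) :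
    HasDerivAt P (-(eos (P r) + P r) * deriv ν r / 2) r := by
  have hm := h.metricDerivs
  obtain ⟨h1, h2, h3⟩ := h.ode r hr
  have hr0 : r ≠ 0 := hr.1.ne'
  have hpi := Real.pi_pos
  -- The rr equation expresses P through a and ν'. Differentiating it brings in ν'', which the
  -- angular equation removes; the tt and rr equations do the rest.
  have hd : HasDerivAt (fun s => ((Real.exp (-a s) * (1 + s * deriv ν s) - 1) / s ^ 2 + Λ)
      / (8 * Real.pi)) (-(eos (P r) + P r) * deriv ν r / 2) r := by
    have e1 := (hm.a r hr).fun_neg.exp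
    have e2 := ((hasDerivAt_id' r).fun_mul (hm.nu' r hr)).const_add 1
    have e3 : HasDerivAt (fun s : ℝ => s ^ 2) (2 * r) r := by simpa using hasDerivAt_pow 2 r
    refine (((((e1.fun_mul e2).sub_const 1).fun_div e3 (pow_ne_zero 2 hr0)).add_const
      Λ).div_const (8 * Real.pi)).congr_deriv ?_
    set A := Real.exp (-a r)
    set n := deriv ν r
    set n2 := deriv (deriv ν) r
    set b := deriv a r
    have h3' : A * (n2 * (2 * r) + n ^ 2 * r - n * b * r + 2 * (n - b)) =
        4 * r * (8 * Real.pi * P r - Λ) := by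
      field_simp at h3
      linear_combination h3 / 2
    field_simp
    linear_combination r * h3' - 4 * h2 - r * n * (h1 + h2)
  refine hd.congr_of_eventuallyEq ?_
  filter_upwards [(isOpen_posRadii R).mem_nhds hr] with s hs
  have h2 := (h.ode s hs).2.1
  have hs0 : s ≠ 0 := hs.1.ne'
  rw [h2]
  field_simp
  ring

/-- The pressure as a function of `x = r²`. -/
def pressureSq (P : ℝ → ℝ) (x : ℝ) : ℝ := P (√x)

lemma pressureSq_sq {r : ℝ} (hr : 0 ≤ r) : pressureSq P (r ^ 2) = P r := by
  rw [pressureSq, Real.sqrt_sq hr]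

lemma sqrt_mem_Icc {r x : ℝ} (hr : 0 ≤ r) (hx : x ∈ Icc 0 (r ^ 2)) : √x ∈ Icc 0 r :=
  ⟨Real.sqrt_nonneg x, Real.sqrt_le_iff.2 ⟨hr, hx.2⟩⟩

lemma pressureSq_continuousOn (h : IsFluidSolution eos Λ Pc R ν a P) {r : ℝ} (hr : r ∈ radii R) :
    ContinuousOn (pressureSq P) (Icc 0 (r ^ 2)) :=
  h.P_continuousOn.comp Real.continuous_sqrt.continuousOn
    fun _ hx => Icc_subset_radii hr.2 (sqrt_mem_Icc hr.1 hx)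

lemma pressureSq_pos (h : IsFluidSolution eos Λ Pc R ν a P) {r : ℝ} (hr : r ∈ radii R) :
    ∀ x ∈ Icc 0 (r ^ 2), 0 < pressureSq P x :=
  fun _ hx => h.P_pos _ (Icc_subset_radii hr.2 (sqrt_mem_Icc hr.1 hx))

/-- The tt equation says that s(1 - e^{-a}) has derivative s²(8πρ + Λ). It is integrated from the
centre, where continuity of a makes the boundary term vanish. -/
lemma exp_neg_a (heos : IsEquationOfState eos) (h : IsFluidSolution eos Λ Pc R ν a P) {r : ℝ}
    (hr : r ∈ radii R) : Real.exp (-a r) = lapse eos Λ (pressureSq P) (r ^ 2) := by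
  rcases hr.1.eq_or_lt with h0 | h0
  · rw [← h0, h.a_zero]
    simp [lapse]
  have hsub := Icc_subset_radii hr.2
  have hac := h.a_continuousOn.mono hsub
  have hPc := h.P_continuousOn.mono hsub
  have hρc : ContinuousOn (fun s => eos (P s)) (Icc 0 r) :=
    density_continuousOn heos hPc fun t ht => (h.P_pos t (hsub ht)).le
  have hint : ContinuousOn (fun s => s ^ 2 * eos (P s)) (Icc 0 r) :=
    (continuous_pow 2).continuousOn.mul hρc
  have hi1 : IntervalIntegrable (fun s => 8 * Real.pi * (s ^ 2 * eos (P s)))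
      MeasureTheory.volume 0 r := (hint.intervalIntegrable_of_Icc h0.le).const_mul _
  have hi2 : IntervalIntegrable (fun s : ℝ => Λ * s ^ 2) MeasureTheory.volume 0 r :=
    Continuous.intervalIntegrable (by fun_prop) _ _
  have key := intervalIntegral.integral_eq_sub_of_hasDerivAt_of_le h0.le
    (f := fun s => s * (1 - Real.exp (-a s)))
    (f' := fun s => 8 * Real.pi * (s ^ 2 * eos (P s)) + Λ * s ^ 2) (by fun_prop)
    (fun s hs => ?_) (hi1.add hi2)
  · rw [intervalIntegral.integral_add hi1 hi2, intervalIntegral.integral_const_mul,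
      intervalIntegral.integral_const_mul, integral_pow] at key
    have e : ∫ s in (0 : ℝ)..r, s ^ 2 * eos (P s) =
        r ^ 3 * moment 2 (fun s => eos (pressureSq P s)) (r ^ 2) := by
      rw [cube_mul_moment]
      refine intervalIntegral.integral_congr fun s hs => ?_
      rw [uIcc_of_le h0.le] at hs
      simp only [pressureSq_sq hs.1]
    rw [e] at key
    refine mul_left_cancel₀ h0.ne' ?_
    rw [lapse, meanDensity]
    norm_num at key
    linear_combination key
  · have hs' := Ioo_subset_posRadii hr.2 hs
    refine ((hasDerivAt_id' s).fun_mul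
      (((h.metricDerivs.a s hs').fun_neg.exp).const_sub 1)).congr_deriv ?_
    linear_combination (h.ode s hs').1

lemma lapse_pos (heos : IsEquationOfState eos) (h : IsFluidSolution eos Λ Pc R ν a P) {r : ℝ}
    (hr : r ∈ radii R) : 0 < lapse eos Λ (pressureSq P) (r ^ 2) :=
  h.exp_neg_a heos hr ▸ Real.exp_pos _

lemma deriv_nu (heos : IsEquationOfState eos) (h : IsFluidSolution eos Λ Pc R ν a P) {r : ℝ}
    (hr : r ∈ posRadii R) : deriv ν r =
      2 * r * (force eos Λ (pressureSq P) (r ^ 2) / lapse eos Λ (pressureSq P) (r ^ 2)) := by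
  have h2 := (h.ode r hr).2.1
  have hl := h.lapse_pos heos (posRadii_subset hr)
  rw [h.exp_neg_a heos (posRadii_subset hr)] at h2
  rw [← mul_div_assoc, eq_div_iff hl.ne']
  refine mul_left_cancel₀ hr.1.ne' ?_
  have e : lapse eos Λ (pressureSq P) (r ^ 2) =
    1 - (2 * meanDensity eos (pressureSq P) (r ^ 2) + Λ / 3) * r ^ 2 := rfl
  rw [force, pressureSq_sq hr.1.le]
  linear_combination h2 - e

/-- Off the centre the chain rule for √x turns the conservation law into the equation in x.
Continuity of P at the centre is enough for the integral form to hold from 0 on. -/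
theorem isCore (heos : IsEquationOfState eos) (h : IsFluidSolution eos Λ Pc R ν a P) {r : ℝ}
    (hr : r ∈ radii R) : IsCore eos Λ Pc (r ^ 2) (pressureSq P) := by
  have hmem : ∀ x ∈ Icc 0 (r ^ 2), √x ∈ radii R := fun x hx =>
    Icc_subset_radii hr.2 (sqrt_mem_Icc hr.1 hx)
  have hl : ∀ x ∈ Icc 0 (r ^ 2), 0 < lapse eos Λ (pressureSq P) x := fun x hx => by
    have := h.lapse_pos heos (hmem x hx)
    rwa [Real.sq_sqrt hx.1] at this
  have hc := h.pressureSq_continuousOn hr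
  have hpos := h.pressureSq_pos hr
  refine ⟨hc, hpos, hl, fun x hx => ?_⟩
  have hsub : Icc 0 x ⊆ Icc 0 (r ^ 2) := Icc_subset_Icc_right hx.2
  have hrc := tovRate_continuousOn heos le_rfl (sq_nonneg r) hc (fun t ht => (hpos t ht).le) hl
  rw [intervalIntegral.integral_eq_sub_of_hasDerivAt_of_le hx.1 (hc.mono hsub) (fun s hs => ?_)
    ((hrc.mono hsub).intervalIntegrable_of_Icc hx.1)]
  · rw [show pressureSq P 0 = Pc by rw [pressureSq, Real.sqrt_zero, h.P_zero]]
    ring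
  · have hs' := hmem s (hsub (Ioo_subset_Icc_self hs))
    have hs0 : 0 < √s := Real.sqrt_pos.2 hs.1
    have hmem' : √s ∈ posRadii R := ⟨hs0, hs'.2⟩
    have h1 := (h.hasDerivAt_pressure hmem').comp s (Real.hasDerivAt_sqrt hs.1.ne')
    refine h1.congr_deriv ?_
    rw [h.deriv_nu heos hmem', Real.sq_sqrt hs.1.le, tovRate]
    have hls := hl s (hsub (Ioo_subset_Icc_self hs))
    rw [show pressureSq P s = P √s from rfl]
    field_simp

end IsFluidSolution

end

/-! ### The maximal solution as a fluid solution. -/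

section

variable {eos : ℝ → ℝ} {Λ Pc : ℝ} {R : EReal} {p : ℝ → ℝ}

lemma contDiffOn_of_contDiffAt {n : WithTop ℕ∞} {f : ℝ → ℝ} {s : Set ℝ}
    (h : ∀ x ∈ s, ContDiffAt ℝ n f x) : ContDiffOn ℝ n f s :=
  fun x hx => (h x hx).contDiffWithinAt

lemma hasDerivAt_comp_sq {f : ℝ → ℝ} {f' r : ℝ} (h : HasDerivAt f f' (r ^ 2)) :
    HasDerivAt (fun s => f (s ^ 2)) (f' * (2 * r)) r := by
  have h1 : HasDerivAt (fun s : ℝ => s ^ 2) (2 * r) r := by simpa using hasDerivAt_pow 2 r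
  exact h.comp_of_eq r h1 rfl

namespace IsMaximal

/-- p agrees with a two-sided local solution only for nonnegative arguments, but φ takes no others.
With φ = r² and φ = ‖x‖² this yields smoothness including the centre. -/
lemma smooth_comp (heos : IsEquationOfState eos) (hp : IsMaximal eos Λ Pc R p) {E : Type*}
    [NormedAddCommGroup E] [NormedSpace ℝ E] {φ : E → ℝ} {y : E} {r : ℝ} (hr : r ∈ radii R)
    (hφ : ContDiffAt ℝ ∞ φ y) (h0 : ∀ z, 0 ≤ φ z) (hy : φ y = r ^ 2) :
    ContDiffAt ℝ ∞ (fun z => p (φ z)) y ∧ ContDiffAt ℝ ∞ (fun z => lapse eos Λ p (φ z)) y ∧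
    ContDiffAt ℝ ∞ (fun z => meanDensity eos p (φ z)) y ∧
    ContDiffAt ℝ ∞ (fun z => potential eos Λ p (φ z)) y := by
  obtain ⟨ε, hε, q, hq, hpq⟩ := hp.local_sol r hr.1 hr.2
  have hmem : φ y ∈ Ioo (-ε) (r ^ 2 + ε) := by
    rw [hy]; exact ⟨by nlinarith [sq_nonneg r], by linarith⟩
  have hev : ∀ᶠ z in 𝓝 y, φ z ∈ Ico 0 (r ^ 2 + ε) := by
    filter_upwards [hφ.continuousAt.eventually (isOpen_Ioo.mem_nhds hmem)] with z hz
    exact ⟨h0 z, hz.2⟩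
  have key : ∀ f g : ℝ → ℝ, ContDiffOn ℝ ∞ g (Ioo (-ε) (r ^ 2 + ε)) →
      (∀ t ∈ Ico 0 (r ^ 2 + ε), f t = g t) → ContDiffAt ℝ ∞ (fun z => f (φ z)) y := by
    intro f g hg hfg
    refine ((hg.contDiffAt (isOpen_Ioo.mem_nhds hmem)).comp y hφ).congr_of_eventuallyEq ?_
    filter_upwards [hev] with z hz using hfg _ hz
  have hsub : ∀ t ∈ Ico 0 (r ^ 2 + ε), EqOn p q (Icc 0 t) := fun t ht =>
    hpq.mono (Icc_subset_Ico_right ht.2)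
  exact ⟨key _ _ (hq.contDiffOn heos) hpq,
    key _ _ (hq.lapse_smooth heos) fun t ht =>
      lapse_congr le_rfl ht.1 (hsub t ht) (right_mem_Icc.2 ht.1),
    key _ _ (hq.meanDensity_smooth heos) fun t ht =>
      meanDensity_congr le_rfl ht.1 (hsub t ht) (right_mem_Icc.2 ht.1),
    key _ _ (hq.potential_smooth heos) fun t ht =>
      potential_congr ht.1 (hsub t ht) (right_mem_Icc.2 ht.1)⟩

lemma pressure_pos (hp : IsMaximal eos Λ Pc R p) {r : ℝ} (hr : r ∈ radii R) : 0 < p (r ^ 2) :=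
  (hp.core r hr.1 hr.2).pos _ (right_mem_Icc.2 (sq_nonneg r))

lemma lapse_pos (hp : IsMaximal eos Λ Pc R p) {r : ℝ} (hr : r ∈ radii R) :
    0 < lapse eos Λ p (r ^ 2) :=
  (hp.core r hr.1 hr.2).lapse_pos _ (right_mem_Icc.2 (sq_nonneg r))

/-- For r > 0, p agrees with a local solution on a neighbourhood of r², and w' can be solved for
explicitly from 2xw' + 3w = 4πρ. -/
lemma hasDerivAt (heos : IsEquationOfState eos) (hΛ : Λ < 4 * Real.pi * eos 0)
    (hp : IsMaximal eos Λ Pc R p) {r : ℝ} (hr : r ∈ posRadii R) :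
    tovRate eos Λ p (r ^ 2) < 0 ∧
    HasDerivAt p (tovRate eos Λ p (r ^ 2)) (r ^ 2) ∧
    HasDerivAt (lapse eos Λ p)
      (meanDensity eos p (r ^ 2) - 4 * Real.pi * eos (p (r ^ 2)) - Λ / 3) (r ^ 2) ∧
    HasDerivAt (force eos Λ p) (4 * Real.pi * tovRate eos Λ p (r ^ 2) +
      (4 * Real.pi * eos (p (r ^ 2)) - 3 * meanDensity eos p (r ^ 2)) / (2 * r ^ 2)) (r ^ 2) ∧
    HasDerivAt (potential eos Λ p)
      (force eos Λ p (r ^ 2) / lapse eos Λ p (r ^ 2)) (r ^ 2) := by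
  obtain ⟨ε, hε, q, hq, hpq⟩ := hp.local_sol r hr.1.le hr.2
  have hr2 : 0 < r ^ 2 := pow_pos hr.1 2
  set x := r ^ 2
  have hx : x ∈ Ioo (-ε) (x + ε) := ⟨by linarith, by linarith⟩
  have hev : ∀ᶠ s in 𝓝 x, s ∈ Ico 0 (x + ε) := by
    filter_upwards [Ico_mem_nhds hr2 hx.2] with s hs using hs
  have hsub : ∀ t ∈ Ico 0 (x + ε), EqOn p q (Icc 0 t) := fun t ht =>
    hpq.mono (Icc_subset_Ico_right ht.2)
  have hx' : x ∈ Ico 0 (x + ε) := ⟨hr2.le, hx.2⟩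
  have hxr := right_mem_Icc.2 hr2.le
  obtain ⟨w', h1, -, h3, h4⟩ := hq.exists_hasDerivAt heos hΛ hx
  rw [tovRate_congr le_rfl hr2.le (hsub x hx') hxr, force_congr le_rfl hr2.le (hsub x hx') hxr,
    lapse_congr le_rfl hr2.le (hsub x hx') hxr, meanDensity_congr le_rfl hr2.le (hsub x hx') hxr,
    hpq hx']
  have hw : w' = (4 * Real.pi * eos (q x) - 3 * meanDensity eos q x) / (2 * x) := by
    field_simp
    linear_combination h1
  rw [← hw]
  refine ⟨hq.tovRate_neg heos hΛ hr2.le hx.2, (hq.hasDerivAt x hx).congr_of_eventuallyEq ?_,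
    h3.congr_of_eventuallyEq ?_, h4.congr_of_eventuallyEq ?_,
    (hq.potential_hasDerivAt heos hx).congr_of_eventuallyEq ?_⟩
  · filter_upwards [hev] with s hs using hpq hs
  · filter_upwards [hev] with s hs using
      lapse_congr le_rfl hs.1 (hsub s hs) (right_mem_Icc.2 hs.1)
  · filter_upwards [hev] with s hs using
      force_congr le_rfl hs.1 (hsub s hs) (right_mem_Icc.2 hs.1)
  · filter_upwards [hev] with s hs using
      potential_congr hs.1 (hsub s hs) (right_mem_Icc.2 hs.1)

end IsMaximal

/-- `ν(r)` of the solution with pressure `p (r²)`. -/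
def nuOf (eos : ℝ → ℝ) (Λ : ℝ) (p : ℝ → ℝ) (r : ℝ) : ℝ := potential eos Λ p (r ^ 2)

/-- `a(r)` of the solution with pressure `p (r²)`. -/
def aOf (eos : ℝ → ℝ) (Λ : ℝ) (p : ℝ → ℝ) (r : ℝ) : ℝ := -Real.log (lapse eos Λ p (r ^ 2))

namespace IsMaximal

lemma exists_metricDerivs (heos : IsEquationOfState eos) (hΛ : Λ < 4 * Real.pi * eos 0)
    (hp : IsMaximal eos Λ Pc R p) : ∃ ν2 a1 : ℝ → ℝ,
    MetricDerivs (nuOf eos Λ p) (aOf eos Λ p)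
      (fun r => 2 * r * (force eos Λ p (r ^ 2) / lapse eos Λ p (r ^ 2))) ν2 a1 (posRadii R) ∧
    ∀ r ∈ posRadii R,
      1 - Real.exp (-aOf eos Λ p r) + r * a1 r * Real.exp (-aOf eos Λ p r)
        = r ^ 2 * (8 * Real.pi * eos (p (r ^ 2)) + Λ) ∧
      Real.exp (-aOf eos Λ p r) *
        (1 + r * (2 * r * (force eos Λ p (r ^ 2) / lapse eos Λ p (r ^ 2))))
        = 1 + r ^ 2 * (8 * Real.pi * p (r ^ 2) - Λ) ∧
      Real.exp (-aOf eos Λ p r) * (ν2 r / 2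
        + (2 * r * (force eos Λ p (r ^ 2) / lapse eos Λ p (r ^ 2))) ^ 2 / 4
        - (2 * r * (force eos Λ p (r ^ 2) / lapse eos Λ p (r ^ 2))) * a1 r / 4
        + ((2 * r * (force eos Λ p (r ^ 2) / lapse eos Λ p (r ^ 2))) - a1 r) / (2 * r))
        = 8 * Real.pi * p (r ^ 2) - Λ := by
  refine ⟨fun r => 2 * (force eos Λ p (r ^ 2) / lapse eos Λ p (r ^ 2)) + 2 * r *
    (((4 * Real.pi * tovRate eos Λ p (r ^ 2) +
      (4 * Real.pi * eos (p (r ^ 2)) - 3 * meanDensity eos p (r ^ 2)) / (2 * r ^ 2)) * (2 * r)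
        * lapse eos Λ p (r ^ 2) - force eos Λ p (r ^ 2) *
      ((meanDensity eos p (r ^ 2) - 4 * Real.pi * eos (p (r ^ 2)) - Λ / 3) * (2 * r)))
        / lapse eos Λ p (r ^ 2) ^ 2),
    fun r => -((meanDensity eos p (r ^ 2) - 4 * Real.pi * eos (p (r ^ 2)) - Λ / 3) * (2 * r)
      / lapse eos Λ p (r ^ 2)),
    ⟨isOpen_posRadii R, fun r hr => hr.1, fun r hr => ?_, fun r hr => ?_, fun r hr => ?_⟩,
    fun r hr => ?_⟩
  · obtain ⟨-, -, -, -, h⟩ := hp.hasDerivAt heos hΛ hr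
    exact (hasDerivAt_comp_sq h).congr_deriv (by ring)
  · obtain ⟨-, -, h1, h2, -⟩ := hp.hasDerivAt heos hΛ hr
    have := ((hasDerivAt_comp_sq h2).fun_div (hasDerivAt_comp_sq h1) (hp.lapse_pos (posRadii_subset hr)).ne')
    refine (((hasDerivAt_id' r).const_mul 2).fun_mul this).congr_deriv ?_
    simp only [mul_one]
  · obtain ⟨-, -, h1, -, -⟩ := hp.hasDerivAt heos hΛ hr
    exact ((hasDerivAt_comp_sq h1).log (hp.lapse_pos (posRadii_subset hr)).ne').fun_neg
  · have hl := hp.lapse_pos (posRadii_subset hr)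
    have hr0 := hr.1.ne'
    have e : Real.exp (-aOf eos Λ p r) = lapse eos Λ p (r ^ 2) := by
      rw [aOf, neg_neg, Real.exp_log hl]
    have eY : lapse eos Λ p (r ^ 2) = 1 - (2 * meanDensity eos p (r ^ 2) + Λ / 3) * r ^ 2 := rfl
    have eF : force eos Λ p (r ^ 2) =
      4 * Real.pi * p (r ^ 2) + meanDensity eos p (r ^ 2) - Λ / 3 := rfl
    simp only [e, tovRate]
    refine ⟨?_, ?_, ?_⟩
    · field_simp
      rw [eY]
      ring
    · field_simp
      rw [eY, eF]
      ring
    · field_simp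
      rw [eF]
      -- With w and Y as plain variables, eliminating Y by its definition leaves a polynomial
      -- identity.
      generalize meanDensity eos p (r ^ 2) = w at *
      generalize lapse eos Λ p (r ^ 2) = Y at *
      subst eY
      ring

theorem isFluidSolution (heos : IsEquationOfState eos) (hΛ : Λ < 4 * Real.pi * eos 0)
    (hp : IsMaximal eos Λ Pc R p) :
    IsFluidSolution eos Λ Pc R (nuOf eos Λ p) (aOf eos Λ p) (fun r => p (r ^ 2)) := by
  obtain ⟨ν2, a1, hm, hode⟩ := hp.exists_metricDerivs heos hΛ
  have hsm := fun (r : ℝ) (hr : r ∈ radii R) => hp.smooth_comp heos (φ := fun s : ℝ => s ^ 2) hr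
    (by fun_prop) (fun z => sq_nonneg z) rfl
  have hν : ContDiffOn ℝ ∞ (nuOf eos Λ p) (radii R) := contDiffOn_of_contDiffAt fun r hr =>
    (hsm r hr).2.2.2
  have ha : ContDiffOn ℝ ∞ (aOf eos Λ p) (radii R) := contDiffOn_of_contDiffAt fun r hr =>
    ((hsm r hr).2.1.log (hp.lapse_pos hr).ne').neg
  have hP : ContDiffOn ℝ ∞ (fun r => p (r ^ 2)) (radii R) := contDiffOn_of_contDiffAt fun r hr =>
    (hsm r hr).1
  exact ⟨hp.pos, contDiffOn_infty.1 (hν.mono posRadii_subset) 2,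
    (ha.mono posRadii_subset).of_le (by simp),
    (hP.mono posRadii_subset).of_le (by simp), hν.continuousOn, ha.continuousOn,
    hP.continuousOn, by simp [nuOf, potential], by simp [aOf, lapse], by
      simpa using (hp.core 0 le_rfl (by simpa using hp.pos)).eq 0 (by simp),
    fun r hr => hp.pressure_pos hr, (fieldEquations_iff hm Λ _ _).2 hode⟩

theorem isSmoothOnBall (heos : IsEquationOfState eos) (hp : IsMaximal eos Λ Pc R p) :
    IsSmoothOnBall R (nuOf eos Λ p) (aOf eos Λ p) (fun r => p (r ^ 2)) := by
  have hsm := fun (x : EuclideanSpace ℝ (Fin 3)) (hx : ((‖x‖ : ℝ) : EReal) < R) =>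
    hp.smooth_comp heos (φ := fun y : EuclideanSpace ℝ (Fin 3) => ‖y‖ ^ 2) (y := x)
      (r := ‖x‖) ⟨norm_nonneg x, hx⟩ (contDiff_norm_sq ℝ).contDiffAt
      (fun z => sq_nonneg _) rfl
  refine ⟨fun x hx => (hsm x hx).2.2.2.contDiffWithinAt, fun i j => ?_,
    fun x hx => (hsm x hx).1.contDiffWithinAt⟩
  have hlp := fun (x : EuclideanSpace ℝ (Fin 3)) (hx : ((‖x‖ : ℝ) : EReal) < R) =>
    hp.lapse_pos (r := ‖x‖) ⟨norm_nonneg x, hx⟩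
  -- Since 1 - Y = (2w + Λ/3) r², the quotient (e^a - 1)/r² equals (2w + Λ/3)/Y, which has no
  -- singularity at the centre.
  have hsmooth : ContDiffOn ℝ ∞ (fun x : EuclideanSpace ℝ (Fin 3) => (if i = j then 1 else 0) +
      (2 * meanDensity eos p (‖x‖ ^ 2) + Λ / 3) / lapse eos Λ p (‖x‖ ^ 2) * (x i * x j))
      {x | ((‖x‖ : ℝ) : EReal) < R} := by
    intro x hx
    refine ContDiffAt.contDiffWithinAt (contDiffAt_const.add ((ContDiffAt.div ?_ (hsm x hx).2.1
      (hlp x hx).ne').mul ?_))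
    · exact (contDiffAt_const.mul (hsm x hx).2.2.1).add contDiffAt_const
    · fun_prop
  refine hsmooth.congr fun x hx => ?_
  rw [cartesianMetric, aOf, Real.exp_neg, Real.exp_log (hlp x hx)]
  by_cases h0 : x = 0
  · simp [h0]
  · have h1 : ‖x‖ ≠ 0 := norm_ne_zero_iff.2 h0
    have h2 := (hlp x hx).ne'
    have eY : lapse eos Λ p (‖x‖ ^ 2) = 1 - (2 * meanDensity eos p (‖x‖ ^ 2) + Λ / 3) * ‖x‖ ^ 2 :=
      rfl
    field_simp
    rw [eY]
    ring

theorem strictAntiOn (heos : IsEquationOfState eos) (hΛ : Λ < 4 * Real.pi * eos 0)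
    (hp : IsMaximal eos Λ Pc R p) : StrictAntiOn (fun r => p (r ^ 2)) (radii R) := by
  intro r hr s hs hrs
  refine strictAntiOn_of_deriv_neg (f := fun r => p (r ^ 2)) (convex_Icc 0 s)
    ((hp.isFluidSolution heos hΛ).P_continuousOn.mono (Icc_subset_radii hs.2)) (fun t ht => ?_)
    ⟨hr.1, hrs.le⟩ (right_mem_Icc.2 hs.1) hrs
  rw [interior_Icc] at ht
  obtain ⟨h0, h, -⟩ := hp.hasDerivAt heos hΛ (Ioo_subset_posRadii hs.2 ht)
  rw [(hasDerivAt_comp_sq h).deriv]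
  exact mul_neg_of_neg_of_pos h0 (by linarith [ht.1])

/-- Every fluid solution is a restriction of the maximal one. -/
theorem eqOn (heos : IsEquationOfState eos) (hΛ : Λ < 4 * Real.pi * eos 0)
    (hp : IsMaximal eos Λ Pc R p) {R' : EReal} {ν a P : ℝ → ℝ}
    (h : IsFluidSolution eos Λ Pc R' ν a P) : R' ≤ R ∧ EqOn ν (nuOf eos Λ p) (radii R') ∧
      EqOn a (aOf eos Λ p) (radii R') ∧ EqOn P (fun r => p (r ^ 2)) (radii R') := by
  have hlt : ∀ r ∈ radii R', r ∈ radii R := fun r hr =>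
    ⟨hr.1, hp.maximal r hr.1 _ (h.isCore heos hr)⟩
  have heq : ∀ r ∈ radii R', EqOn (IsFluidSolution.pressureSq P) p (Icc 0 (r ^ 2)) :=
    fun r hr => (h.isCore heos hr).eqOn heos (sq_nonneg r) (hp.core r hr.1 (hlt r hr).2)
  have hF := hp.isFluidSolution heos hΛ
  refine ⟨?_, ?_, ?_, ?_⟩
  · by_contra hlt'
    push Not at hlt'
    obtain ⟨r, h1, h2⟩ := EReal.lt_iff_exists_real_btwn.1 hlt'
    have hr : 0 ≤ r := (EReal.coe_le_coe_iff.1 (by simpa using (hp.pos.trans h1).le) : (0 : ℝ) ≤ r)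
    exact lt_asymm h1 (hlt r ⟨hr, h2⟩).2
  · intro r hr
    have hsub := Icc_subset_radii hr.2
    have hm := h.metricDerivs
    obtain ⟨ν2, a1, hm', -⟩ := hp.exists_metricDerivs heos hΛ
    -- The two functions ν have the same derivative off the centre, are continuous there, and both
    -- vanish at 0.
    have key := intervalIntegral.integral_eq_sub_of_hasDerivAt_of_le hr.1
      (f := fun s => ν s - nuOf eos Λ p s) (f' := fun _ => 0)
      ((h.nu_continuousOn.mono hsub).sub
        (hF.nu_continuousOn.mono fun s hs => hlt s (hsub hs))) (fun s hs => ?_) (by simp)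
    · have h0 := hF.nu_zero
      simp only [intervalIntegral.integral_zero, h.nu_zero, h0] at key
      linarith
    · have hs' := Ioo_subset_posRadii hr.2 hs
      refine ((hm.nu s hs').fun_sub (hm'.nu s ⟨hs.1, (hlt s (posRadii_subset hs')).2⟩)).congr_deriv ?_
      have e := heq s (posRadii_subset hs')
      have hs2 := right_mem_Icc.2 (sq_nonneg s)
      rw [h.deriv_nu heos hs', force_congr le_rfl (sq_nonneg s) e hs2,
        lapse_congr le_rfl (sq_nonneg s) e hs2, sub_self]
  · intro r hr
    have h1 := h.exp_neg_a heos hr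
    rw [lapse_congr le_rfl (sq_nonneg r) (heq r hr) (right_mem_Icc.2 (sq_nonneg r))] at h1
    rw [aOf, ← h1, Real.log_exp, neg_neg]
  · intro r hr
    have := heq r hr (right_mem_Icc.2 (sq_nonneg r))
    rwa [IsFluidSolution.pressureSq_sq hr.1] at this

end IsMaximal

end

/-! ### Gluing at the boundary and the Gauss coordinate. -/

section

lemma glue_of_lt {rb r : ℝ} (u v : ℝ → ℝ) (h : r < rb) : glue rb u v r = u r := if_pos h

lemma glue_of_le {rb r : ℝ} (u v : ℝ → ℝ) (h : rb ≤ r) : glue rb u v r = v r := if_neg h.not_gt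

lemma glue_eqOn_Iic {rb : ℝ} {u v : ℝ → ℝ} (h : u rb = v rb) : EqOn (glue rb u v) u (Iic rb) := by
  intro r hr
  rcases (mem_Iic.1 hr).lt_or_eq with h1 | h1
  · exact glue_of_lt u v h1
  · rw [glue_of_le u v h1.ge, h1, h]

lemma glue_continuousOn {rb : ℝ} {u v : ℝ → ℝ} {T : Set ℝ} (hu : ContinuousOn u (T ∩ Iic rb))
    (hv : ContinuousOn v (T ∩ Ici rb)) (h : u rb = v rb) : ContinuousOn (glue rb u v) T := by
  have hT : T = (T ∩ Iic rb) ∪ (T ∩ Ici rb) := by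
    rw [← inter_union_distrib_left, Iic_union_Ici, inter_univ]
  have h1 : ContinuousOn (glue rb u v) (T ∩ Iic rb) :=
    hu.congr fun r hr => glue_eqOn_Iic h hr.2
  have h2 : ContinuousOn (glue rb u v) (T ∩ Ici rb) :=
    hv.congr fun r hr => glue_of_le u v hr.2
  intro x hx
  rw [hT]
  refine ContinuousWithinAt.union ?_ ?_
  · by_cases hxr : x ≤ rb
    · exact h1 x ⟨hx, hxr⟩
    · refine continuousWithinAt_of_notMem_closure fun hc => hxr ?_
      exact (closure_minimal inter_subset_right isClosed_Iic) hc
  · by_cases hxr : rb ≤ x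
    · exact h2 x ⟨hx, hxr⟩
    · refine continuousWithinAt_of_notMem_closure fun hc => hxr ?_
      exact (closure_minimal inter_subset_right isClosed_Ici) hc

lemma contDiffOn_one_of_hasDerivAt {f f' : ℝ → ℝ} {S : Set ℝ} (hS : IsOpen S)
    (h : ∀ x ∈ S, HasDerivAt f (f' x) x) (hc : ContinuousOn f' S) : ContDiffOn ℝ 1 f S := by
  rw [show (1 : WithTop ℕ∞) = 0 + 1 by norm_num, contDiffOn_succ_iff_deriv_of_isOpen hS]
  exact ⟨fun x hx => (h x hx).differentiableAt.differentiableWithinAt, by simp,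
    contDiffOn_zero.2 (hc.congr fun x hx => (h x hx).deriv)⟩

/-- Two `C¹` functions that agree to first order at `rb` can be glued there. -/
lemma glue_contDiffOn {rb α : ℝ} {u v u' v' : ℝ → ℝ} {T : Set ℝ} (hT : IsOpen T) (hα : α < rb)
    (hrb : rb ∈ T) (hTα : T ⊆ Ioi α) (hTα' : Ioo α rb ⊆ T)
    (hu : ∀ r ∈ Ioo α rb, HasDerivAt u (u' r) r) (huc : ContinuousOn u (Ioc α rb))
    (hu' : ContinuousOn u' (Ioc α rb)) (hv : ∀ r ∈ T ∩ Ici rb, HasDerivAt v (v' r) r)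
    (hv' : ContinuousOn v' (T ∩ Ici rb)) (h0 : u rb = v rb) (h1 : u' rb = v' rb) :
    ContDiffOn ℝ 1 (glue rb u v) T := by
  have hsub : T ∩ Iic rb ⊆ Ioc α rb := fun r hr => ⟨hTα hr.1, hr.2⟩
  have hc : ContinuousOn (glue rb u v) T := glue_continuousOn (huc.mono hsub)
    (fun r hr => (hv r hr).continuousAt.continuousWithinAt) h0
  have hc' : ContinuousOn (glue rb u' v') T := glue_continuousOn (hu'.mono hsub) hv' h1
  refine contDiffOn_one_of_hasDerivAt hT (f' := glue rb u' v') (fun r hr => ?_) hc'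
  have hlt : ∀ r ∈ Ioo α rb, HasDerivAt (glue rb u v) (glue rb u' v' r) r := fun r hr => by
    rw [glue_of_lt _ _ hr.2]
    refine (hu r hr).congr_of_eventuallyEq ?_
    filter_upwards [Iio_mem_nhds hr.2] with s hs using glue_of_lt u v hs
  rcases lt_trichotomy r rb with hrr | hrr | hrr
  · exact hlt r ⟨hTα hr, hrr⟩
  · subst hrr
    -- No derivative of u at the boundary is assumed; the left derivative is obtained as the limit
    -- of the derivatives inside.
    have hL : HasDerivWithinAt (glue r u v) (glue r u' v' r) (Iic r) r := by
      refine hasDerivWithinAt_Iic_of_tendsto_deriv (s := Ioo α r)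
        (fun s hs => (hlt s hs).differentiableAt.differentiableWithinAt)
        ((hc r hr).mono hTα') (Ioo_mem_nhdsLT hα) ?_
      have h2 : Tendsto (glue r u' v') (𝓝[<] r) (𝓝 (glue r u' v' r)) := by
        rw [← nhdsWithin_Ioo_eq_nhdsLT hα]
        exact (hc' r hr).mono_left (nhdsWithin_mono _ hTα')
      refine h2.congr' ?_
      filter_upwards [Ioo_mem_nhdsLT hα] with s hs using (hlt s hs).deriv.symm
    have hR : HasDerivWithinAt (glue r u v) (glue r u' v' r) (Ici r) r := by
      rw [glue_of_le _ _ le_rfl]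
      exact (hv r ⟨hr, mem_Ici.2 le_rfl⟩).hasDerivWithinAt.congr
        (fun s hs => glue_of_le u v hs) (glue_of_le u v le_rfl)
    have := hL.union hR
    rwa [Iic_union_Ici, hasDerivWithinAt_univ] at this
  · rw [glue_of_le _ _ hrr.le]
    refine (hv r ⟨hr, hrr.le⟩).congr_of_eventuallyEq ?_
    filter_upwards [Ioi_mem_nhds hrr] with s hs using glue_of_le u v (mem_Ioi.1 hs).le

/-- A `C¹` function with positive derivative on an interval has a `C¹` inverse. -/
lemma exists_contDiffOn_inverse {f f' : ℝ → ℝ} {S : Set ℝ} (hS : IsOpen S) (hconv : Convex ℝ S)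
    (h : ∀ x ∈ S, HasDerivAt f (f' x) x) (hc : ContinuousOn f' S) (hpos : ∀ x ∈ S, 0 < f' x) :
    ∃ g : ℝ → ℝ, (∀ x ∈ S, g (f x) = x) ∧ ContDiffOn ℝ 1 g (f '' S) := by
  have hinj : InjOn f S := (strictMonoOn_of_deriv_pos hconv
    (fun x hx => (h x hx).continuousAt.continuousWithinAt) fun x hx => by
      rw [(h x (interior_subset hx)).deriv]
      exact hpos x (interior_subset hx)).injOn
  have hf := contDiffOn_one_of_hasDerivAt hS h hc
  have hleft : ∀ x ∈ S, Function.invFunOn f S (f x) = x := fun x hx => hinj.leftInvOn_invFunOn hx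
  refine ⟨Function.invFunOn f S, hleft, ?_⟩
  rintro _ ⟨x, hx, rfl⟩
  have hfx := hf.contDiffAt (hS.mem_nhds hx)
  have hd := (h x hx).hasFDerivAt_equiv (hpos x hx).ne'
  refine ((hfx.to_localInverse hd one_ne_zero).congr_of_eventuallyEq ?_).contDiffWithinAt
  have hs := hfx.hasStrictFDerivAt' hd one_ne_zero
  filter_upwards [hs.eventually_right_inverse, hs.localInverse_tendsto.eventually (hS.mem_nhds hx)]
    with y hy hyS
  change Function.invFunOn f S y = hs.localInverse f _ x y
  conv_lhs => rw [← hy]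
  exact hleft _ hyS

lemma convex_posRadii (R : EReal) : Convex ℝ (posRadii R) := by
  rw [convex_iff_ordConnected]
  exact ⟨fun x hx y hy z hz => ⟨lt_of_lt_of_le hx.1 hz.1,
    (EReal.coe_le_coe_iff.2 hz.2).trans_lt hy.2⟩⟩

lemma gaussCoord_hasDerivAt {R : EReal} {a : ℝ → ℝ} (ha : ContinuousOn a (radii R)) {r : ℝ}
    (hr : r ∈ posRadii R) : HasDerivAt (gaussCoord a) (Real.exp (a r / 2)) r := by
  have hE : ContinuousOn (fun s => Real.exp (a s / 2)) (radii R) := by fun_prop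
  have hE' := hE.mono (posRadii_subset (R := R))
  exact intervalIntegral.integral_hasDerivAt_right
    ((hE.mono (Icc_subset_radii hr.2)).intervalIntegrable_of_Icc hr.1.le)
    (hE'.stronglyMeasurableAtFilter (isOpen_posRadii R) r hr)
    (hE'.continuousAt ((isOpen_posRadii R).mem_nhds hr))

/-- The derivative of χ(r) is e^{a/2}, continuous and positive. So continuity of a suffices for r(χ)
to be C¹, even if a has a kink. -/
lemma isC1InGaussCoord {R : EReal} {ν a : ℝ → ℝ} (ha : ContinuousOn a (radii R))
    (hν : ContDiffOn ℝ 1 ν (posRadii R)) : IsC1InGaussCoord R ν a := by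
  obtain ⟨g, hg, hgc⟩ := exists_contDiffOn_inverse (isOpen_posRadii R) (convex_posRadii R)
    (f := gaussCoord a) (f' := fun r => Real.exp (a r / 2)) (fun r hr => gaussCoord_hasDerivAt ha hr)
    (by have := ha.mono (posRadii_subset (R := R)); fun_prop) fun r _ => Real.exp_pos _
  refine ⟨g, hg, hgc, (hν.comp hgc ?_).exp⟩
  rintro _ ⟨r, hr, rfl⟩
  rwa [hg r hr]

lemma sdsFactor_hasDerivAt (Λ M : ℝ) {r : ℝ} (hr : r ≠ 0) :
    HasDerivAt (sdsFactor Λ M) (2 * M / r ^ 2 - 2 * Λ / 3 * r) r := by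
  have h1 : HasDerivAt (fun s : ℝ => s ^ 2) (2 * r) r := by simpa using hasDerivAt_pow 2 r
  refine (((((hasDerivAt_inv hr).const_mul (2 * M)).const_sub 1)).fun_sub
    (h1.const_mul (Λ / 3))).congr_deriv ?_
  field_simp

lemma sdsFactor_continuousOn (Λ M : ℝ) : ContinuousOn (sdsFactor Λ M) (Ioi 0) :=
  fun _ hr => (sdsFactor_hasDerivAt Λ M (ne_of_gt hr)).continuousAt.continuousWithinAt

/-- The two one-sided conditions for a metric to be `C¹` in the Gauss coordinate at the
boundary. -/
lemma IsC1InGaussCoord.matching {Λ M c rb : ℝ} {ν a : ℝ → ℝ} {R : EReal} (hrb : 0 < rb)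
    (hR : (rb : EReal) < R) (hν : ContinuousOn ν (Icc 0 rb)) (ha : ContinuousOn a (Icc 0 rb))
    (hf : ∀ r : ℝ, rb ≤ r → (r : EReal) < R → 0 < sdsFactor Λ M r)
    (h : IsC1InGaussCoord R (joinedNu Λ M c rb ν) (joinedA Λ M rb a)) :
    Real.exp (-a rb) = sdsFactor Λ M rb ∧ Real.exp (ν rb + c) = sdsFactor Λ M rb := by
  obtain ⟨rad, hrad, hradc, hνc⟩ := h
  set χ := gaussCoord (joinedA Λ M rb a) with hχ
  have hfrb := hf rb le_rfl hR
  obtain ⟨b, hb1, hb2⟩ := EReal.lt_iff_exists_real_btwn.1 hR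
  have hb1 : rb < b := EReal.coe_lt_coe_iff.1 hb1
  have hrbS : rb ∈ posRadii R := ⟨hrb, hR⟩
  have hsubL : Ioc 0 rb ⊆ posRadii R := fun s hs =>
    ⟨hs.1, (EReal.coe_le_coe_iff.2 hs.2).trans_lt hR⟩
  have hsubR : Icc rb b ⊆ posRadii R := fun s hs =>
    ⟨hrb.trans_le hs.1, (EReal.coe_le_coe_iff.2 hs.2).trans_lt hb2⟩
  -- eL, and eR below, continue e^{a/2} continuously from either side of the boundary; their values
  -- at rb are the one-sided derivatives of χ.
  obtain ⟨eL, heL, hL⟩ := exists_continuous_eqOn hrb.le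
    (f := fun s => Real.exp (a s / 2)) (by fun_prop)
  have hlog : ContinuousOn (fun s => Real.log (sdsFactor Λ M s)) (Icc rb b) :=
    ((sdsFactor_continuousOn Λ M).mono fun s hs => hrb.trans_le hs.1).log
      fun s hs => (hf s hs.1 (hsubR hs).2).ne'
  obtain ⟨eR, heR, hR'⟩ := exists_continuous_eqOn hb1.le
    (f := fun s => Real.exp (-Real.log (sdsFactor Λ M s) / 2)) (by fun_prop)
  have hEL : ∀ u ∈ Icc 0 rb, EqOn eL (fun s => Real.exp (joinedA Λ M rb a s / 2)) (Ioo 0 u) :=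
    fun u hu s hs => by
      simp only [joinedA, glue_of_lt _ _ (hs.2.trans_le hu.2)]
      exact (hL ⟨hs.1.le, (hs.2.trans_le hu.2).le⟩).symm
  have hER : ∀ u ∈ Icc rb b, EqOn eR (fun s => Real.exp (joinedA Λ M rb a s / 2)) (Icc rb u) :=
    fun u hu s hs => by
      simp only [joinedA, glue_of_le _ _ hs.1]
      exact (hR' ⟨hs.1, hs.2.trans hu.2⟩).symm
  have hχL : ∀ u ∈ Icc 0 rb, χ u = ∫ s in (0 : ℝ)..u, eL s := fun u hu =>
    (intervalIntegral.integral_congr_Ioo_of_le hu.1 (hEL u hu)).symm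
  have hrbI : rb ∈ Icc 0 rb := right_mem_Icc.2 hrb.le
  have hχR : ∀ u ∈ Icc rb b, χ u = χ rb + ∫ s in rb..u, eR s := fun u hu => by
    have i1 : IntervalIntegrable (fun s => Real.exp (joinedA Λ M rb a s / 2))
        MeasureTheory.volume 0 rb := (heL.intervalIntegrable 0 rb).congr_uIoo (by
      rw [uIoo_of_le hrb.le]; exact hEL rb hrbI)
    have i2 : IntervalIntegrable (fun s => Real.exp (joinedA Λ M rb a s / 2))
        MeasureTheory.volume rb u := (heR.intervalIntegrable rb u).congr_uIoo (by
      rw [uIoo_of_le hu.1]; exact (hER u hu).mono Ioo_subset_Icc_self)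
    have e : ∫ s in rb..u, eR s = ∫ s in rb..u, Real.exp (joinedA Λ M rb a s / 2) :=
      intervalIntegral.integral_congr (by rw [uIcc_of_le hu.1]; exact hER u hu)
    rw [e, hχ, gaussCoord, gaussCoord, intervalIntegral.integral_add_adjacent_intervals i1 i2]
  have dL : HasDerivWithinAt χ (eL rb) (Ioc 0 rb) rb :=
    ((heL.integral_hasStrictDerivAt 0 rb).hasDerivAt.hasDerivWithinAt).congr
      (fun u hu => hχL u (Ioc_subset_Icc_self hu)) (hχL rb hrbI)
  have dR : HasDerivWithinAt χ (eR rb) (Icc rb b) rb :=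
    (((heR.integral_hasStrictDerivAt rb rb).hasDerivAt.const_add (χ rb)).hasDerivWithinAt).congr
      (fun u hu => hχR u hu) (hχR rb (left_mem_Icc.2 hb1.le))
  -- The single derivative d of r(χ) times each one-sided derivative of χ is 1, so the latter
  -- coincide and e^a is continuous at rb.
  obtain ⟨d, hd⟩ : ∃ d, HasDerivWithinAt rad d (χ '' posRadii R) (χ rb) :=
    ⟨_, ((hradc.differentiableOn (by simp)) (χ rb) (mem_image_of_mem χ hrbS)).hasDerivWithinAt⟩
  have cL : d * eL rb = 1 := by
    have h1 := hd.comp rb dL fun s hs => mem_image_of_mem χ (hsubL hs)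
    have h2 : HasDerivWithinAt id (d * eL rb) (Ioc 0 rb) rb :=
      h1.congr (fun s hs => (hrad s (hsubL hs)).symm) (hrad rb hrbS).symm
    exact (uniqueDiffOn_Ioc 0 rb rb ⟨hrb, le_rfl⟩).eq_deriv _ h2 (hasDerivWithinAt_id _ _)
  have cR : d * eR rb = 1 := by
    have h1 := hd.comp rb dR fun s hs => mem_image_of_mem χ (hsubR hs)
    have h2 : HasDerivWithinAt id (d * eR rb) (Icc rb b) rb :=
      h1.congr (fun s hs => (hrad s (hsubR hs)).symm) (hrad rb hrbS).symm
    exact (uniqueDiffOn_Icc hb1 rb (left_mem_Icc.2 hb1.le)).eq_deriv _ h2 (hasDerivWithinAt_id _ _)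
  have hd0 : d ≠ 0 := left_ne_zero_of_mul_eq_one cL
  have heq : eL rb = eR rb := mul_left_cancel₀ hd0 (cL.trans cR.symm)
  rw [← hL hrbI, ← hR' (left_mem_Icc.2 hb1.le)] at heq
  have heq' := Real.exp_injective heq
  constructor
  · rw [show -a rb = Real.log (sdsFactor Λ M rb) by linarith, Real.exp_log hfrb]
  -- Here only the continuity of e^ν in χ is used: its limit from inside must be the exterior value
  -- f(rb).
  · have k1 : Tendsto (fun s => Real.exp (joinedNu Λ M c rb ν s)) (𝓝[Ioo 0 rb] rb)
        (𝓝 (sdsFactor Λ M rb)) := by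
      have h1 := (hνc.continuousOn (χ rb) (mem_image_of_mem χ hrbS)).comp dL.continuousWithinAt
        fun s hs => mem_image_of_mem χ (hsubL hs)
      have h2 : ContinuousWithinAt (fun s => Real.exp (joinedNu Λ M c rb ν s)) (Ioc 0 rb) rb :=
        h1.congr (fun s hs => by simp only [Function.comp, hrad s (hsubL hs)])
          (by simp only [Function.comp, hrad rb hrbS])
      have h3 := h2.mono_left (nhdsWithin_mono rb Ioo_subset_Ioc_self)
      simpa only [joinedNu, glue_of_le _ _ (le_refl rb), Real.exp_log hfrb] using h3
    have k2 : Tendsto (fun s => Real.exp (joinedNu Λ M c rb ν s)) (𝓝[Ioo 0 rb] rb)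
        (𝓝 (Real.exp (ν rb + c))) := by
      have h1 : Tendsto (fun s => Real.exp (ν s + c)) (𝓝[Ioo 0 rb] rb)
          (𝓝 (Real.exp (ν rb + c))) :=
        Tendsto.mono_left (Real.continuous_exp.continuousAt.tendsto.comp
          ((hν rb hrbI).tendsto.add_const c)) (nhdsWithin_mono rb Ioo_subset_Icc_self)
      refine h1.congr' ?_
      filter_upwards [self_mem_nhdsWithin] with s hs
      rw [joinedNu, glue_of_lt _ _ hs.2]
    have : (𝓝[Ioo 0 rb] rb).NeBot := by
      rw [nhdsWithin_Ioo_eq_nhdsLT hrb]; infer_instance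
    exact tendsto_nhds_unique k2 k1

end

/-! ### The exterior Schwarzschild-(anti-)de Sitter field. -/

section

variable {eos : ℝ → ℝ} {Λ Pc : ℝ} {R : EReal} {p : ℝ → ℝ}

lemma MetricDerivs.congr {ν a ν' a' ν1 ν2 a1 : ℝ → ℝ} {S T : Set ℝ} {c : ℝ}
    (h : MetricDerivs ν a ν1 ν2 a1 S) (hT : IsOpen T) (hTS : T ⊆ S)
    (hν : EqOn ν' (fun r => ν r + c) T) (ha : EqOn a' a T) : MetricDerivs ν' a' ν1 ν2 a1 T :=
  ⟨hT, fun r hr => h.pos r (hTS hr),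
    fun r hr => ((h.nu r (hTS hr)).add_const c).congr_of_eventuallyEq
      (hν.eventuallyEq_of_mem (hT.mem_nhds hr)),
    fun r hr => h.nu' r (hTS hr),
    fun r hr => (h.a r (hTS hr)).congr_of_eventuallyEq (ha.eventuallyEq_of_mem (hT.mem_nhds hr))⟩

/-- The derivative of `sdsFactor`. -/
def sdsSlope (Λ M r : ℝ) : ℝ := 2 * M / r ^ 2 - 2 * Λ / 3 * r

lemma sdsSlope_hasDerivAt (Λ M : ℝ) {r : ℝ} (hr : r ≠ 0) :
    HasDerivAt (sdsSlope Λ M) (-4 * M / r ^ 3 - 2 * Λ / 3) r := by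
  have h1 : HasDerivAt (fun s : ℝ => s ^ 2) (2 * r) r := by simpa using hasDerivAt_pow 2 r
  refine (((h1.fun_inv (pow_ne_zero 2 hr)).const_mul (2 * M)).fun_sub
    ((hasDerivAt_id' r).const_mul (2 * Λ / 3))).congr_deriv ?_
  field_simp
  ring

lemma sdsLog_hasDerivAt {M r : ℝ} (hr : 0 < r) (hf : 0 < sdsFactor Λ M r) :
    HasDerivAt (fun s => Real.log (sdsFactor Λ M s)) (sdsSlope Λ M r / sdsFactor Λ M r) r :=
  (sdsFactor_hasDerivAt Λ M hr.ne').log hf.ne'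

lemma sds_metricDerivs {M : ℝ} {S : Set ℝ} (hS : IsOpen S) (hpos : ∀ r ∈ S, 0 < r)
    (hf : ∀ r ∈ S, 0 < sdsFactor Λ M r) :
    MetricDerivs (fun r => Real.log (sdsFactor Λ M r)) (fun r => -Real.log (sdsFactor Λ M r))
      (fun r => sdsSlope Λ M r / sdsFactor Λ M r)
      (fun r => ((-4 * M / r ^ 3 - 2 * Λ / 3) * sdsFactor Λ M r - sdsSlope Λ M r * sdsSlope Λ M r) /
        sdsFactor Λ M r ^ 2)
      (fun r => -(sdsSlope Λ M r / sdsFactor Λ M r)) S :=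
  ⟨hS, hpos, fun r hr => sdsLog_hasDerivAt (hpos r hr) (hf r hr),
    fun r hr => (sdsSlope_hasDerivAt Λ M (hpos r hr).ne').fun_div
      (sdsFactor_hasDerivAt Λ M (hpos r hr).ne') (hf r hr).ne',
    fun r hr => (sdsLog_hasDerivAt (hpos r hr) (hf r hr)).fun_neg⟩

/-- The Schwarzschild-(anti-)de Sitter metric solves the vacuum field equations. -/
theorem sds_vacuum {M : ℝ} {S : Set ℝ} {ν a : ℝ → ℝ} (hS : IsOpen S) (hpos : ∀ r ∈ S, 0 < r)
    (hf : ∀ r ∈ S, 0 < sdsFactor Λ M r)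
    (hν : EqOn ν (fun r => Real.log (sdsFactor Λ M r)) S)
    (ha : EqOn a (fun r => -Real.log (sdsFactor Λ M r)) S) :
    FieldEquations Λ ν a (fun _ => 0) (fun _ => 0) S := by
  refine (fieldEquations_iff ((sds_metricDerivs hS hpos hf).congr (c := 0) hS Subset.rfl
    (fun r hr => (hν hr).trans (add_zero _).symm) ha) Λ _ _).2 fun r hr => ?_
  have e : Real.exp (-a r) = sdsFactor Λ M r := by rw [ha hr, neg_neg, Real.exp_log (hf r hr)]
  have hr0 := (hpos r hr).ne'
  have hf0 := (hf r hr).ne'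
  have eF : sdsFactor Λ M r = 1 - 2 * M / r - Λ / 3 * r ^ 2 := rfl
  have eG : sdsSlope Λ M r = 2 * M / r ^ 2 - 2 * Λ / 3 * r := rfl
  rw [e]
  refine ⟨?_, ?_, ?_⟩
  · field_simp
    rw [eF, eG]
    field_simp
    ring
  · field_simp
    rw [eF, eG]
    field_simp
    ring
  · field_simp
    rw [eG]
    field_simp
    ring

lemma sdsFactor_injective {M M' r : ℝ} (hr : 0 < r) (h : sdsFactor Λ M r = sdsFactor Λ M' r) :
    M = M' := by
  unfold sdsFactor at h
  have : 2 * M / r = 2 * M' / r := by linarith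
  field_simp at this
  linarith

/-- For `Λ ≤ 0` the exterior metric stays static for all larger radii. -/
lemma sdsFactor_pos_of_nonpos {M rb r : ℝ} (hΛ : Λ ≤ 0) (hM : 0 ≤ M) (hrb : 0 < rb) (hr : rb ≤ r)
    (h : 0 < sdsFactor Λ M rb) : 0 < sdsFactor Λ M r := by
  refine h.trans_le ?_
  unfold sdsFactor
  have h1 : 2 * M / r ≤ 2 * M / rb := by gcongr
  have h2 : Λ / 3 * r ^ 2 ≤ Λ / 3 * rb ^ 2 := by
    have : rb ^ 2 ≤ r ^ 2 := by gcongr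
    nlinarith
  linarith

/-- For `Λ > 0` the static region ends at a horizon. -/
lemma exists_horizon {M rb : ℝ} (hΛ : 0 < Λ) (hM : 0 ≤ M) (hrb : 0 < rb)
    (h : 0 < sdsFactor Λ M rb) : ∃ rh, rb < rh ∧ sdsFactor Λ M rh = 0 ∧
      ∀ r, rb ≤ r → r < rh → 0 < sdsFactor Λ M r := by
  have hc : ContinuousOn (sdsFactor Λ M) (Ici rb) :=
    (sdsFactor_continuousOn Λ M).mono fun r hr => hrb.trans_le hr
  -- The horizon is the first point of this closed set. It is nonempty since Λr²/3 ≥ 1 as soon as r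
  -- ≥ 3/Λ + 1.
  set Z := Ici rb ∩ sdsFactor Λ M ⁻¹' Iic 0 with hZ
  have hcl : IsClosed Z := hc.preimage_isClosed_of_isClosed isClosed_Ici isClosed_Iic
  have hne : Z.Nonempty := by
    refine ⟨max rb (3 / Λ + 1), mem_Ici.2 (le_max_left _ _), ?_⟩
    set r := max rb (3 / Λ + 1)
    have h1 : 3 / Λ + 1 ≤ r := le_max_right _ _
    have h0 : 0 < 3 / Λ := by positivity
    have h2 : 0 ≤ 2 * M / r := div_nonneg (by linarith) (by linarith)
    have h3 : 3 / Λ ≤ r ^ 2 := by nlinarith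
    have h4 : 1 ≤ Λ / 3 * r ^ 2 := by
      rw [div_le_iff₀ hΛ] at h3
      linarith
    simp only [mem_preimage, mem_Iic, sdsFactor]
    linarith
  have hbdd : BddBelow Z := ⟨rb, fun r hr => hr.1⟩
  have hmem : sInf Z ∈ Z := hcl.csInf_mem hne hbdd
  have hlt : rb < sInf Z := lt_of_le_of_ne hmem.1 fun he => by
    have h0 := hmem.2
    rw [← he] at h0
    exact absurd h (not_lt.2 h0)
  have hpos : ∀ r, rb ≤ r → r < sInf Z → 0 < sdsFactor Λ M r := fun r h1 h2 => by
    by_contra hn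
    exact absurd (csInf_le hbdd (show r ∈ Z from ⟨h1, not_lt.1 hn⟩)) (not_le.2 h2)
  refine ⟨sInf Z, hlt, le_antisymm hmem.2 ?_, hpos⟩
  have hcw : ContinuousWithinAt (sdsFactor Λ M) (Ico rb (sInf Z)) (sInf Z) :=
    (hc _ hmem.1).mono fun r hr => hr.1
  have : (𝓝[Ico rb (sInf Z)] (sInf Z)).NeBot := by
    rw [nhdsWithin_Ico_eq_nhdsLT hlt]; infer_instance
  exact ge_of_tendsto hcw (eventually_mem_nhdsWithin.mono fun r hr => (hpos r hr.1 hr.2).le)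

namespace IsMaximal

variable {rb : ℝ}

lemma bdry_pos (hp : IsMaximal eos Λ Pc rb p) : 0 < rb := by exact_mod_cast hp.pos

lemma bdry_nonneg (hp : IsMaximal eos Λ Pc rb p) : ∀ x ∈ Icc 0 (rb ^ 2), 0 ≤ p x := by
  intro x hx
  rcases hx.2.lt_or_eq with h | h
  · have hs : √x < rb := (Real.sqrt_lt' hp.bdry_pos).2 h
    have := hp.pressure_pos ⟨Real.sqrt_nonneg x, EReal.coe_lt_coe_iff.2 hs⟩
    rw [Real.sq_sqrt hx.1] at this
    exact this.le
  · rw [h, (hp.boundary rb rfl).2.1]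

lemma bdry_lapse_pos (hp : IsMaximal eos Λ Pc rb p) :
    ∀ x ∈ Icc 0 (rb ^ 2), 0 < lapse eos Λ p x := by
  intro x hx
  rcases hx.2.lt_or_eq with h | h
  · have hs : √x < rb := (Real.sqrt_lt' hp.bdry_pos).2 h
    have := hp.lapse_pos ⟨Real.sqrt_nonneg x, EReal.coe_lt_coe_iff.2 hs⟩
    rwa [Real.sq_sqrt hx.1] at this
  · rw [h]
    exact (hp.boundary rb rfl).2.2

lemma sq_mapsTo : MapsTo (fun r : ℝ => r ^ 2) (Icc 0 rb) (Icc 0 (rb ^ 2)) := fun r hr =>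
  ⟨sq_nonneg r, pow_le_pow_left₀ hr.1 hr.2 2⟩

lemma bdry_lapse_continuousOn (heos : IsEquationOfState eos) (hp : IsMaximal eos Λ Pc rb p) :
    ContinuousOn (lapse eos Λ p) (Icc 0 (rb ^ 2)) :=
  lapse_continuousOn heos le_rfl (sq_nonneg rb) (hp.boundary rb rfl).1 hp.bdry_nonneg

lemma bdry_rate_continuousOn (heos : IsEquationOfState eos) (hp : IsMaximal eos Λ Pc rb p) :
    ContinuousOn (fun x => force eos Λ p x / lapse eos Λ p x) (Icc 0 (rb ^ 2)) :=
  (force_continuousOn heos le_rfl (sq_nonneg rb) (hp.boundary rb rfl).1 hp.bdry_nonneg).div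
    (hp.bdry_lapse_continuousOn heos) fun x hx => (hp.bdry_lapse_pos x hx).ne'

lemma aOf_continuousOn (heos : IsEquationOfState eos) (hp : IsMaximal eos Λ Pc rb p) :
    ContinuousOn (aOf eos Λ p) (Icc 0 rb) :=
  (((hp.bdry_lapse_continuousOn heos).comp (by fun_prop) sq_mapsTo).log fun r hr =>
    (hp.bdry_lapse_pos _ (sq_mapsTo hr)).ne').neg

lemma nuOf_continuousOn (heos : IsEquationOfState eos) (hp : IsMaximal eos Λ Pc rb p) :
    ContinuousOn (nuOf eos Λ p) (Icc 0 rb) := by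
  have h : ContinuousOn (potential eos Λ p) (uIcc 0 (rb ^ 2)) := by
    refine intervalIntegral.continuousOn_primitive_interval ?_
    rw [uIcc_of_le (sq_nonneg rb)]
    exact (hp.bdry_rate_continuousOn heos).integrableOn_Icc
  rw [uIcc_of_le (sq_nonneg rb)] at h
  exact h.comp (by fun_prop) sq_mapsTo

lemma slope_continuousOn (heos : IsEquationOfState eos) (hp : IsMaximal eos Λ Pc rb p) :
    ContinuousOn (fun r => 2 * r * (force eos Λ p (r ^ 2) / lapse eos Λ p (r ^ 2))) (Icc 0 rb) :=
  ContinuousOn.mul (by fun_prop) ((hp.bdry_rate_continuousOn heos).comp (by fun_prop) sq_mapsTo)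

lemma mass_eq (rb : ℝ) : mass eos (fun r => p (r ^ 2)) rb = rb ^ 3 * meanDensity eos p (rb ^ 2) := by
  rw [mass, ← cube_mul_moment (fun s => eos (p s)), meanDensity]
  ring

lemma mass_nonneg (heos : IsEquationOfState eos) (hp : IsMaximal eos Λ Pc rb p) :
    0 ≤ mass eos (fun r => p (r ^ 2)) rb := by
  refine mul_nonneg (by positivity) (intervalIntegral.integral_nonneg hp.bdry_pos.le fun r hr => ?_)
  exact mul_nonneg (sq_nonneg r) (heos.nonneg _ (hp.bdry_nonneg _ (sq_mapsTo hr)))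

lemma sdsFactor_bdry (hp : IsMaximal eos Λ Pc rb p) :
    sdsFactor Λ (mass eos (fun r => p (r ^ 2)) rb) rb = lapse eos Λ p (rb ^ 2) := by
  have := hp.bdry_pos.ne'
  rw [mass_eq, sdsFactor, lapse]
  field_simp
  ring

lemma sdsFactor_bdry_pos (hp : IsMaximal eos Λ Pc rb p) :
    0 < sdsFactor Λ (mass eos (fun r => p (r ^ 2)) rb) rb := by
  rw [hp.sdsFactor_bdry]
  exact (hp.boundary rb rfl).2.2

/-- Because the pressure vanishes at the boundary, the force there is M/rb³ - Λ/3, which is the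
vacuum value. Divided by f = Y, this says that ν' is continuous across rb. -/
lemma sdsSlope_bdry (hp : IsMaximal eos Λ Pc rb p) :
    sdsSlope Λ (mass eos (fun r => p (r ^ 2)) rb) rb = 2 * rb * force eos Λ p (rb ^ 2) := by
  have := hp.bdry_pos.ne'
  rw [mass_eq, sdsSlope, force, (hp.boundary rb rfl).2.1]
  field_simp
  ring

/-- The exterior field joined on at the boundary of the matter. -/
theorem isExteriorJoin (heos : IsEquationOfState eos) (hΛ : Λ < 4 * Real.pi * eos 0)
    (hp : IsMaximal eos Λ Pc rb p) {Re : EReal} (hlt : (rb : EReal) < Re)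
    (hstat : ∀ r : ℝ, rb ≤ r → (r : EReal) < Re →
      0 < sdsFactor Λ (mass eos (fun r => p (r ^ 2)) rb) r)
    (hmax : Re = ⊤ ∨ ∃ rh : ℝ, Re = (rh : EReal) ∧
      sdsFactor Λ (mass eos (fun r => p (r ^ 2)) rb) rh = 0) :
    IsExteriorJoin eos Λ rb (nuOf eos Λ p) (aOf eos Λ p) (fun r => p (r ^ 2))
      (mass eos (fun r => p (r ^ 2)) rb)
      (Real.log (sdsFactor Λ (mass eos (fun r => p (r ^ 2)) rb) rb) - nuOf eos Λ p rb) Re := by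
  set M := mass eos (fun r => p (r ^ 2)) rb with hM
  have hrb := hp.bdry_pos
  obtain ⟨ν2, a1, hm, hode⟩ := hp.exists_metricDerivs heos hΛ
  -- The rescaling of time that makes ν continuous at rb.
  set c := Real.log (sdsFactor Λ M rb) - nuOf eos Λ p rb with hc
  have hin : Ioo 0 rb ⊆ posRadii rb := fun r hr => ⟨hr.1, EReal.coe_lt_coe_iff.2 hr.2⟩
  have hlog : ∀ r ∈ posRadii Re ∩ Ici rb, HasDerivAt (fun s => Real.log (sdsFactor Λ M s))
      (sdsSlope Λ M r / sdsFactor Λ M r) r := fun r hr =>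
    sdsLog_hasDerivAt hr.1.1 (hstat r hr.2 hr.1.2)
  have hamatch : aOf eos Λ p rb = -Real.log (sdsFactor Λ M rb) := by
    rw [hp.sdsFactor_bdry, aOf]
  refine ⟨hlt, hstat, hmax, ?_, ?_, ?_⟩
  · have ha : EqOn (joinedA Λ M rb (aOf eos Λ p)) (aOf eos Λ p) (Ioo 0 rb) := fun r hr =>
      glue_of_lt _ _ hr.2
    have hν : EqOn (joinedNu Λ M c rb (nuOf eos Λ p)) (fun r => nuOf eos Λ p r + c) (Ioo 0 rb) :=
      fun r hr => glue_of_lt _ _ hr.2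
    refine (fieldEquations_iff (hm.congr isOpen_Ioo hin hν ha) Λ _ _).2 fun r hr => ?_
    rw [ha hr]
    exact hode r (hin hr)
  · refine sds_vacuum (M := M) (isOpen_Ioi.inter (isOpen_Iio.preimage continuous_coe_real_ereal))
      (fun r hr => hrb.trans hr.1) (fun r hr => hstat r hr.1.le hr.2)
      (fun r hr => glue_of_le _ _ hr.1.le) fun r hr => glue_of_le _ _ hr.1.le
  · have ha : ContinuousOn (joinedA Λ M rb (aOf eos Λ p)) (radii Re) := by
      refine glue_continuousOn (u := aOf eos Λ p)
        (v := fun r => -Real.log (sdsFactor Λ M r)) ?_ ?_ hamatch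
      · exact (hp.aOf_continuousOn heos).mono fun r hr => ⟨hr.1.1, hr.2⟩
      · exact fun r hr =>
          (hlog r ⟨⟨hrb.trans_le hr.2, hr.1.2⟩, hr.2⟩).fun_neg.continuousAt.continuousWithinAt
    refine isC1InGaussCoord ha ?_
    · refine glue_contDiffOn (u := fun r => nuOf eos Λ p r + c)
        (v := fun r => Real.log (sdsFactor Λ M r)) (v' := fun r => sdsSlope Λ M r / sdsFactor Λ M r)
        (u' := fun r => 2 * r * (force eos Λ p (r ^ 2) / lapse eos Λ p (r ^ 2))) (isOpen_posRadii Re) hrb ⟨hrb, hlt⟩ (fun r hr => hr.1)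
        (fun r hr => ⟨hr.1, (EReal.coe_lt_coe_iff.2 hr.2).trans hlt⟩)
        (fun r hr => (hm.nu r (hin hr)).add_const _)
        (((hp.nuOf_continuousOn heos).add continuousOn_const).mono Ioc_subset_Icc_self)
        ((hp.slope_continuousOn heos).mono Ioc_subset_Icc_self) hlog (fun r hr => ?_)
        (by simp only [hc]; ring) ?_
      · exact ((sdsSlope_hasDerivAt Λ M hr.1.1.ne').continuousAt.div
          (sdsFactor_hasDerivAt Λ M hr.1.1.ne').continuousAt
          (hstat r hr.2 hr.1.2).ne').continuousWithinAt
      · rw [hp.sdsFactor_bdry, hp.sdsSlope_bdry, mul_div_assoc]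

/-- For uniqueness, matching gives f(rb) = e^{-a(rb)}, hence M, and then c. Of two different end
radii the smaller would be a zero of f inside a region where f > 0. -/
theorem hasFiniteExtent (heos : IsEquationOfState eos) (hΛ : Λ < 4 * Real.pi * eos 0)
    (hp : IsMaximal eos Λ Pc rb p) {Re : EReal} (hlt : (rb : EReal) < Re)
    (hstat : ∀ r : ℝ, rb ≤ r → (r : EReal) < Re →
      0 < sdsFactor Λ (mass eos (fun r => p (r ^ 2)) rb) r)
    (hmax : Re = ⊤ ∨ ∃ rh : ℝ, Re = (rh : EReal) ∧
      sdsFactor Λ (mass eos (fun r => p (r ^ 2)) rb) rh = 0) :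
    HasFiniteExtent eos Λ rb (nuOf eos Λ p) (aOf eos Λ p) (fun r => p (r ^ 2)) rb Re := by
  have hrb := hp.bdry_pos
  refine ⟨rfl, ?_, _, hp.isExteriorJoin heos hΛ hlt hstat hmax, fun M' c' Re' h => ?_⟩
  · have h := ((hp.boundary rb rfl).1.comp (by fun_prop) sq_mapsTo) rb (right_mem_Icc.2 hrb.le)
    have h2 := h.mono_left (nhdsWithin_mono rb (Ioo_subset_Icc_self (a := (0 : ℝ))))
    rw [nhdsWithin_Ioo_eq_nhdsLT hrb] at h2
    simpa [Function.comp_def, (hp.boundary rb rfl).2.1] using h2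
  · obtain ⟨h1, h2⟩ := h.c1.matching hrb h.lt (hp.nuOf_continuousOn heos)
      (hp.aOf_continuousOn heos) h.static
    have hM : M' = mass eos (fun r => p (r ^ 2)) rb := by
      refine sdsFactor_injective hrb (h1.symm.trans ?_)
      rw [hp.sdsFactor_bdry, aOf, neg_neg, Real.exp_log (hp.boundary rb rfl).2.2]
    subst hM
    refine ⟨rfl, ?_, ?_⟩
    · rw [← h2, Real.log_exp]
      ring
    · rcases lt_trichotomy Re' Re with hlt' | he | hlt'
      · obtain h0 | ⟨rh, rfl, h0⟩ := h.maximal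
        · exact absurd hlt' (by simp [h0])
        · exact absurd h0 (hstat rh (EReal.coe_lt_coe_iff.1 h.lt).le hlt').ne'
      · exact he
      · obtain h0 | ⟨rh, rfl, h0⟩ := hmax
        · exact absurd hlt' (by simp [h0])
        · exact absurd h0 (h.static rh (EReal.coe_lt_coe_iff.1 hlt).le hlt').ne'

end IsMaximal

end

/-! ### Infinite or finite extent. -/

section

variable {eos : ℝ → ℝ} {Λ Pc : ℝ} {R : EReal} {p : ℝ → ℝ}

namespace IsMaximal

/-- With a positive cosmological constant the matter cannot fill the whole space. -/
lemma ne_top (heos : IsEquationOfState eos) (hΛ0 : 0 < Λ) (hp : IsMaximal eos Λ Pc R p) :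
    R ≠ ⊤ := by
  rintro rfl
  -- At this radius Λr²/3 = 1, so a nonnegative mean density would make the lapse nonpositive.
  set r := √(3 / Λ)
  have hr : r ^ 2 = 3 / Λ := Real.sq_sqrt (by positivity)
  have hm : r ∈ radii ⊤ := ⟨Real.sqrt_nonneg _, EReal.coe_lt_top r⟩
  have hc := hp.core r hm.1 hm.2
  have hw := IsSol.le_meanDensity heos (right_mem_Icc.2 (sq_nonneg r)) hc.cont
    (fun s hs => (hc.pos s hs).le) (c := 0) fun s hs => heos.nonneg _ (hc.pos s hs).le
  have hl := hp.lapse_pos hm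
  rw [lapse, hr] at hl
  rw [hr] at hw
  have h1 : Λ / 3 * (3 / Λ) = 1 := by field_simp
  have h2 : 0 ≤ meanDensity eos p (3 / Λ) * (3 / Λ) :=
    mul_nonneg (by linarith) (by positivity)
  linarith

/-- The pressure is decreasing and positive, so it converges to its infimum. The limit may be 0, so
the density limit uses continuity of the equation of state within p ≥ 0. -/
theorem fillsSpace (heos : IsEquationOfState eos) (hΛ : Λ < 4 * Real.pi * eos 0)
    (hp : IsMaximal eos Λ Pc ⊤ p) : FillsSpace eos ⊤ (fun r => p (r ^ 2)) := by
  have hmem : ∀ r : ℝ, 0 ≤ r → r ∈ radii ⊤ := fun r hr => ⟨hr, EReal.coe_lt_top r⟩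
  have hmax : ∀ r : ℝ, max r 0 ∈ radii ⊤ := fun r => hmem _ (le_max_right _ _)
  have hanti : Antitone fun r : ℝ => p (max r 0 ^ 2) := fun r s hrs =>
    (hp.strictAntiOn heos hΛ).antitoneOn (hmax r) (hmax s) (max_le_max_right 0 hrs)
  have hbdd : BddBelow (range fun r : ℝ => p (max r 0 ^ 2)) :=
    ⟨0, by rintro _ ⟨r, rfl⟩; exact (hp.pressure_pos (hmax r)).le⟩
  have h1 := tendsto_atTop_ciInf hanti hbdd
  have h0 : 0 ≤ ⨅ r : ℝ, p (max r 0 ^ 2) := le_ciInf fun r => (hp.pressure_pos (hmax r)).le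
  have h2 : Tendsto (fun r => p (r ^ 2)) atTop (𝓝 (⨅ r : ℝ, p (max r 0 ^ 2))) := by
    refine h1.congr' ?_
    filter_upwards [eventually_ge_atTop 0] with r hr
    rw [max_eq_left hr]
  refine ⟨rfl, _, h0, h2, (heos.continuousOn _ h0).tendsto.comp
    (tendsto_nhdsWithin_iff.2 ⟨h2, ?_⟩)⟩
  filter_upwards [eventually_ge_atTop 0] with r hr using (hp.pressure_pos (hmem r hr)).le

theorem isInextendible (heos : IsEquationOfState eos) (hΛ : Λ < 4 * Real.pi * eos 0)
    (hp : IsMaximal eos Λ Pc R p) :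
    IsInextendible eos Λ Pc R (nuOf eos Λ p) (aOf eos Λ p) (fun r => p (r ^ 2)) :=
  ⟨hp.isFluidSolution heos hΛ, fun _ _ _ _ h hle _ _ _ => (hp.eqOn heos hΛ h).1.antisymm hle⟩

end IsMaximal

end

end StaticFluid

end

theorem mainTheorem1 (eos : ℝ → ℝ) (heos : StaticFluid.IsEquationOfState eos)
    (Λ : ℝ) (hΛ : Λ < 4 * Real.pi * eos 0) (Pc : ℝ) (hPc : 0 < Pc) :
    ∃ (R : EReal) (ν a P : ℝ → ℝ),
      StaticFluid.IsInextendible eos Λ Pc R ν a P ∧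
      (∀ (R' : EReal) (ν' a' P' : ℝ → ℝ), StaticFluid.IsInextendible eos Λ Pc R' ν' a' P' →
        R' = R ∧ Set.EqOn ν' ν (StaticFluid.radii R) ∧ Set.EqOn a' a (StaticFluid.radii R) ∧
          Set.EqOn P' P (StaticFluid.radii R)) ∧
      StaticFluid.IsSmoothOnBall R ν a P ∧
      StrictAntiOn P (StaticFluid.radii R) ∧
      (Λ ≤ 0 → StaticFluid.FillsSpace eos R P ∨
        ∃ rb : ℝ, StaticFluid.HasFiniteExtent eos Λ R ν a P rb ⊤) ∧
      (0 < Λ → ∃ rb rh : ℝ, StaticFluid.HasFiniteExtent eos Λ R ν a P rb (rh : EReal)) := by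
  obtain ⟨R, p, hp⟩ := StaticFluid.exists_isMaximal heos hΛ hPc
  refine ⟨R, StaticFluid.nuOf eos Λ p, StaticFluid.aOf eos Λ p, fun r => p (r ^ 2),
    hp.isInextendible heos hΛ, fun R' ν' a' P' h => ?_, hp.isSmoothOnBall heos,
    hp.strictAntiOn heos hΛ, fun hΛ0 => ?_, fun hΛ0 => ?_⟩
  · obtain ⟨hle, h1, h2, h3⟩ := hp.eqOn heos hΛ h.solution
    -- An inextendible solution is a restriction of the maximal one, so its own inextendibility
    -- makes the radii equal.
    obtain rfl := h.maximal R _ _ _ (hp.isFluidSolution heos hΛ) hle h1.symm h2.symm h3.symm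
    exact ⟨rfl, h1, h2, h3⟩
  · induction R with
    | bot => exact absurd hp.pos (by simp)
    | top => exact Or.inl (hp.fillsSpace heos hΛ)
    | coe rb =>
      exact Or.inr ⟨rb, hp.hasFiniteExtent heos hΛ (EReal.coe_lt_top rb)
        (fun r hr _ => StaticFluid.sdsFactor_pos_of_nonpos hΛ0 (hp.mass_nonneg heos) hp.bdry_pos hr
          hp.sdsFactor_bdry_pos) (Or.inl rfl)⟩
  · induction R with
    | bot => exact absurd hp.pos (by simp)
    | top => exact absurd rfl (hp.ne_top heos hΛ0)
    | coe rb =>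
      obtain ⟨rh, h1, h2, h3⟩ := StaticFluid.exists_horizon hΛ0 (hp.mass_nonneg heos) hp.bdry_pos
        hp.sdsFactor_bdry_pos
      exact ⟨rb, rh, hp.hasFiniteExtent heos hΛ (EReal.coe_lt_coe_iff.2 h1)
        (fun r hr hr' => h3 r hr (EReal.coe_lt_coe_iff.1 hr')) (Or.inr ⟨rh, rfl, h2⟩)⟩
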